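/- All groups are finite. $\operatorname{Irr}(X)$ is the set of irreducible complex characters of $X$, and $\operatorname{Irr}_{p'}(X)$ the subset of those of degree not divisible by $p$. For $Y\le X$, $\chi\in\operatorname{Irr}(X)$ and $\theta\in\operatorname{Irr}(Y)$, $\operatorname{Irr}(Y\mid\chi)$ is the set of irreducible constituents of $\chi|_Y$ and $\operatorname{Irr}(X\mid\theta)$ that of the induced character $\theta^X$. Subscripts denote stabilizers. For $X_1\lhd X_2$, maximal extensibility holds if every $\chi\in\operatorname{Irr}(X_1)$ extends to its inertia group in $X_2$. **Inductive McKay condition.** Let $S$ be a non-abelian simple group, $p$ a prime with $p\mid |S|$, $G$ the maximal perfect central extension (universal covering group) of $S$ and $Q$ a Sylow $p$-subgroup of $G$. Then $S$ satisfies the inductive McKay condition for $p$ if there are an $\operatorname{Aut}(G)_Q$-stable subgroup $N\ne G$ of $G$ with $N_G(Q)\le N$ and an $\operatorname{Aut}(G)_Q$-equivariant bijection $\Omega:\operatorname{Irr}_{p'}(G)\to\operatorname{Irr}_{p'}(N)$ with $\Omega(\operatorname{Irr}_{p'}(G)\cap\operatorname{Irr}(G\mid\nu))=\operatorname{Irr}_{p'}(N)\cap\operatorname{Irr}(N\mid\nu)$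 for all $\nu\in\operatorname{Irr}(Z(G))$, such that for every $\chi\in\operatorname{Irr}_{p'}(G)$ the pair $(\chi,\psi)$ with $\psi=\Omega(\chi)$ satisfies: 1. $\operatorname{Irr}(Z(G)\mid\chi)=\operatorname{Irr}(Z(G)\mid\psi)$ and $\operatorname{Aut}(G)_{N,\chi}=\operatorname{Aut}(G)_{N,\psi}$; 2. for $\overline G=G/\ker(\chi|_{Z(G)})$ and $\overline N=N/\ker(\chi|_{Z(G)})$ there is a group $A$ with $\overline G\lhd A$, $A_\chi=A$, $C:=C_A(\overline G)$ abelian and $A/\overline GC=\operatorname{Out}(\overline G)_\chi$, and an $A$-invariant $\epsilon\in\operatorname{Irr}(C)$ with $\operatorname{Irr}(Z(\overline G)\mid\epsilon)=\operatorname{Irr}(Z(\overline G)\mid\chi)$, such that $[\chi\cdot\epsilon]$ and $[\psi\cdot\epsilon]$ in the Schur multipliers of $A/\overline GC$ and $N_A(\overline N)/\overline NC$ coincide under the natural isomorphism $N_A(\overline N)/\overline NC\cong A/\overline GC$. Here $\chi\cdot\epsilon$ is the character $gc\mapsto\chi(g)\epsilon(c)$ of $\overline GC$ (similarly $\psi\cdot\epsilon$),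 and for $K\lhd M$ and an $M$-invariant $\theta\in\operatorname{Irr}(K)$, $[\theta]$ is the class in $H^2(M/K,\mathbb C^\times)$ of the factor set of a projective representation of $M$ whose restriction to $K$ is a linear representation affording $\theta$ and whose factor set is constant on $K$-cosets. **Theorem.** Let $G$ be the maximal perfect central extension of a non-abelian simple group $S$, and $Q$ a Sylow $p$-subgroup of $G$ for a prime $p$ with $p\mid|S|$. Assume the following. (i) There are groups $\tilde G$ and $D$ with $G\lhd\tilde G$ such that $\tilde G\rtimes D$ is defined, $\tilde G/G$ is abelian, $C_{\tilde G\rtimes D}(G)=Z(\tilde G)$, $G\lhd\tilde G\rtimes D$, and $\tilde G\rtimes D$ induces on $G$ all automorphisms of $G$. (ii) There is a $(\tilde G\rtimes D)_Q$-stable subgroup $N$ of $G$ with $N_G(Q)\le N\ne G$. (iii) Maximal extensibility holds for $G\lhd\tilde G$ and for $N\lhd\tilde N:=N_{\tilde G}(N)$. (iv) Put $\mathcal G=\{\chi\in\operatorname{Irr}(\tilde G)\mid\operatorname{Irr}(G\mid\chi)\subseteq\operatorname{Irr}_{p'}(G)\}$ and $\mathcal N=\{\psi\in\operatorname{Irr}(\tilde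 N)\mid\operatorname{Irr}(N\mid\psi)\subseteq\operatorname{Irr}_{p'}(N)\}$. There is a $(\tilde G\rtimes D)_Q$-equivariant bijection $\tilde\Omega:\mathcal G\to\mathcal N$ such that $\tilde\Omega(\mathcal G\cap\operatorname{Irr}(\tilde G\mid\nu))=\mathcal N\cap\operatorname{Irr}(\tilde N\mid\nu)$ for every $\nu\in\operatorname{Irr}(Z(\tilde G))$, and $\tilde\Omega(\chi\lambda)=\tilde\Omega(\chi)\,\lambda|_{\tilde N}$ for every $\chi\in\mathcal G$ and every $\lambda\in\operatorname{Irr}(\tilde G/G)$. (v) For every $\chi\in\mathcal G$ there is some $\chi_0\in\operatorname{Irr}_{p'}(G)\cap\operatorname{Irr}(G\mid\chi)$ such that $(\tilde G\rtimes D)_{\chi_0}=\tilde G_{\chi_0}\rtimes D_{\chi_0}$ and $\chi_0$ extends to $(G\rtimes D)_{\chi_0}$. (vi) For every $\psi\in\mathcal N$ there is some $\psi_0\in\operatorname{Irr}(N\mid\psi)$ such that the group $O:=(\tilde G\rtimes D)_{N,\psi_0}\,G$ satisfies $O=(\tilde G\cap O)\rtimes(D\cap O)$ and $\psi_0$ extends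 to $(G\rtimes D)_{N,\psi_0}$. Then the inductive McKay condition holds for $S$ and $p$. -/

import Mathlib

universe u

noncomputable section

/-! ### Irreducible complex characters -/

/-- `Irr G` is the set of irreducible complex characters of `G`, i.e. of trace functions of
irreducible representations of `G` on some `ℂⁿ`. -/
structure Irr (G : Type*) [Group G] where
  toFun : G → ℂ
  isIrr : ∃ (n : ℕ) (ρ : Representation ℂ G (Fin n → ℂ)), ρ.IsIrreducible ∧ ρ.character = toFun

namespace Irr

instance {G : Type*} [Group G] : CoeFun (Irr G) (fun _ => G → ℂ) := ⟨Irr.toFun⟩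

@[ext] theorem ext {G : Type*} [Group G] {χ ψ : Irr G} (h : ∀ g, χ g = ψ g) : χ = ψ := by
  cases χ; cases ψ; congr; exact funext h

/-- Two representations on the same space with the same invariant subspaces are simultaneously
irreducible. -/
theorem isIrreducible_congr {G H V : Type*} [Group G] [Group H] [AddCommGroup V] [Module ℂ V]
    {ρ : Representation ℂ G V} {τ : Representation ℂ H V}
    (h : ∀ W : Submodule ℂ V,
      (∀ g, ∀ v ∈ W, ρ g v ∈ W) ↔ (∀ g, ∀ v ∈ W, τ g v ∈ W))
    (hρ : ρ.IsIrreducible) : τ.IsIrreducible := by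
  let e : Subrepresentation τ ≃o Subrepresentation ρ :=
    { toFun := fun W => ⟨W.toSubmodule, fun g v hv =>
        (h W.toSubmodule).2 (fun g v hv => W.apply_mem_toSubmodule g hv) g v hv⟩
      invFun := fun W => ⟨W.toSubmodule, fun g v hv =>
        (h W.toSubmodule).1 (fun g v hv => W.apply_mem_toSubmodule g hv) g v hv⟩
      left_inv := fun W => rfl
      right_inv := fun W => rfl
      map_rel_iff' := Iff.rfl }
  exact e.isSimpleOrder_iff.2 hρ

/-- The character `g ↦ χ (σ g)` for an automorphism `σ` of `G`. -/
def compAut {G : Type*} [Group G] (χ : Irr G) (σ : MulAut G) : Irr G where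
  toFun g := χ (σ g)
  isIrr := by
    obtain ⟨n, ρ, hρ, hχ⟩ := χ.isIrr
    refine ⟨n, ρ.comp (MulEquiv.toMonoidHom σ), ?_, ?_⟩
    · refine isIrreducible_congr (ρ := ρ)
        (fun W => ⟨fun hW g v hv => hW (σ g) v hv, fun hW g v hv => ?_⟩) hρ
      have h1 : ρ (σ (σ⁻¹ g)) v ∈ W := hW (σ⁻¹ g) v hv
      rwa [MulAut.apply_inv_self] at h1
    · funext g
      rw [← hχ]
      rfl

/-- The action of `Aut(G)` on `Irr(G)` by composition (written as a left action). -/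
instance {G : Type*} [Group G] : MulAction (MulAut G) (Irr G) where
  smul σ χ := χ.compAut σ⁻¹
  one_smul χ := by
    ext g
    change χ ((1 : MulAut G)⁻¹ g) = χ g
    simp
  mul_smul σ τ χ := by
    ext g
    change χ ((σ * τ)⁻¹ g) = χ (τ⁻¹ (σ⁻¹ g))
    rw [mul_inv_rev]
    rfl

/-- The product `χ λ` of an irreducible character with a linear character. -/
def twist {G : Type*} [Group G] (χ : Irr G) (l : G →* ℂˣ) : Irr G where
  toFun g := χ g * (l g : ℂ)
  isIrr := by
    obtain ⟨n, ρ, hρ, hχ⟩ := χ.isIrr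
    let τ : Representation ℂ G (Fin n → ℂ) :=
      { toFun := fun g => (l g : ℂ) • ρ g
        map_one' := by simp
        map_mul' := fun x y => by
          simp only [map_mul, Units.val_mul, smul_mul_assoc, mul_smul_comm, smul_smul]
          rw [mul_comm] }
    refine ⟨n, τ, ?_, ?_⟩
    · refine isIrreducible_congr (fun W => ⟨fun hW g v hv => W.smul_mem _ (hW g v hv),
        fun hW g v hv => ?_⟩) hρ
      exact (W.smul_mem_iff (Units.ne_zero (l g))).1 (hW g v hv)
    · funext g
      rw [← hχ]
      change LinearMap.trace ℂ _ ((l g : ℂ) • ρ g) = LinearMap.trace ℂ _ (ρ g) * _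
      rw [map_smul, smul_eq_mul, mul_comm]

/-- The degree `χ(1)` is not divisible by `p`; such characters form `Irr_{p'}(G)`. -/
def IsPPrime {G : Type*} [Group G] (p : ℕ) (χ : Irr G) : Prop :=
  ∃ n : ℕ, χ 1 = (n : ℂ) ∧ ¬ p ∣ n

/-- For an embedding `f : K → H` of finite groups: `θ ∈ Irr(K)` is a constituent of the
restriction of `χ ∈ Irr(H)` to `K` (that is, `θ ∈ Irr(K ∣ χ)`; by Frobenius reciprocity this is
the same as `χ ∈ Irr(H ∣ θ)`): the inner product of `χ|_K` and `θ` is nonzero. -/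
def LiesOver {H K : Type*} [Group H] [Group K] (f : K →* H) (χ : Irr H) (θ : Irr K) : Prop :=
  ∑ᶠ k : K, χ (f k) * (starRingEnd ℂ) (θ k) ≠ 0

/-! ### Characters of subgroups of a group `Γ` -/

section Subgroups

variable {Γ : Type*} [Group Γ]

/-- The conjugate of `θ ∈ Irr(H)` by an element `x` normalizing `H`. -/
def conj {H : Subgroup Γ} (x : Γ) (hx : x ∈ Subgroup.normalizer (H : Set Γ)) (θ : Irr H) : Irr H :=
  H.normalizerMonoidHom ⟨x, hx⟩ • θ

/-- The stabilizer in `Γ` of the pair `(H, θ)`, `θ ∈ Irr(H)`: all elements that normalize `H` and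
fix `θ`. For `H` normal in `Γ` this is the inertia group `Γ_θ`. -/
def inertia {H : Subgroup Γ} (θ : Irr H) : Subgroup Γ :=
  ((MulAction.stabilizer (MulAut H) θ).comap H.normalizerMonoidHom).map
    (Subgroup.normalizer (H : Set Γ)).subtype

/-- `θ ∈ Irr(H)` extends to the overgroup `K`: it is the restriction of some `η ∈ Irr(K)`. -/
def ExtendsTo {H : Subgroup Γ} (θ : Irr H) (K : Subgroup Γ) : Prop :=
  ∃ (h : H ≤ K) (η : Irr K), ∀ x : H, η (Subgroup.inclusion h x) = θ x

end Subgroups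

end Irr

/-- Maximal extensibility for `X₁ ⊲ X₂`: every irreducible character of `X₁` extends to its inertia
group in `X₂`. -/
def MaximalExtensibility {Γ : Type*} [Group Γ] (X₁ X₂ : Subgroup Γ) : Prop :=
  ∀ θ : Irr X₁, θ.ExtendsTo (X₂ ⊓ θ.inertia)

/-- The centre `Z(H)` of a subgroup `H ≤ Γ`, as a subgroup of `Γ`. -/
def centerOf {Γ : Type*} [Group Γ] (H : Subgroup Γ) : Subgroup Γ :=
  (Subgroup.center H).map H.subtype

/-- The normalizer `N_H(N)`, for subgroups `H`, `N` of `Γ`. -/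
def normalizerIn {Γ : Type*} [Group Γ] (H N : Subgroup Γ) : Subgroup Γ :=
  H ⊓ Subgroup.normalizer (N : Set Γ)

theorem centerOf_le {Γ : Type*} [Group Γ] (H : Subgroup Γ) : centerOf H ≤ H :=
  Subgroup.map_subtype_le _

theorem normalizerIn_le {Γ : Type*} [Group Γ] (H N : Subgroup Γ) : normalizerIn H N ≤ H :=
  inf_le_left

theorem le_normalizerIn {Γ : Type*} [Group Γ] {H N : Subgroup Γ} (h : N ≤ H) :
    N ≤ normalizerIn H N :=
  le_inf h Subgroup.le_normalizer

theorem centerOf_le_normalizerIn {Γ : Type*} [Group Γ] {H N : Subgroup Γ} (h : N ≤ H) :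
    centerOf H ≤ normalizerIn H N := by
  refine le_inf (centerOf_le H) ?_
  rintro _ ⟨z, hz, rfl⟩
  rw [Subgroup.mem_normalizer_iff]
  have key : ∀ n : Γ, n ∈ H → (z : Γ) * n * (z : Γ)⁻¹ = n := fun n hn => by
    have := congrArg Subtype.val (Subgroup.mem_center_iff.1 hz ⟨n, hn⟩)
    simp only [Subgroup.coe_mul] at this
    rw [← this, mul_inv_cancel_right]
  intro n
  constructor
  · intro hn
    change (z : Γ) * n * (z : Γ)⁻¹ ∈ N
    rwa [key n (h hn)]
  · intro hn
    change (z : Γ) * n * (z : Γ)⁻¹ ∈ N at hn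
    have hnH : n ∈ H := by
      have h1 : (z : Γ)⁻¹ * ((z : Γ) * n * (z : Γ)⁻¹) * z ∈ H :=
        H.mul_mem (H.mul_mem (H.inv_mem z.2) (h hn)) z.2
      simpa [mul_assoc] using h1
    rwa [key n hnH] at hn

theorem mem_normalizer_of_normal {Γ : Type*} [Group Γ] (H : Subgroup Γ) [H.Normal] (x : Γ) :
    x ∈ Subgroup.normalizer (H : Set Γ) := by
  rw [Subgroup.normalizer_eq_top]
  exact Subgroup.mem_top x

theorem mem_normalizer_normalizerIn {Γ : Type*} [Group Γ] (H : Subgroup Γ) [hH : H.Normal]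
    {N : Subgroup Γ} {x : Γ} (hx : x ∈ Subgroup.normalizer (N : Set Γ)) :
    x ∈ Subgroup.normalizer (normalizerIn H N : Set Γ) := by
  rw [Subgroup.mem_normalizer_iff]
  intro y
  simp only [normalizerIn, Subgroup.mem_inf]
  refine and_congr ?_ ?_
  · exact Subgroup.mem_normalizer_iff.1 (mem_normalizer_of_normal H x) y
  · constructor
    · intro hy
      exact Subgroup.mul_mem _ (Subgroup.mul_mem _ hx hy) (Subgroup.inv_mem _ hx)
    · intro hy
      have h1 := Subgroup.mul_mem _ (Subgroup.mul_mem _ (Subgroup.inv_mem _ hx) hy) hx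
      simpa [mul_assoc] using h1

/-! ### Universal covering groups -/

/-- `π : G → S` is the maximal perfect central extension (universal covering) of the finite group
`S`: `G` is perfect, `π` is surjective with central kernel, and every perfect central extension of
`S` is a quotient of `π`. (Perfect central extensions of a finite group are finite.) -/
structure IsUniversalCovering {G S : Type u} [Group G] [Group S] (π : G →* S) : Prop where
  perfect : Group.IsPerfect G
  surjective : Function.Surjective π
  central : π.ker ≤ Subgroup.center G
  universal : ∀ (H : Type u) [Group H] [Finite H] [Group.IsPerfect H] (τ : H →* S),
    Function.Surjective τ → τ.ker ≤ Subgroup.center H → ∃ φ : G →* H, τ.comp φ = π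

/-! ### Projective representations and cohomology classes -/

/-- Let `f : K → M` be the embedding of a normal subgroup and `θ ∈ Irr(K)`. Then `P` is a
projective representation of `M` whose restriction to `K` is a linear representation affording `θ`,
and its factor set `α`, given by `P x P y = α(x, y) P (xy)`, is constant on `K`-cosets.
The class of `α` in the Schur multiplier of `M / K` is the element `[θ]`. -/
structure IsAssociatedProjRep {K M : Type*} [Group K] [Group M] (f : K →* M) (θ : Irr K)
    {n : ℕ} (P : M → GL (Fin n) ℂ) (α : M → M → ℂˣ) : Prop where
  factorSet : ∀ x y, (P x : Matrix (Fin n) (Fin n) ℂ) * (P y : Matrix (Fin n) (Fin n) ℂ) =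
    (α x y : ℂ) • (P (x * y) : Matrix (Fin n) (Fin n) ℂ)
  linear : ∀ k l, P (f (k * l)) = P (f k) * P (f l)
  affords : ∀ k, (P (f k) : Matrix (Fin n) (Fin n) ℂ).trace = θ k
  coset : ∀ x y k l, α (x * f k) (y * f l) = α x y

/-- `α` is (the inflation to `M` of) a 2-cocycle of `M / K` representing the element `[θ]` of the
Schur multiplier of `M / K`. -/
def RepresentsClass {K M : Type*} [Group K] [Group M] (f : K →* M) (θ : Irr K)
    (α : M → M → ℂˣ) : Prop :=
  ∃ (n : ℕ) (P : M → GL (Fin n) ℂ), IsAssociatedProjRep f θ P α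

/-- Two 2-cocycles of `M / K` with values in `ℂˣ` (trivial action), given as functions on `M × M`
that are constant on `K`-cosets, differ by a coboundary of `M / K`. -/
def Cohomologous {K M : Type*} [Group K] [Group M] (f : K →* M) (α β : M → M → ℂˣ) : Prop :=
  ∃ μ : M → ℂˣ, (∀ x k, μ (x * f k) = μ x) ∧
    ∀ x y, β x y = α x y * (μ x * μ y * (μ (x * y))⁻¹)

/-- `θ` is the character `χ·ε` of `HC`, where `C` centralizes `H`, `χ ∈ Irr(H)` and `ε` is a linear
character of `C`: it is given by `hc ↦ χ(h) ε(c)`. -/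
def IsDotProduct {A : Type*} [Group A] {H C : Subgroup A} (χ : Irr H) (ε : Irr C)
    (θ : Irr (H ⊔ C : Subgroup A)) : Prop :=
  ∀ (h : H) (c : C), θ ⟨(h : A) * c, Subgroup.mul_mem_sup h.2 c.2⟩ = χ h * ε c

theorem sup_centralizer_le_normalizer {A : Type*} [Group A] {H N : Subgroup A} (h : N ≤ H) :
    N ⊔ Subgroup.centralizer (H : Set A) ≤ Subgroup.normalizer (N : Set A) := by
  refine sup_le Subgroup.le_normalizer ?_
  refine le_trans (Subgroup.centralizer_le ?_) (Subgroup.centralizer_le_normalizer _)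
  exact h

/-! ### The condition on cohomological elements -/

/-- The requirements on the overgroup `A` of `H` and on `χ ∈ Irr(H)`, `ψ ∈ Irr(N)`, `N ≤ H ⊲ A`:
`A` fixes `χ`, `C = C_A(H)` is abelian, `A` induces on `H` exactly the automorphisms in `Aut(H)_χ`
(that is, `A / HC = Out(H)_χ`), and for some `A`-invariant `ε ∈ Irr(C)` with
`Irr(Z(H) ∣ ε) = Irr(Z(H) ∣ χ)` (where `Z(H) = H ∩ C`) the elements `[χ·ε]` and `[ψ·ε]` of the
Schur multipliers of `A / HC` and `N_A(N) / NC` coincide under the natural map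
`N_A(N) / NC → A / HC`, i.e. the restriction to `N_A(N)` of a cocycle representing the first
represents the second. -/
structure IsCohomOvergroup {A : Type*} [Group A] {H N : Subgroup A} [H.Normal] (hNH : N ≤ H)
    (χ : Irr H) (ψ : Irr N) : Prop where
  invariant : ∀ a : A, MulAut.conjNormal (H := H) a • χ = χ
  abelian : ∀ x ∈ Subgroup.centralizer (H : Set A), ∀ y ∈ Subgroup.centralizer (H : Set A),
    x * y = y * x
  induces : ∀ σ : MulAut H, σ • χ = χ → ∃ a : A, MulAut.conjNormal (H := H) a = σ
  classes : ∃ ε : Irr (Subgroup.centralizer (H : Set A)),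
    (∀ a : A, MulAut.conjNormal (H := Subgroup.centralizer (H : Set A)) a • ε = ε) ∧
    (∀ ν : Irr (H ⊓ Subgroup.centralizer (H : Set A) : Subgroup A),
      ε.LiesOver (Subgroup.inclusion inf_le_right) ν ↔
        χ.LiesOver (Subgroup.inclusion inf_le_left) ν) ∧
    ∃ (θ : Irr (H ⊔ Subgroup.centralizer (H : Set A) : Subgroup A))
      (θ' : Irr (N ⊔ Subgroup.centralizer (H : Set A) : Subgroup A)),
      IsDotProduct χ ε θ ∧ IsDotProduct ψ ε θ' ∧
      ∃ (α : A → A → ℂˣ)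
        (α' : Subgroup.normalizer (N : Set A) → Subgroup.normalizer (N : Set A) → ℂˣ),
        RepresentsClass (Subgroup.subtype (H ⊔ Subgroup.centralizer (H : Set A))) θ α ∧
        RepresentsClass (Subgroup.inclusion (sup_centralizer_le_normalizer hNH)) θ' α' ∧
        Cohomologous (Subgroup.inclusion (sup_centralizer_le_normalizer hNH))
          (fun x y => α x y) α'

/-- The restriction to `N` of an automorphism of `G` stabilizing `N`. -/
def restrictAut {G : Type*} [Group G] (σ : MulAut G) (N : Subgroup G)
    (h : N.map (σ : G ≃* G).toMonoidHom = N) : MulAut N :=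
  (MulEquiv.subgroupMap σ N).trans (MulEquiv.subgroupCongr h)

/-- The pair `(χ, ψ)`, `χ ∈ Irr(G)`, `ψ ∈ Irr(N)`, `Z(G) ≤ N ≤ G`, satisfies the condition on
cohomological elements:
`Irr(Z(G) ∣ χ) = Irr(Z(G) ∣ ψ)`, `Aut(G)_{N,χ} = Aut(G)_{N,ψ}`, and for `Ḡ = G / ker(χ|_{Z(G)})`,
`N̄ = N / ker(χ|_{Z(G)})` there is a finite overgroup `A` of `Ḡ` as in `IsCohomOvergroup`. Here
`Ḡ ⊲ A` is given as the image of a homomorphism `ι : G → A` with kernel `ker(χ|_{Z(G)})`, and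
`χ'`, `ψ'` are `χ` and `ψ` regarded as characters of `Ḡ` and `N̄`. -/
structure Cohom {G : Type u} [Group G] {N : Subgroup G} (hZN : Subgroup.center G ≤ N)
    (χ : Irr G) (ψ : Irr N) : Prop where
  central : ∀ ν : Irr (Subgroup.center G),
    χ.LiesOver (Subgroup.center G).subtype ν ↔ ψ.LiesOver (Subgroup.inclusion hZN) ν
  stabilizer : ∀ (σ : MulAut G) (h : N.map (σ : G ≃* G).toMonoidHom = N),
    σ • χ = χ ↔ restrictAut σ N h • ψ = ψ
  overgroup : ∃ (A : Type u) (_ : Group A) (_ : Finite A) (ι : G →* A) (_ : ι.range.Normal),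
    (∀ g : G, ι g = 1 ↔ g ∈ Subgroup.center G ∧ χ g = χ 1) ∧
    ∃ (χ' : Irr ι.range) (ψ' : Irr (N.map ι)),
      (∀ g : G, χ' ⟨ι g, g, rfl⟩ = χ g) ∧
      (∀ g : N, ψ' ⟨ι g, g, g.2, rfl⟩ = ψ g) ∧
      IsCohomOvergroup (Subgroup.map_le_range ι N) χ' ψ'

/-! ### The inductive McKay condition -/

/-- The inductive McKay condition for the simple group `S` and the prime `p`. With `G` the
universal covering group of `S` and `Q` a Sylow `p`-subgroup of `G`, there are an
`Aut(G)_Q`-stable subgroup `N` with `N_G(Q) ≤ N ≠ G` and an `Aut(G)_Q`-equivariant bijection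
`Ω : Irr_{p'}(G) → Irr_{p'}(N)` preserving the characters of `Z(G)` lying below, such that every
pair `(χ, Ω(χ))` satisfies the condition on cohomological elements. -/
def InductiveMcKayCondition (S : Type u) [Group S] (p : ℕ) : Prop :=
  ∃ (G : Type u) (_ : Group G) (_ : Finite G) (π : G →* S) (Q : Sylow p G) (N : Subgroup G)
    (hQN : Subgroup.normalizer ((Q : Subgroup G) : Set G) ≤ N)
    (hN : ∀ σ : MulAut G, (Q : Subgroup G).map (σ : G ≃* G).toMonoidHom = Q →
      N.map (σ : G ≃* G).toMonoidHom = N)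
    (Ω : Irr G → Irr N),
    IsUniversalCovering π ∧ N ≠ ⊤ ∧
    Set.BijOn Ω {χ | χ.IsPPrime p} {ψ | ψ.IsPPrime p} ∧
    (∀ (σ : MulAut G) (hσ : (Q : Subgroup G).map (σ : G ≃* G).toMonoidHom = Q) (χ : Irr G),
      χ.IsPPrime p → Ω (σ • χ) = restrictAut σ N (hN σ hσ) • Ω χ) ∧
    (∀ ν : Irr (Subgroup.center G),
      Ω '' {χ | χ.IsPPrime p ∧ χ.LiesOver (Subgroup.center G).subtype ν} =
        {ψ | ψ.IsPPrime p ∧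
          ψ.LiesOver (Subgroup.inclusion ((Subgroup.center_le_normalizer _).trans hQN)) ν}) ∧
    ∀ χ : Irr G, χ.IsPPrime p →
      Cohom ((Subgroup.center_le_normalizer _).trans hQN) χ (Ω χ)

/-- For `X ≤ Y`: the set of all `χ ∈ Irr(Y)` with `Irr(X ∣ χ) ⊆ Irr_{p'}(X)`. -/
def pPrimeBelow {Γ : Type*} [Group Γ] (p : ℕ) {X Y : Subgroup Γ} (h : X ≤ Y) : Set (Irr Y) :=
  {χ | ∀ θ : Irr X, χ.LiesOver (Subgroup.inclusion h) θ → θ.IsPPrime p}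

end

/-! Write `Γ` for the semidirect product of `Gt` and `D`. Call `χ` of `G` and `ψ` of `N` linked if
they lie below some `X` and `Ω X`. The proof has two halves: comparing the stabilizers of linked
characters, and showing that the two cohomology classes agree.

Stabilizers. Since `Gt / G` is abelian and characters extend to their inertia groups, the characters
of `Gt` over a given `χ` are twists of one of them by linear characters of `Gt / G`
(`Irr.LiesOver.exists_twist`), and a twist fixes `X` exactly when the linear character is trivial on
the inertia group of `χ` (`Irr.LiesOver.twist_eq_iff`). The same holds over `N`. As `Ω` is injective
and commutes with twists and conjugation, linked characters have the same stabilizer in the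
normalizer of `N` in `Gt` (`CharacterBijection.mem_inertia_iff`), and conjugacy up to `Gt` is the
same on both sides (`CharacterBijection.exists_conj_iff`). The splitting of the two stabilizers
along `D` improves this to equality of stabilizers in all of `Γ`, up to `G`
(`CharacterBijection.inertia_eq_sup`). Pairs of orbit representatives with equal stabilizers then
give the bijection (`exists_equivariant_bijOn`).

Cohomology. The stabilizer of `ψ` is a product of its parts in `Gt` and in `G ⊔ D`. Both `χ` and `ψ`
extend to linear representations of either part, and multiplying the two extensions gives projective
representations `P` and `P'`. Their factor sets only measure how the second part moves the extension
to the first. That is the linear character by which conjugation twists `X`, and the properties of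
`Ω` make it the same for `Ω X`. So `P` and `P'` have a common factor set, and they agree on the
centralizer of `G` (`CharacterBijection.exists_parallelProjReps`).

For `A` one takes the finite group of pairs consisting of a matrix of determinant one and an
automorphism of `G` that it realizes (`overgroup`). The matrix component extends `χ` linearly to
`A`. Writing it as `c • P j` and sending it to `c • P' j` is well defined and multiplicative because
the factor sets agree, so `ψ` extends linearly to the normalizer of the image of `N`
(`ParallelProjReps.exists_localRep`). Both classes are therefore trivial, with the same character of
the centralizer (`isCohomOvergroup_of_isMatRep`). That `A` induces every automorphism fixing `χ` on
the quotient of `G` uses the lifting of automorphisms to the universal covering group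
(`IsUniversalCovering.exists_lift`). -/

noncomputable section

open scoped Matrix ComplexOrder commutatorElement

/-! ### Matrix representations of subgroups -/

section MatrixRepresentations

variable {Γ : Type*} [Group Γ]

/-- A matrix-valued function on `Γ` that restricts to a representation of the subgroup `H`. -/
structure IsMatRep (H : Subgroup Γ) {n : ℕ} (ρ : Γ → Matrix (Fin n) (Fin n) ℂ) : Prop where
  one : ρ 1 = 1
  mul : ∀ x ∈ H, ∀ y ∈ H, ρ (x * y) = ρ x * ρ y

/-- A matrix representation of `H` that is irreducible, in the form given by Schur's lemma. -/
structure IsMatIrrep (H : Subgroup Γ) {n : ℕ} (ρ : Γ → Matrix (Fin n) (Fin n) ℂ) : Prop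
    extends IsMatRep H ρ where
  pos : 0 < n
  schur : ∀ M, (∀ x ∈ H, M * ρ x = ρ x * M) → ∃ c : ℂ, M = c • (1 : Matrix (Fin n) (Fin n) ℂ)

/-- `A` intertwines the representations `ρ` and `σ` of `H`. -/
def Intertwines (H : Subgroup Γ) {n m : ℕ} (ρ : Γ → Matrix (Fin n) (Fin n) ℂ)
    (σ : Γ → Matrix (Fin m) (Fin m) ℂ) (A : Matrix (Fin m) (Fin n) ℂ) : Prop :=
  ∀ x ∈ H, σ x * A = A * ρ x

/-- The matrix representation `ρ` of `H` affords the irreducible character `χ`. -/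
structure Affords {H : Subgroup Γ} (χ : Irr H) {n : ℕ} (ρ : Γ → Matrix (Fin n) (Fin n) ℂ) :
    Prop extends IsMatIrrep H ρ where
  trace : ∀ x : H, χ x = (ρ x).trace

variable {H K : Subgroup Γ} {n m k : ℕ} {ρ : Γ → Matrix (Fin n) (Fin n) ℂ}
  {σ : Γ → Matrix (Fin m) (Fin m) ℂ} {τ : Γ → Matrix (Fin k) (Fin k) ℂ}

namespace IsMatRep

theorem mono (h : IsMatRep H ρ) (hK : K ≤ H) : IsMatRep K ρ :=
  ⟨h.one, fun x hx y hy => h.mul x (hK hx) y (hK hy)⟩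

theorem mul_inv (h : IsMatRep H ρ) {x : Γ} (hx : x ∈ H) : ρ x * ρ x⁻¹ = 1 := by
  rw [← h.mul x hx _ (H.inv_mem hx), mul_inv_cancel, h.one]

theorem inv_mul (h : IsMatRep H ρ) {x : Γ} (hx : x ∈ H) : ρ x⁻¹ * ρ x = 1 := by
  rw [← h.mul _ (H.inv_mem hx) _ hx, inv_mul_cancel, h.one]

theorem trace_conj (h : IsMatRep H ρ) {x y : Γ} (hx : x ∈ H) (hy : y ∈ H) :
    (ρ (x * y * x⁻¹)).trace = (ρ y).trace := by
  rw [h.mul _ (H.mul_mem hx hy) _ (H.inv_mem hx), h.mul _ hx _ hy, Matrix.trace_mul_cycle,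
    h.inv_mul hx, Matrix.one_mul]

end IsMatRep

theorem IsMatIrrep.of_le (h : IsMatRep H ρ) (hK : K ≤ H) (hi : IsMatIrrep K ρ) :
    IsMatIrrep H ρ :=
  { h with
    pos := hi.pos
    schur := fun M hM => hi.schur M fun x hx => hM x (hK hx) }

namespace Intertwines

theorem mono {A : Matrix (Fin m) (Fin n) ℂ} (h : Intertwines H ρ σ A) (hK : K ≤ H) :
    Intertwines K ρ σ A := fun x hx => h x (hK hx)

theorem mul {A : Matrix (Fin m) (Fin n) ℂ} {B : Matrix (Fin k) (Fin m) ℂ}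
    (hB : Intertwines H σ τ B) (hA : Intertwines H ρ σ A) : Intertwines H ρ τ (B * A) := by
  intro x hx
  rw [← Matrix.mul_assoc, hB x hx, Matrix.mul_assoc, hA x hx, Matrix.mul_assoc]

end Intertwines

variable [Finite Γ]

/-- An enumeration of a subgroup of a finite group. -/
abbrev fintypeSubgroup {Γ : Type*} [Group Γ] [Finite Γ] (H : Subgroup Γ) : Fintype H :=
  Fintype.ofFinite H

attribute [local instance] fintypeSubgroup

/-- The sum of all `σ x * E * ρ x⁻¹`, `x ∈ H`. -/
def averageIntertwiner (H : Subgroup Γ) {n m : ℕ} (ρ : Γ → Matrix (Fin n) (Fin n) ℂ)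
    (σ : Γ → Matrix (Fin m) (Fin m) ℂ) (E : Matrix (Fin m) (Fin n) ℂ) :
    Matrix (Fin m) (Fin n) ℂ :=
  ∑ x : H, σ x * E * ρ (x : Γ)⁻¹

theorem intertwines_average (hρ : IsMatRep H ρ) (hσ : IsMatRep H σ)
    (E : Matrix (Fin m) (Fin n) ℂ) : Intertwines H ρ σ (averageIntertwiner H ρ σ E) := by
  intro y hy
  unfold averageIntertwiner
  rw [Matrix.mul_sum, Matrix.sum_mul]
  rw [← Equiv.sum_comp (Equiv.mulLeft (⟨y, hy⟩ : H))
    (fun x : H => σ (x : Γ) * E * ρ (x : Γ)⁻¹ * ρ y)]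
  refine Finset.sum_congr rfl fun x _ => ?_
  simp only [Equiv.coe_mulLeft, Subgroup.coe_mul]
  rw [mul_inv_rev, hσ.mul y hy x x.2, hρ.mul _ (H.inv_mem x.2) _ (H.inv_mem hy)]
  simp only [Matrix.mul_assoc]
  rw [hρ.inv_mul hy, Matrix.mul_one]

theorem average_of_intertwines (hρ : IsMatRep H ρ) {A : Matrix (Fin m) (Fin n) ℂ}
    (hA : Intertwines H ρ σ A) : averageIntertwiner H ρ σ A = (Fintype.card H : ℂ) • A := by
  unfold averageIntertwiner
  rw [Finset.sum_congr rfl (g := fun _ => A) fun x _ => ?_]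
  · simp [Finset.card_univ, ← Nat.cast_smul_eq_nsmul ℂ]
  · rw [hA x x.2, Matrix.mul_assoc, hρ.mul_inv x.2, Matrix.mul_one]

theorem card_subgroup_ne_zero (H : Subgroup Γ) : (Fintype.card H : ℂ) ≠ 0 :=
  Nat.cast_ne_zero.2 Fintype.card_ne_zero

/-- Average the conjugate transpose of `A` to get `B`. Schur's lemma makes `B * A` a scalar, and its
trace is the order of `H` times the trace of `Aᴴ * A`, which is nonzero. -/
theorem IsMatIrrep.exists_leftInverse (hρ : IsMatIrrep H ρ) (hσ : IsMatRep H σ)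
    {A : Matrix (Fin m) (Fin n) ℂ} (hA : Intertwines H ρ σ A) (hA0 : A ≠ 0) :
    ∃ B, Intertwines H σ ρ B ∧ B * A = 1 := by
  have hB := intertwines_average hσ hρ.toIsMatRep Aᴴ
  set B := averageIntertwiner H σ ρ Aᴴ with hBdef
  obtain ⟨c, hc⟩ := hρ.schur (B * A) fun x hx => ((hB.mul hA) x hx).symm
  have htr : (B * A).trace = (Fintype.card H : ℂ) * (Aᴴ * A).trace := by
    rw [hBdef, averageIntertwiner, Matrix.sum_mul, Matrix.trace_sum]
    rw [Finset.sum_congr rfl (g := fun _ => (Aᴴ * A).trace) fun x _ => ?_]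
    · simp [Finset.card_univ]
    · rw [Matrix.mul_assoc, hA _ (H.inv_mem x.2), ← Matrix.mul_assoc, Matrix.trace_mul_comm,
        Matrix.mul_assoc (ρ x), ← Matrix.mul_assoc, hρ.inv_mul x.2, Matrix.one_mul]
  have hc0 : c ≠ 0 := by
    rintro rfl
    rw [hc, zero_smul, Matrix.trace_zero] at htr
    have := (mul_eq_zero.1 htr.symm).resolve_left (card_subgroup_ne_zero H)
    exact hA0 ((Matrix.trace_conjTranspose_mul_self_eq_zero_iff (A := A)).1 this)
  refine ⟨c⁻¹ • B, fun x hx => ?_, ?_⟩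
  · rw [Matrix.mul_smul, hB x hx, Matrix.smul_mul]
  · rw [Matrix.smul_mul, hc, smul_smul, inv_mul_cancel₀ hc0, one_smul]

theorem IsMatIrrep.exists_inverse (hρ : IsMatIrrep H ρ) (hσ : IsMatIrrep H σ)
    {A : Matrix (Fin m) (Fin n) ℂ} (hA : Intertwines H ρ σ A) (hA0 : A ≠ 0) :
    ∃ B, Intertwines H σ ρ B ∧ B * A = 1 ∧ A * B = 1 := by
  obtain ⟨B, hB, hBA⟩ := hρ.exists_leftInverse hσ.toIsMatRep hA hA0
  obtain ⟨c, hc⟩ := hσ.schur (A * B) fun x hx => ((hA.mul hB) x hx).symm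
  have h1 : c • A = A := by
    calc c • A = A * B * A := by rw [hc, Matrix.smul_mul, Matrix.one_mul]
      _ = A := by rw [Matrix.mul_assoc, hBA, Matrix.mul_one]
  have h2 : c = 1 := by
    have h3 : (c - 1) • A = 0 := by rw [sub_smul, h1, one_smul, sub_self]
    exact sub_eq_zero.1 ((smul_eq_zero.1 h3).resolve_right hA0)
  exact ⟨B, hB, hBA, by rw [hc, h2, one_smul]⟩

theorem IsMatIrrep.trace_eq (hρ : IsMatIrrep H ρ) (hσ : IsMatIrrep H σ)
    {A : Matrix (Fin m) (Fin n) ℂ} (hA : Intertwines H ρ σ A) (hA0 : A ≠ 0) {x : Γ} (hx : x ∈ H) :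
    (σ x).trace = (ρ x).trace := by
  obtain ⟨B, -, hBA, hAB⟩ := hρ.exists_inverse hσ hA hA0
  rw [← Matrix.mul_one (σ x), ← hAB, ← Matrix.mul_assoc, hA x hx, Matrix.trace_mul_comm,
    ← Matrix.mul_assoc, hBA, Matrix.one_mul]

/-- Averaging the standard hermitian form gives an invariant positive definite form `F`, with
respect to which `ρ x` is unitary. Hence `(ρ x)ᴴ` is similar to `ρ x⁻¹`. -/
theorem IsMatRep.trace_inv (h : IsMatRep H ρ) {x : Γ} (hx : x ∈ H) :
    (ρ x⁻¹).trace = (starRingEnd ℂ) (ρ x).trace := by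
  classical
  set F : Matrix (Fin n) (Fin n) ℂ := ∑ y : H, (ρ y)ᴴ * ρ y with hF
  have hFpos : F.PosDef := by
    rw [hF, ← Finset.add_sum_erase _ _ (Finset.mem_univ (1 : H))]
    refine Matrix.PosDef.add_posSemidef ?_ ?_
    · simp only [OneMemClass.coe_one, h.one, Matrix.conjTranspose_one, Matrix.one_mul]
      exact Matrix.PosDef.one
    · exact Matrix.posSemidef_sum _ fun y _ => Matrix.posSemidef_conjTranspose_mul_self _
  have hinv : (ρ x)ᴴ * F * ρ x = F := by
    rw [hF, Matrix.mul_sum, Matrix.sum_mul,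
      ← Equiv.sum_comp (Equiv.mulRight (⟨x, hx⟩ : H)) (fun y : H => (ρ y)ᴴ * ρ y)]
    refine Finset.sum_congr rfl fun y _ => ?_
    simp only [Equiv.coe_mulRight, Subgroup.coe_mul]
    rw [h.mul y y.2 x hx, Matrix.conjTranspose_mul]
    simp only [Matrix.mul_assoc]
  have hdet : IsUnit F.det := (Matrix.isUnit_iff_isUnit_det F).1 hFpos.isUnit
  have h1 : (ρ x)ᴴ * F = F * ρ x⁻¹ := by
    conv_rhs => rw [← hinv, Matrix.mul_assoc _ (ρ x), h.mul_inv hx, Matrix.mul_one]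
  have h2 : (ρ x)ᴴ = F * ρ x⁻¹ * F⁻¹ := by
    rw [← h1, Matrix.mul_nonsing_inv_cancel_right _ _ hdet]
  have h3 := congrArg Matrix.trace h2
  rw [Matrix.trace_conjTranspose, Matrix.trace_mul_comm, ← Matrix.mul_assoc,
    Matrix.nonsing_inv_mul _ hdet, Matrix.one_mul] at h3
  exact h3.symm

-- In coordinates, averaging matrices is the operator `P`, which is the order of `H` times a
-- projection onto the space of intertwiners. The character sum is its trace, and an idempotent over
-- `ℂ` of trace zero is zero.
open scoped Kronecker in
theorem sum_trace_ne_zero_iff (hρ : IsMatRep H ρ) (hσ : IsMatRep H σ) :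
    ∑ x : H, (σ x).trace * (starRingEnd ℂ) (ρ x).trace ≠ 0 ↔
      ∃ A, A ≠ 0 ∧ Intertwines H ρ σ A := by
  set P : Matrix (Fin m × Fin n) (Fin m × Fin n) ℂ :=
    ∑ x : H, σ (x : Γ) ⊗ₖ (ρ (x : Γ)⁻¹)ᵀ with hP
  have htr : ∑ x : H, (σ x).trace * (starRingEnd ℂ) (ρ x).trace = P.trace := by
    rw [hP, Matrix.trace_sum]
    refine Finset.sum_congr rfl fun x _ => ?_
    rw [Matrix.trace_kronecker, Matrix.trace_transpose, hρ.trace_inv x.2]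
  have hPP : P * P = (Fintype.card H : ℂ) • P := by
    have h1 : ∀ x : H, σ (x : Γ) ⊗ₖ (ρ (x : Γ)⁻¹)ᵀ * P = P := by
      intro x
      rw [hP, Matrix.mul_sum, ← Equiv.sum_comp (Equiv.mulLeft x)
        (fun y : H => σ (y : Γ) ⊗ₖ (ρ (y : Γ)⁻¹)ᵀ)]
      refine Finset.sum_congr rfl fun y _ => ?_
      rw [← Matrix.mul_kronecker_mul, ← Matrix.transpose_mul, ← hσ.mul x x.2 y y.2,
        ← hρ.mul _ (H.inv_mem y.2) _ (H.inv_mem x.2), ← mul_inv_rev]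
      rfl
    conv_lhs => rw [hP, Matrix.sum_mul]
    rw [← hP, Finset.sum_congr rfl fun x _ => h1 x]
    simp [Finset.card_univ, ← Nat.cast_smul_eq_nsmul ℂ]
  have happ : ∀ (A : Matrix (Fin m) (Fin n) ℂ) i j,
      averageIntertwiner H ρ σ A i j = ∑ p : Fin m × Fin n, P (i, j) p * A p.1 p.2 := by
    intro A i j
    rw [averageIntertwiner, Matrix.sum_apply, hP]
    simp only [Matrix.sum_apply, Finset.sum_mul]
    rw [Finset.sum_comm]
    refine Finset.sum_congr rfl fun x _ => ?_
    rw [Fintype.sum_prod_type_right]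
    simp only [Matrix.mul_apply, Matrix.kronecker_apply, Matrix.transpose_apply, Finset.sum_mul]
    refine Finset.sum_congr rfl fun a _ => Finset.sum_congr rfl fun b _ => by ring
  rw [htr]
  constructor
  · intro h
    have hP0 : P ≠ 0 := by
      intro h0
      rw [h0, Matrix.trace_zero] at h
      exact h rfl
    by_contra hno
    push Not at hno
    apply hP0
    ext ⟨i, j⟩ ⟨i', j'⟩
    have h1 : averageIntertwiner H ρ σ (Matrix.single i' j' 1) = 0 := by
      by_contra h2
      exact hno _ h2 (intertwines_average hρ hσ _)
    have h2 := happ (Matrix.single i' j' 1) i j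
    rw [h1, Finset.sum_eq_single (i', j')] at h2
    · simpa using h2.symm
    · rintro ⟨a, b⟩ - hab
      have : ¬ (i' = a ∧ j' = b) := fun h => hab (by rw [h.1, h.2])
      simp [this]
    · simp
  · rintro ⟨A, hA0, hA⟩ h0
    have hc := card_subgroup_ne_zero H
    set e := Matrix.toLin' ((Fintype.card H : ℂ)⁻¹ • P)
    have he : IsIdempotentElem e := by
      change Matrix.toLin' _ * Matrix.toLin' _ = Matrix.toLin' _
      rw [Module.End.mul_eq_comp, ← Matrix.toLin'_mul, Matrix.smul_mul, Matrix.mul_smul, hPP,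
        smul_smul, smul_smul, inv_mul_cancel_right₀ hc]
    have he0 : e = 0 := by
      refine LinearMap.IsIdempotentElem.eq_zero_of_trace_eq_zero he ?_
      rw [Matrix.trace_toLin'_eq, Matrix.trace_smul, h0, smul_zero]
    have hP0 : P = 0 := by
      have h1 : (Fintype.card H : ℂ)⁻¹ • P = 0 := by
        simpa [e] using he0
      exact (smul_eq_zero.1 h1).resolve_left (inv_ne_zero hc)
    have h1 := average_of_intertwines hρ hA
    have h2 : averageIntertwiner H ρ σ A = 0 := by
      ext i j
      rw [happ, hP0]
      simp
    rw [h2] at h1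
    exact (smul_eq_zero.1 h1.symm).elim hc hA0

end MatrixRepresentations

/-! ### Irreducible characters and their matrix representations -/

section IrrMatrices

variable {Γ : Type*} [Group Γ] {H K : Subgroup Γ} {n m k : ℕ}
  {ρ : Γ → Matrix (Fin n) (Fin n) ℂ} {σ : Γ → Matrix (Fin m) (Fin m) ℂ}

/-- The extension of a function on `H` to `Γ` by a default value. -/
def extendFun {α : Type*} (f : H → α) (d : α) (x : Γ) : α :=
  open Classical in if h : x ∈ H then f ⟨x, h⟩ else d

@[simp] theorem extendFun_coe {α : Type*} (f : H → α) (d : α) (x : H) :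
    extendFun f d (x : Γ) = f x := by
  simp [extendFun]

theorem extendFun_of_mem {α : Type*} (f : H → α) (d : α) {x : Γ} (hx : x ∈ H) :
    extendFun f d x = f ⟨x, hx⟩ := by
  simp [extendFun, hx]

/-- An irreducible finite-dimensional representation of `H` in matrix form. -/
theorem exists_isMatIrrep_of_isIrreducible {V : Type*} [AddCommGroup V] [Module ℂ V]
    [FiniteDimensional ℂ V] (R : Representation ℂ H V) (hR : R.IsIrreducible) :
    ∃ (τ : Γ → Matrix (Fin (Module.finrank ℂ V)) (Fin (Module.finrank ℂ V)) ℂ)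
      (e : V ≃ₗ[ℂ] (Fin (Module.finrank ℂ V) → ℂ)), IsMatIrrep H τ ∧
      (∀ (x : H) (v : V), (τ x) *ᵥ (e v) = e (R x v)) ∧
      ∀ x : H, (τ x).trace = R.character x := by
  set b := Module.finBasis ℂ V
  set t := LinearMap.toMatrix b b
  have hτ : ∀ x : H, extendFun (fun x : H => t (R x)) 1 (x : Γ) = t (R x) := fun x => by simp
  refine ⟨extendFun (fun x : H => t (R x)) 1, b.equivFun, ⟨⟨?_, ?_⟩, ?_, ?_⟩, ?_, ?_⟩
  · have := hτ 1
    simp only [OneMemClass.coe_one] at this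
    rw [this, map_one]
    exact LinearMap.toMatrix_one b
  · intro x hx y hy
    have := hτ (⟨x, hx⟩ * ⟨y, hy⟩)
    simp only [Subgroup.coe_mul] at this
    rw [this, hτ ⟨x, hx⟩, hτ ⟨y, hy⟩, map_mul]
    exact LinearMap.toMatrix_mul b _ _
  · have : Nontrivial V := by
      have hn : Nontrivial (Subrepresentation R) := hR.toNontrivial
      by_contra hV
      rw [not_nontrivial_iff_subsingleton] at hV
      refine not_subsingleton (Subrepresentation R)
        ⟨fun a c => Subrepresentation.toSubmodule_injective (Subsingleton.elim _ _)⟩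
    exact Module.finrank_pos
  · intro M hM
    set f := t.symm M
    have hMf : t f = M := t.apply_symm_apply M
    have hcomm : ∀ (x : H) (v : V), f (R x v) = R x (f v) := by
      intro x v
      have h1 := hM x x.2
      rw [hτ, ← hMf] at h1
      have h2 : t (f * R x) = t (R x * f) := by
        rw [LinearMap.toMatrix_mul, LinearMap.toMatrix_mul]
        exact h1
      exact LinearMap.congr_fun (t.injective h2) v
    obtain ⟨c, hc⟩ := (Representation.IsIrreducible.algebraMap_intertwiningMap_bijective_of_isAlgClosed
      (ρ := R)).2 (f.intertwiningMap_of_isIntertwiningMap R R hcomm)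
    refine ⟨c, ?_⟩
    have h3 : f = c • (1 : V →ₗ[ℂ] V) := by
      have h4 := congrArg Representation.IntertwiningMap.toLinearMap hc
      rw [Algebra.algebraMap_eq_smul_one] at h4
      exact h4.symm
    rw [← hMf, h3, map_smul]
    exact congrArg _ (LinearMap.toMatrix_one b)
  · intro x v
    rw [hτ]
    exact LinearMap.toMatrix_mulVec_repr b b (R x) v
  · intro x
    rw [hτ]
    exact (LinearMap.trace_eq_matrix_trace ℂ b (R x)).symm

theorem Irr.exists_affords (χ : Irr H) :
    ∃ (n : ℕ) (ρ : Γ → Matrix (Fin n) (Fin n) ℂ), Affords χ ρ := by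
  obtain ⟨n, R, hR, hχ⟩ := χ.isIrr
  obtain ⟨τ, e, hτ, -, htr⟩ := exists_isMatIrrep_of_isIrreducible R hR
  exact ⟨_, τ, hτ, fun x => by rw [htr, hχ]⟩

variable [Finite Γ]

attribute [local instance] fintypeSubgroup

/-- The character of an irreducible matrix representation. -/
def IsMatIrrep.toIrr (h : IsMatIrrep H ρ) : Irr H where
  toFun x := (ρ x).trace
  isIrr := by
    let R : Representation ℂ H (Fin n → ℂ) :=
      { toFun := fun x => Matrix.toLin' (ρ x)
        map_one' := by simp [h.one]; rfl
        map_mul' := fun x y => by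
          rw [Subgroup.coe_mul, h.mul x x.2 y y.2, Matrix.toLin'_mul]
          rfl }
    have hpos := h.pos
    have : Nontrivial (Fin n → ℂ) := by
      have : Nonempty (Fin n) := ⟨⟨0, hpos⟩⟩
      infer_instance
    refine ⟨n, R, ?_, ?_⟩
    · refine { exists_pair_ne := ⟨⊥, ⊤, fun hb => ?_⟩, eq_bot_or_eq_top := fun U => ?_ }
      · exact bot_ne_top (α := Submodule ℂ (Fin n → ℂ))
          (congrArg Subrepresentation.toSubmodule hb)
      · by_cases hU : U.toSubmodule = ⊥
        · exact Or.inl (Subrepresentation.toSubmodule_injective hU)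
        · right
          apply Subrepresentation.toSubmodule_injective
          -- Maschke's argument: the average of a projection onto `U` is a scalar, it maps
          -- everything into `U`, and it acts on `U` as multiplication by the order of `H`. If `U`
          -- is nonzero the scalar is nonzero, so `U` is everything.
          obtain ⟨g, hg⟩ := U.toSubmodule.subtype.exists_leftInverse_of_injective
            (by rw [Submodule.ker_subtype])
          set E : Matrix (Fin n) (Fin n) ℂ := LinearMap.toMatrix' (U.toSubmodule.subtype ∘ₗ g)
          have hEmem : ∀ v, E *ᵥ v ∈ U.toSubmodule := fun v => by
            rw [← Matrix.toLin'_apply, Matrix.toLin'_toMatrix']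
            exact (g v).2
          have hEid : ∀ v ∈ U.toSubmodule, E *ᵥ v = v := fun v hv => by
            rw [← Matrix.toLin'_apply, Matrix.toLin'_toMatrix']
            exact congrArg Subtype.val (LinearMap.congr_fun hg ⟨v, hv⟩)
          have hinv : ∀ (x : Γ), x ∈ H → ∀ v ∈ U.toSubmodule, ρ x *ᵥ v ∈ U.toSubmodule :=
            fun x hx v hv => U.apply_mem_toSubmodule ⟨x, hx⟩ hv
          obtain ⟨c, hc⟩ := h.schur (averageIntertwiner H ρ ρ E) fun x hx =>
            ((intertwines_average h.toIsMatRep h.toIsMatRep E) x hx).symm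
          have hmem : ∀ v, averageIntertwiner H ρ ρ E *ᵥ v ∈ U.toSubmodule := fun v => by
            rw [averageIntertwiner, Matrix.sum_mulVec]
            refine Submodule.sum_mem _ fun x _ => ?_
            rw [← Matrix.mulVec_mulVec, ← Matrix.mulVec_mulVec]
            exact hinv x x.2 _ (hEmem _)
          have hid : ∀ v ∈ U.toSubmodule,
              averageIntertwiner H ρ ρ E *ᵥ v = (Fintype.card H : ℂ) • v := fun v hv => by
            rw [averageIntertwiner, Matrix.sum_mulVec,
              Finset.sum_congr rfl (g := fun _ => v) fun x _ => ?_]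
            · simp [Finset.card_univ, ← Nat.cast_smul_eq_nsmul ℂ]
            · rw [← Matrix.mulVec_mulVec, ← Matrix.mulVec_mulVec,
                hEid _ (hinv _ (H.inv_mem x.2) _ hv), Matrix.mulVec_mulVec,
                h.mul_inv x.2, Matrix.one_mulVec]
          obtain ⟨v, hv, hv0⟩ := Submodule.exists_mem_ne_zero_of_ne_bot hU
          have hc0 : c ≠ 0 := by
            rintro rfl
            have := hid v hv
            rw [hc, zero_smul, Matrix.zero_mulVec] at this
            exact (smul_eq_zero.1 this.symm).elim (card_subgroup_ne_zero H) hv0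
          refine eq_top_iff.2 fun w _ => ?_
          have hw := hmem w
          rw [hc, Matrix.smul_mulVec, Matrix.one_mulVec] at hw
          exact (U.toSubmodule.smul_mem_iff hc0).1 hw
    · funext x
      exact Matrix.trace_toLin'_eq _

theorem IsMatIrrep.affords_toIrr (h : IsMatIrrep H ρ) : Affords h.toIrr ρ :=
  ⟨h, fun _ => rfl⟩

theorem Affords.liesOver_iff {χ : Irr H} {θ : Irr K} (h : K ≤ H) (hσ : Affords χ σ)
    (hρ : Affords θ ρ) :
    χ.LiesOver (Subgroup.inclusion h) θ ↔ ∃ A, A ≠ 0 ∧ Intertwines K ρ σ A := by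
  rw [← sum_trace_ne_zero_iff hρ.toIsMatRep (hσ.toIsMatRep.mono h), Irr.LiesOver,
    finsum_eq_sum_of_fintype]
  refine not_congr (Eq.congr_left (Finset.sum_congr rfl fun x _ => ?_))
  rw [hσ.trace, hρ.trace]
  rfl

/-- The inner product of two characters is conjugate symmetric. -/
theorem Intertwines.exists_symm (hρ : IsMatRep H ρ) (hσ : IsMatRep H σ)
    {A : Matrix (Fin m) (Fin n) ℂ} (hA : Intertwines H ρ σ A) (hA0 : A ≠ 0) :
    ∃ B, B ≠ 0 ∧ Intertwines H σ ρ B := by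
  rw [← sum_trace_ne_zero_iff hσ hρ]
  have h1 := (sum_trace_ne_zero_iff hρ hσ).2 ⟨A, hA0, hA⟩
  intro h0
  apply h1
  have h2 := congrArg (starRingEnd ℂ) h0
  rw [map_zero, map_sum] at h2
  rw [← h2]
  refine Finset.sum_congr rfl fun x _ => ?_
  rw [map_mul, Complex.conj_conj, mul_comm]

theorem Affords.eq_of_intertwines {χ χ' : Irr H} (hρ : Affords χ ρ) (hσ : Affords χ' σ)
    {A : Matrix (Fin m) (Fin n) ℂ} (hA : Intertwines H ρ σ A) (hA0 : A ≠ 0) : χ = χ' := by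
  ext x
  rw [hρ.trace, hσ.trace, hρ.toIsMatIrrep.trace_eq hσ.toIsMatIrrep hA hA0 x.2]

/-- The norm of a character is a sum of nonnegative terms, and the term at the identity is positive.
-/
theorem Affords.exists_intertwines {χ : Irr H} (hρ : Affords χ ρ) (hσ : Affords χ σ) :
    ∃ A, A ≠ 0 ∧ Intertwines H ρ σ A := by
  rw [← sum_trace_ne_zero_iff hρ.toIsMatRep hσ.toIsMatRep]
  have h1 : ∀ x : H, (σ x).trace * (starRingEnd ℂ) (ρ x).trace =
      ((Complex.normSq (ρ x).trace : ℝ) : ℂ) := fun x => by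
    rw [← hσ.trace, ← hρ.trace, Complex.mul_conj]
  rw [Finset.sum_congr rfl fun x _ => h1 x, ← Complex.ofReal_sum]
  refine Complex.ofReal_ne_zero.2 (ne_of_gt ?_)
  refine Finset.sum_pos' (fun x _ => Complex.normSq_nonneg _) ⟨1, Finset.mem_univ _, ?_⟩
  rw [Complex.normSq_pos, OneMemClass.coe_one, hρ.one, Matrix.trace_one, Fintype.card_fin]
  exact Nat.cast_ne_zero.2 hρ.pos.ne'

/-- Every irreducible character of a subgroup lies under one of the whole group. -/
theorem Irr.exists_liesOver (h : K ≤ H) (θ : Irr K) :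
    ∃ χ : Irr H, χ.LiesOver (Subgroup.inclusion h) θ := by
  obtain ⟨n, ρ, hρ⟩ := θ.exists_affords
  -- The induced module, realized as the functions on `H` that are equivariant under left
  -- translation by `K`, with `H` acting by right translation.
  let T : H → (H → Fin n → ℂ) →ₗ[ℂ] (H → Fin n → ℂ) := fun y =>
    { toFun := fun F z => F (z * y)
      map_add' := fun _ _ => rfl
      map_smul' := fun _ _ => rfl }
  let P : Submodule ℂ (H → Fin n → ℂ) → Prop := fun U =>
    (∀ F ∈ U, ∀ (x : K) (y : H), F (Subgroup.inclusion h x * y) = ρ x *ᵥ F y) ∧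
      (∀ y, ∀ F ∈ U, T y F ∈ U) ∧ U ≠ ⊥
  have hne : ∃ U, P U := by
    let U : Submodule ℂ (H → Fin n → ℂ) :=
      { carrier := {F | ∀ (x : K) (y : H), F (Subgroup.inclusion h x * y) = ρ x *ᵥ F y}
        add_mem' := fun {F F'} hF hF' x y => by
          change F _ + F' _ = ρ x *ᵥ (F y + F' y)
          rw [hF, hF', Matrix.mulVec_add]
        zero_mem' := fun x y => by
          change (0 : Fin n → ℂ) = ρ x *ᵥ (0 : Fin n → ℂ)
          rw [Matrix.mulVec_zero]
        smul_mem' := fun c F hF x y => by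
          change c • F _ = ρ x *ᵥ (c • F y)
          rw [hF, Matrix.mulVec_smul] }
    refine ⟨U, fun F hF => hF, fun y F hF x z => ?_, ?_⟩
    · change F (_ * z * y) = ρ x *ᵥ F (z * y)
      rw [mul_assoc]
      exact hF x _
    · classical
      let v : Fin n → ℂ := Pi.single ⟨0, hρ.pos⟩ 1
      let F : H → Fin n → ℂ := fun y => if (y : Γ) ∈ K then ρ y *ᵥ v else 0
      have hF : F ∈ U := by
        intro x y
        by_cases hy : (y : Γ) ∈ K
        · have h1 : ((Subgroup.inclusion h x * y : H) : Γ) ∈ K := K.mul_mem x.2 hy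
          simp only [F, hy, h1, if_true]
          rw [Matrix.mulVec_mulVec, ← hρ.mul x x.2 y hy]
          rfl
        · have h1 : ¬ ((Subgroup.inclusion h x * y : H) : Γ) ∈ K := fun h2 => by
            exact hy ((K.mul_mem_cancel_left x.2).1 h2)
          simp only [F, hy, h1, if_false, Matrix.mulVec_zero]
      intro hbot
      rw [hbot, Submodule.mem_bot] at hF
      have h2 := congrFun (congrFun hF 1) ⟨0, hρ.pos⟩
      simp [F, K.one_mem, hρ.one, v] at h2
  -- A minimal nonzero invariant subspace exists by finite dimensionality and is irreducible.
  obtain ⟨U, hU, hmin⟩ := wellFounded_lt.has_min {U | P U} hne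
  let R : Representation ℂ H U :=
    { toFun := fun y => (T y).restrict (hU.2.1 y)
      map_one' := by
        ext F : 2
        funext z
        change (F : H → Fin n → ℂ) (z * 1) = _
        rw [mul_one]
        rfl
      map_mul' := fun x y => by
        ext F : 2
        funext z
        change (F : H → Fin n → ℂ) (z * (x * y)) = (F : H → Fin n → ℂ) (z * x * y)
        rw [mul_assoc] }
  have hnt : Nontrivial U := Submodule.nontrivial_iff_ne_bot.2 hU.2.2
  have hR : R.IsIrreducible := by
    refine { exists_pair_ne := ⟨⊥, ⊤, fun hb => ?_⟩, eq_bot_or_eq_top := fun W => ?_ }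
    · exact bot_ne_top (α := Submodule ℂ U) (congrArg Subrepresentation.toSubmodule hb)
    · by_cases hW : W.toSubmodule = ⊥
      · exact Or.inl (Subrepresentation.toSubmodule_injective hW)
      · right
        apply Subrepresentation.toSubmodule_injective
        have hle : W.toSubmodule.map U.subtype ≤ U := Submodule.map_subtype_le _ _
        have hP : P (W.toSubmodule.map U.subtype) := by
          refine ⟨fun F hF => hU.1 F (hle hF), ?_, ?_⟩
          · rintro y _ ⟨F, hF, rfl⟩
            exact ⟨R y F, W.apply_mem_toSubmodule y hF, rfl⟩
          · exact fun hb => hW (Submodule.map_injective_of_injective U.injective_subtype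
              (hb.trans (Submodule.map_bot _).symm))
        have h1 := hmin _ hP
        have h2 : W.toSubmodule.map U.subtype = U := (eq_of_le_of_not_lt hle h1)
        refine eq_top_iff.2 fun F _ => ?_
        have h3 : (F : H → Fin n → ℂ) ∈ W.toSubmodule.map U.subtype := h2.symm ▸ F.2
        obtain ⟨F', hF', hFF'⟩ := h3
        rwa [← Subtype.ext hFF']
  obtain ⟨τ, e, hτ, he, -⟩ := exists_isMatIrrep_of_isIrreducible R hR
  refine ⟨hτ.toIrr, (hτ.affords_toIrr.liesOver_iff h hρ).2 ?_⟩
  -- Evaluation at the identity commutes with `K`. It is nonzero on `U`, because evaluating all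
  -- translates of a function at the identity recovers the function.
  let ev : U →ₗ[ℂ] (Fin n → ℂ) := (LinearMap.proj (1 : H)) ∘ₗ U.subtype
  let A := LinearMap.toMatrix' (ev ∘ₗ e.symm.toLinearMap)
  have hA : ∀ F : U, A *ᵥ (e F) = (F : H → Fin n → ℂ) 1 := fun F => by
    rw [← Matrix.toLin'_apply, Matrix.toLin'_toMatrix']
    simp [ev]
  refine Intertwines.exists_symm (A := A) (hτ.toIsMatRep.mono h) hρ.toIsMatRep ?_ ?_
  · intro x hx
    apply Matrix.ext_of_mulVec_single
    intro i
    obtain ⟨F, hF⟩ := e.surjective (Pi.single i 1)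
    rw [← hF, ← Matrix.mulVec_mulVec, ← Matrix.mulVec_mulVec, hA]
    have h1 := he ⟨x, h hx⟩ F
    simp only at h1
    rw [h1, hA]
    change _ = (F : H → Fin n → ℂ) (1 * ⟨x, h hx⟩)
    have h2 := hU.1 F F.2 ⟨x, hx⟩ 1
    rw [one_mul, ← h2, mul_one]
    rfl
  · intro h0
    obtain ⟨F, hF⟩ := exists_ne (0 : U)
    apply hF
    apply Subtype.ext
    funext z
    have h1 := hA (R z F)
    rw [h0, Matrix.zero_mulVec] at h1
    have h2 : ((R z F : U) : H → Fin n → ℂ) 1 = (F : H → Fin n → ℂ) (1 * z) := rfl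
    rw [h2, one_mul] at h1
    exact h1.symm

end IrrMatrices

section Clifford

variable {Γ : Type*} [Group Γ] {H K X Y T : Subgroup Γ} {n m k : ℕ}
  {ρ : Γ → Matrix (Fin n) (Fin n) ℂ} {σ : Γ → Matrix (Fin m) (Fin m) ℂ}

/-! ### Conjugation and twisting -/

namespace Irr

theorem conj_apply (θ : Irr H) {x : Γ} (hx : x ∈ Subgroup.normalizer (H : Set Γ)) (y : H) :
    θ.conj x hx y =
      θ ⟨x⁻¹ * y * x, (Subgroup.mem_normalizer_iff''.1 hx y).1 y.2⟩ := by
  change θ ((H.normalizerMonoidHom ⟨x, hx⟩)⁻¹ y) = _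
  rw [← map_inv]
  congr 1
  apply Subtype.ext
  change x⁻¹ * y * x⁻¹⁻¹ = _
  rw [inv_inv]

theorem conj_one (θ : Irr H) : θ.conj 1 (Subgroup.one_mem _) = θ := by
  ext y
  rw [conj_apply]
  simp

theorem conj_conj (θ : Irr H) {x y : Γ} (hx : x ∈ Subgroup.normalizer (H : Set Γ))
    (hy : y ∈ Subgroup.normalizer (H : Set Γ)) :
    (θ.conj y hy).conj x hx = θ.conj (x * y) (Subgroup.mul_mem _ hx hy) := by
  ext z
  simp only [conj_apply]
  congr 1
  apply Subtype.ext
  simp [mul_assoc]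

theorem mem_inertia_iff {θ : Irr H} {x : Γ} :
    x ∈ θ.inertia ↔ ∃ hx : x ∈ Subgroup.normalizer (H : Set Γ), θ.conj x hx = θ := by
  constructor
  · rintro ⟨⟨y, hy⟩, h, rfl⟩
    exact ⟨hy, h⟩
  · rintro ⟨hx, h⟩
    exact ⟨⟨x, hx⟩, h, rfl⟩

theorem inertia_le_normalizer (θ : Irr H) : θ.inertia ≤ Subgroup.normalizer (H : Set Γ) :=
  fun _ hx => (mem_inertia_iff.1 hx).1

theorem conj_eq_conj_iff (θ : Irr H) {x y : Γ} (hx : x ∈ Subgroup.normalizer (H : Set Γ))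
    (hy : y ∈ Subgroup.normalizer (H : Set Γ)) :
    θ.conj x hx = θ.conj y hy ↔ y⁻¹ * x ∈ θ.inertia := by
  have hy' := Subgroup.inv_mem _ hy
  rw [mem_inertia_iff]
  constructor
  · intro h
    refine ⟨Subgroup.mul_mem _ hy' hx, ?_⟩
    rw [← conj_conj θ hy' hx, h, conj_conj]
    simp [conj_one]
  · rintro ⟨h1, h2⟩
    conv_rhs => rw [← h2, conj_conj]
    simp

theorem isPPrime_conj {p : ℕ} {θ : Irr H} {x : Γ}
    (hx : x ∈ Subgroup.normalizer (H : Set Γ)) :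
    (θ.conj x hx).IsPPrime p ↔ θ.IsPPrime p := by
  have : θ.conj x hx 1 = θ 1 := by
    rw [conj_apply]
    congr 1
    apply Subtype.ext
    simp
  rw [IsPPrime, IsPPrime, this]

theorem liesOver_conj (h : K ≤ H) {χ : Irr H} {θ : Irr K} {x : Γ}
    (hx : x ∈ Subgroup.normalizer (H : Set Γ)) (hx' : x ∈ Subgroup.normalizer (K : Set Γ)) :
    (χ.conj x hx).LiesOver (Subgroup.inclusion h) (θ.conj x hx') ↔
      χ.LiesOver (Subgroup.inclusion h) θ := by
  rw [LiesOver, LiesOver]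
  refine not_congr (Eq.congr_left ?_)
  rw [← finsum_comp_equiv (K.normalizerMonoidHom ⟨x, hx'⟩).toEquiv]
  refine finsum_congr fun y => ?_
  rw [conj_apply, conj_apply]
  have h1 : x⁻¹ * ((K.normalizerMonoidHom ⟨x, hx'⟩).toEquiv y : Γ) * x = y := by
    change x⁻¹ * (x * y * x⁻¹) * x = y
    group
  congr 2
  · exact Subtype.ext h1
  · exact congrArg _ (Subtype.ext h1)

theorem liesOver_twist (h : K ≤ H) {χ : Irr H} {θ : Irr K} {l : H →* ℂˣ}
    (hl : ∀ x : K, l (Subgroup.inclusion h x) = 1) :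
    (χ.twist l).LiesOver (Subgroup.inclusion h) θ ↔ χ.LiesOver (Subgroup.inclusion h) θ := by
  rw [LiesOver, LiesOver]
  refine not_congr (Eq.congr_left (finsum_congr fun y => ?_))
  change χ _ * (l _ : ℂ) * _ = _
  rw [hl, Units.val_one, mul_one]

theorem twist_apply (χ : Irr H) (l : H →* ℂˣ) (x : H) : χ.twist l x = χ x * (l x : ℂ) := rfl

end Irr

theorem Affords.conj {θ : Irr H} (h : Affords θ ρ) {x : Γ}
    (hx : x ∈ Subgroup.normalizer (H : Set Γ)) :
    Affords (θ.conj x hx) (fun y => ρ (x⁻¹ * y * x)) where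
  one := by simp [h.one]
  mul y hy z hz := by
    rw [← h.mul _ ((Subgroup.mem_normalizer_iff''.1 hx y).1 hy) _
      ((Subgroup.mem_normalizer_iff''.1 hx z).1 hz)]
    congr 1
    group
  pos := h.pos
  schur M hM := h.schur M fun y hy => by
    have := hM (x * y * x⁻¹) ((Subgroup.mem_normalizer_iff.1 hx y).1 hy)
    simpa [mul_assoc] using this
  trace y := by
    rw [Irr.conj_apply, h.trace]

/-- A linear character of `Y`, as a function on `Γ`. -/
def linFun (l : Y →* ℂˣ) (x : Γ) : ℂ := extendFun (fun y : Y => (l y : ℂ)) 1 x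

theorem linFun_of_mem (l : Y →* ℂˣ) {x : Γ} (hx : x ∈ Y) : linFun l x = l ⟨x, hx⟩ :=
  extendFun_of_mem _ _ hx

theorem linFun_ne_zero (l : Y →* ℂˣ) (x : Γ) : linFun l x ≠ 0 := by
  by_cases hx : x ∈ Y
  · rw [linFun_of_mem l hx]
    exact Units.ne_zero _
  · simp [linFun, extendFun, hx]

theorem linFun_one (l : Y →* ℂˣ) : linFun l 1 = 1 := by
  rw [linFun_of_mem l Y.one_mem]
  have : (⟨1, Y.one_mem⟩ : Y) = 1 := rfl
  simp [this]

theorem linFun_mul (l : Y →* ℂˣ) {x y : Γ} (hx : x ∈ Y) (hy : y ∈ Y) :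
    linFun l (x * y) = linFun l x * linFun l y := by
  rw [linFun_of_mem l hx, linFun_of_mem l hy, linFun_of_mem l (Y.mul_mem hx hy),
    ← Units.val_mul, ← map_mul]
  rfl

theorem IsMatRep.twist (h : IsMatRep H ρ) (hH : H ≤ Y) (l : Y →* ℂˣ) :
    IsMatRep H (fun x => linFun l x • ρ x) where
  one := by simp [h.one, linFun_one]
  mul x hx y hy := by
    rw [linFun_mul l (hH hx) (hH hy), h.mul x hx y hy, Matrix.smul_mul, Matrix.mul_smul, smul_smul]

theorem IsMatIrrep.twist (h : IsMatIrrep H ρ) (hH : H ≤ Y) (l : Y →* ℂˣ) :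
    IsMatIrrep H (fun x => linFun l x • ρ x) :=
  { h.toIsMatRep.twist hH l with
    pos := h.pos
    schur := fun M hM => h.schur M fun x hx => by
      have := hM x hx
      simp only [Matrix.mul_smul, Matrix.smul_mul] at this
      exact smul_right_injective _ (linFun_ne_zero l x) this }

theorem Affords.twist {χ : Irr H} (h : Affords χ ρ) (l : H →* ℂˣ) :
    Affords (χ.twist l) (fun x => linFun l x • ρ x) :=
  { h.toIsMatIrrep.twist le_rfl l with
    trace := fun x => by
      rw [Irr.twist_apply, h.trace, Matrix.trace_smul, linFun_of_mem l x.2, mul_comm]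
      rfl }

theorem Irr.conj_of_mem (θ : Irr H) {x : Γ} (hx : x ∈ H) :
    θ.conj x (Subgroup.le_normalizer hx) = θ := by
  obtain ⟨n, ρ, hρ⟩ := θ.exists_affords
  ext y
  rw [(hρ.conj (Subgroup.le_normalizer hx)).trace, hρ.trace]
  simpa using hρ.toIsMatRep.trace_conj (H.inv_mem hx) y.2

theorem Irr.le_inertia (θ : Irr H) : H ≤ θ.inertia := fun _ hx =>
  Irr.mem_inertia_iff.2 ⟨_, θ.conj_of_mem hx⟩

variable [Finite Γ]

attribute [local instance] fintypeSubgroup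

/-- A representation with an irreducible character is irreducible. -/
theorem IsMatRep.affords_of_trace_eq {θ : Irr H} (h : IsMatRep H ρ)
    (htr : ∀ x : H, θ x = (ρ x).trace) : Affords θ ρ := by
  obtain ⟨m, σ, hσ⟩ := θ.exists_affords
  have hnm : m = n := by
    have h1 := hσ.trace 1
    rw [htr, OneMemClass.coe_one, h.one, hσ.one, Matrix.trace_one, Matrix.trace_one,
      Fintype.card_fin, Fintype.card_fin] at h1
    exact_mod_cast h1.symm
  subst hnm
  obtain ⟨A0, hA00, hA0⟩ := hσ.exists_intertwines hσ
  obtain ⟨A, hA0, hA⟩ := (sum_trace_ne_zero_iff hσ.toIsMatRep h).1 (by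
    have h1 := (sum_trace_ne_zero_iff hσ.toIsMatRep hσ.toIsMatRep).2 ⟨A0, hA00, hA0⟩
    rwa [Finset.sum_congr rfl fun x _ => by rw [← htr, hσ.trace]])
  obtain ⟨B, hB, hBA⟩ := hσ.exists_leftInverse h hA hA0
  -- The degrees agree, so `A` is square, its left inverse is two-sided, and Schur's property passes
  -- from `σ` to `ρ`.
  have hAB : A * B = 1 := mul_eq_one_comm.1 hBA
  refine ⟨⟨h, hσ.pos, fun M hM => ?_⟩, htr⟩
  obtain ⟨c, hc⟩ := hσ.schur (B * M * A) fun x hx => by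
    rw [Matrix.mul_assoc, ← hA x hx, ← Matrix.mul_assoc, Matrix.mul_assoc B, hM x hx,
      ← Matrix.mul_assoc B, ← hB x hx]
    simp only [Matrix.mul_assoc]
  refine ⟨c, ?_⟩
  calc M = A * (B * M * A) * B := by
        simp only [← Matrix.mul_assoc]
        rw [hAB, Matrix.one_mul, Matrix.mul_assoc, hAB, Matrix.mul_one]
    _ = c • 1 := by rw [hc, Matrix.mul_smul, Matrix.mul_one, Matrix.smul_mul, hAB]

/-- An extension of `θ` in matrix form. -/
theorem Irr.ExtendsTo.exists_isMatRep {θ : Irr X} (h : θ.ExtendsTo T) :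
    ∃ (n : ℕ) (ρ : Γ → Matrix (Fin n) (Fin n) ℂ), X ≤ T ∧ IsMatRep T ρ ∧ Affords θ ρ := by
  obtain ⟨hXT, η, hη⟩ := h
  obtain ⟨n, ρ, hρ⟩ := η.exists_affords
  refine ⟨n, ρ, hXT, hρ.toIsMatRep,
    (hρ.toIsMatRep.mono hXT).affords_of_trace_eq fun x => ?_⟩
  rw [← hη, hρ.trace]
  rfl

/-! ### Constituents of restrictions to normal subgroups -/

/-- The matrix `B * σ y * A` intertwines the conjugate of `ρ` by `y` with `ρ'`. All later vanishing
statements for terms of an average come from this. -/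
theorem Affords.conj_eq_of_mul_ne_zero {θ θ' : Irr X} {ρ' : Γ → Matrix (Fin k) (Fin k) ℂ}
    (hXY : X ≤ Y) (hρ : Affords θ ρ) (hρ' : Affords θ' ρ') (hσ : IsMatRep Y σ)
    {A : Matrix (Fin m) (Fin n) ℂ} {B : Matrix (Fin k) (Fin m) ℂ} (hA : Intertwines X ρ σ A)
    (hB : Intertwines X σ ρ' B) {y : Γ} (hy : y ∈ Y)
    (hyX : y ∈ Subgroup.normalizer (X : Set Γ)) (hne : B * σ y * A ≠ 0) :
    θ.conj y hyX = θ' := by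
  refine (hρ.conj hyX).eq_of_intertwines hρ' (A := B * σ y * A) (fun x hx => ?_) hne
  have hx' : y⁻¹ * x * y ∈ X := (Subgroup.mem_normalizer_iff''.1 hyX x).1 hx
  rw [← Matrix.mul_assoc, ← Matrix.mul_assoc, hB x hx, Matrix.mul_assoc B, ← hσ.mul x (hXY hx) y hy,
    Matrix.mul_assoc _ A, ← hA _ hx', ← Matrix.mul_assoc, Matrix.mul_assoc B (σ y),
    ← hσ.mul y hy _ (hXY hx')]
  congr 3
  group

/-- The average of `A * B` for `B * A = 1` is a nonzero scalar. -/
theorem IsMatIrrep.average_mul (hσ : IsMatIrrep Y σ) (hn : 0 < n)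
    {A : Matrix (Fin m) (Fin n) ℂ} {B : Matrix (Fin n) (Fin m) ℂ} (hBA : B * A = 1) :
    ∃ c : ℂ, c ≠ 0 ∧ averageIntertwiner Y σ σ (A * B) = c • 1 := by
  obtain ⟨c, hc⟩ := hσ.schur (averageIntertwiner Y σ σ (A * B)) fun x hx =>
    ((intertwines_average hσ.toIsMatRep hσ.toIsMatRep (A * B)) x hx).symm
  refine ⟨c, ?_, hc⟩
  rintro rfl
  have h1 := congrArg Matrix.trace hc
  rw [zero_smul, Matrix.trace_zero, averageIntertwiner, Matrix.trace_sum,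
    Finset.sum_congr rfl (g := fun _ => (n : ℂ)) fun x _ => ?_] at h1
  · rw [Finset.sum_const, Finset.card_univ, ← Nat.cast_smul_eq_nsmul ℂ, smul_eq_mul] at h1
    exact (mul_eq_zero.1 h1).elim (card_subgroup_ne_zero Y) (Nat.cast_ne_zero.2 hn.ne')
  · rw [Matrix.trace_mul_comm, ← Matrix.mul_assoc, hσ.inv_mul x.2, Matrix.one_mul,
      Matrix.trace_mul_comm, hBA, Matrix.trace_one, Fintype.card_fin]

/-- The constituents of the restriction of an irreducible character to a normal subgroup are
conjugate. -/
theorem Irr.LiesOver.exists_conj_eq (hXY : X ≤ Y) (hYX : Y ≤ Subgroup.normalizer (X : Set Γ))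
    {χ : Irr Y} {θ θ' : Irr X} (h : χ.LiesOver (Subgroup.inclusion hXY) θ)
    (h' : χ.LiesOver (Subgroup.inclusion hXY) θ') :
    ∃ (y : Γ) (hy : y ∈ Y), θ.conj y (hYX hy) = θ' := by
  obtain ⟨m, σ, hσ⟩ := χ.exists_affords
  obtain ⟨n, ρ, hρ⟩ := θ.exists_affords
  obtain ⟨k, ρ', hρ'⟩ := θ'.exists_affords
  have hσX := hσ.toIsMatRep.mono hXY
  obtain ⟨A, hA0, hA⟩ := (hσ.liesOver_iff hXY hρ).1 h
  obtain ⟨A', hA0', hA'⟩ := (hσ.liesOver_iff hXY hρ').1 h'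
  obtain ⟨B, hB, hBA⟩ := hρ.toIsMatIrrep.exists_leftInverse hσX hA hA0
  obtain ⟨B', hB0', hB'⟩ := Intertwines.exists_symm hρ'.toIsMatRep hσX hA' hA0'
  obtain ⟨c, hc0, hc⟩ := hσ.toIsMatIrrep.average_mul hρ.pos hBA
  -- If no conjugate of `θ` equals `θ'`, every term of `B'` times the average of `A * B` vanishes,
  -- although that average is a nonzero scalar.
  by_contra hno
  push Not at hno
  have h1 : c • B' = 0 := by
    calc c • B' = B' * averageIntertwiner Y σ σ (A * B) := by
          rw [hc, Matrix.mul_smul, Matrix.mul_one]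
      _ = 0 := by
          rw [averageIntertwiner, Matrix.mul_sum]
          refine Finset.sum_eq_zero fun y _ => ?_
          have h2 : B' * σ y * A = 0 := by
            by_contra h3
            exact hno y y.2 (hρ.conj_eq_of_mul_ne_zero hXY hρ' hσ.toIsMatRep hA hB' y.2
              (hYX y.2) h3)
          rw [← Matrix.mul_assoc, ← Matrix.mul_assoc, ← Matrix.mul_assoc, h2]
          simp
  exact hB0' ((smul_eq_zero.1 h1).resolve_left hc0)

end Clifford

/-! ### The Clifford correspondence and Gallagher's theorem for extendible characters -/

section CliffordCorrespondence

variable {Γ : Type*} [Group Γ] {H K X Y T : Subgroup Γ} {n m k : ℕ}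
  {ρ : Γ → Matrix (Fin n) (Fin n) ℂ} {σ : Γ → Matrix (Fin m) (Fin m) ℂ}
  [Finite Γ]

attribute [local instance] fintypeSubgroup

/-- An element of `Y` outside `T` does not fix `θ`, so the corresponding intertwiner between `θ` and
a different conjugate must be zero. -/
theorem Affords.mul_eq_zero_of_notMem {θ : Irr X} (hXY : X ≤ Y)
    (hYX : Y ≤ Subgroup.normalizer (X : Set Γ)) (hT : Y ⊓ θ.inertia ≤ T)
    (hρ : Affords θ ρ) (hσ : IsMatRep Y σ) {A : Matrix (Fin m) (Fin n) ℂ}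
    {B : Matrix (Fin n) (Fin m) ℂ} (hA : Intertwines X ρ σ A) (hB : Intertwines X σ ρ B)
    {y : Γ} (hy : y ∈ Y) (hyT : y ∉ T) : B * σ y⁻¹ * A = 0 := by
  by_contra hne
  have h1 := hρ.conj_eq_of_mul_ne_zero hXY hρ hσ hA hB (Y.inv_mem hy) (hYX (Y.inv_mem hy)) hne
  have h2 : y⁻¹ ∈ θ.inertia := Irr.mem_inertia_iff.2 ⟨_, h1⟩
  exact hyT (hT ⟨hy, (Subgroup.inv_mem_iff _).1 h2⟩)

/-- The Clifford correspondence: an irreducible character is determined by the extension of `θ` to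
the inertia group over which it lies. -/
theorem exists_intertwines_of_inertia {θ : Irr X} (hXT : X ≤ T) (hTY : T ≤ Y)
    (hYX : Y ≤ Subgroup.normalizer (X : Set Γ)) (hT : Y ⊓ θ.inertia ≤ T)
    (hρ : Affords θ ρ) (hρT : IsMatRep T ρ) {σ' : Γ → Matrix (Fin k) (Fin k) ℂ}
    (hσ : IsMatRep Y σ) (hσ' : IsMatRep Y σ') {A : Matrix (Fin m) (Fin n) ℂ}
    (hA : Intertwines T ρ σ A) (hA0 : A ≠ 0) {A' : Matrix (Fin k) (Fin n) ℂ}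
    (hA' : Intertwines T ρ σ' A') (hA0' : A' ≠ 0) :
    ∃ C, C ≠ 0 ∧ Intertwines Y σ σ' C := by
  classical
  have hρi : IsMatIrrep T ρ := IsMatIrrep.of_le hρT hXT hρ.toIsMatIrrep
  obtain ⟨B, hB, hBA⟩ := hρi.exists_leftInverse (hσ.mono hTY) hA hA0
  obtain ⟨B', hB', hBA'⟩ := hρi.exists_leftInverse (hσ'.mono hTY) hA' hA0'
  refine ⟨_, fun h0 => ?_, intertwines_average hσ hσ' (A' * B)⟩
  -- Compressed to the copies of `ρ`, the average loses all terms outside `T`, while each term in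
  -- `T` contributes the identity.
  have h1 : B' * averageIntertwiner Y σ σ' (A' * B) * A =
      ((Finset.univ.filter fun y : Y => (y : Γ) ∈ T).card : ℂ) • 1 := by
    rw [averageIntertwiner, Matrix.mul_sum, Matrix.sum_mul,
      Finset.sum_congr rfl (g := fun y : Y => if (y : Γ) ∈ T then 1 else 0) fun y _ => ?_]
    · rw [← Finset.sum_filter, Finset.sum_const, ← Nat.cast_smul_eq_nsmul ℂ]
    · split_ifs with hy
      · calc B' * (σ' y * (A' * B) * σ (y : Γ)⁻¹) * A
            = B' * (σ' y * A') * B * (σ (y : Γ)⁻¹ * A) := by simp only [Matrix.mul_assoc]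
          _ = (B' * A') * ρ y * (B * A) * ρ (y : Γ)⁻¹ := by
            rw [hA' y hy, hA _ (T.inv_mem hy)]
            simp only [Matrix.mul_assoc]
          _ = 1 := by rw [hBA, hBA', Matrix.one_mul, Matrix.mul_one, hρT.mul_inv hy]
      · calc B' * (σ' y * (A' * B) * σ (y : Γ)⁻¹) * A
            = B' * σ' y * A' * (B * σ (y : Γ)⁻¹ * A) := by simp only [Matrix.mul_assoc]
          _ = 0 := by
            rw [hρ.mul_eq_zero_of_notMem (hXT.trans hTY) hYX hT hσ (hA.mono hXT) (hB.mono hXT)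
              y.2 hy, Matrix.mul_zero]
  rw [h0, Matrix.mul_zero, Matrix.zero_mul] at h1
  have h2 : ((Finset.univ.filter fun y : Y => (y : Γ) ∈ T).card : ℂ) ≠ 0 := by
    refine Nat.cast_ne_zero.2 (Finset.card_ne_zero_of_mem (a := (1 : Y)) ?_)
    simp [T.one_mem]
  have : Nonempty (Fin n) := ⟨⟨0, hρ.pos⟩⟩
  exact (smul_eq_zero.1 h1.symm).elim h2 one_ne_zero

/-- An extension of `θ` to the inertia group occurs only once in an irreducible representation. -/
theorem Intertwines.eq_smul {θ : Irr X} (hXT : X ≤ T) (hTY : T ≤ Y)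
    (hYX : Y ≤ Subgroup.normalizer (X : Set Γ)) (hT : Y ⊓ θ.inertia ≤ T)
    (hρ : Affords θ ρ) (hρT : IsMatRep T ρ) (hσ : IsMatIrrep Y σ)
    {A C : Matrix (Fin m) (Fin n) ℂ}
    (hA : Intertwines T ρ σ A) (hA0 : A ≠ 0) (hC : Intertwines X ρ σ C) :
    ∃ c : ℂ, C = c • A := by
  classical
  have hρi : IsMatIrrep T ρ := IsMatIrrep.of_le hρT hXT hρ.toIsMatIrrep
  obtain ⟨B, hB, hBA⟩ := hρi.exists_leftInverse (hσ.toIsMatRep.mono hTY) hA hA0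
  obtain ⟨c, hc0, hc⟩ := hσ.average_mul hρ.pos hBA
  obtain ⟨d, hd⟩ := hρ.schur (B * C) fun x hx => (((hB.mono hXT).mul hC) x hx).symm
  -- Inserting the scalar average of `A * B` in front of `C` removes the terms outside `T`; the rest
  -- factor through `A`.
  have h1 : c • C = A * ∑ y : Y, if (y : Γ) ∈ T then ρ y * B * σ (y : Γ)⁻¹ * C else 0 := by
    calc c • C = averageIntertwiner Y σ σ (A * B) * C := by
          rw [hc, Matrix.smul_mul, Matrix.one_mul]
      _ = _ := by
        rw [averageIntertwiner, Matrix.sum_mul, Matrix.mul_sum]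
        refine Finset.sum_congr rfl fun y _ => ?_
        split_ifs with hy
        · rw [← Matrix.mul_assoc, hA y hy]
          simp only [Matrix.mul_assoc]
        · calc σ y * (A * B) * σ (y : Γ)⁻¹ * C = σ y * A * (B * σ (y : Γ)⁻¹ * C) := by
                simp only [Matrix.mul_assoc]
            _ = A * (0 : Matrix (Fin n) (Fin n) ℂ) := by
              rw [hρ.mul_eq_zero_of_notMem (hXT.trans hTY) hYX hT hσ.toIsMatRep hC
                (hB.mono hXT) y.2 hy, Matrix.mul_zero, Matrix.mul_zero]
  set M := ∑ y : Y, if (y : Γ) ∈ T then ρ y * B * σ (y : Γ)⁻¹ * C else 0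
  have h2 : c • (B * C) = M := by
    rw [← Matrix.mul_smul, h1, ← Matrix.mul_assoc, hBA, Matrix.one_mul]
  refine ⟨d, smul_right_injective _ hc0 ?_⟩
  change c • C = c • d • A
  rw [h1, ← h2, hd, Matrix.mul_smul, Matrix.mul_smul, Matrix.mul_one]

/-- An irreducible character lies over only one extension of `θ` to the inertia group. -/
theorem extension_unique {θ : Irr X} (hXT : X ≤ T) (hTY : T ≤ Y)
    (hYX : Y ≤ Subgroup.normalizer (X : Set Γ)) (hT : Y ⊓ θ.inertia ≤ T)
    (hρ : Affords θ ρ) (hρT : IsMatRep T ρ) (hσ : IsMatIrrep Y σ)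
    {ρ' : Γ → Matrix (Fin n) (Fin n) ℂ} (hρρ' : ∀ x ∈ X, ρ' x = ρ x)
    {A A' : Matrix (Fin m) (Fin n) ℂ} (hA : Intertwines T ρ σ A) (hA0 : A ≠ 0)
    (hA' : Intertwines T ρ' σ A') (hA0' : A' ≠ 0) : ∀ t ∈ T, ρ' t = ρ t := by
  have hρi : IsMatIrrep T ρ := IsMatIrrep.of_le hρT hXT hρ.toIsMatIrrep
  obtain ⟨B, hB, hBA⟩ := hρi.exists_leftInverse (hσ.toIsMatRep.mono hTY) hA hA0
  -- Since `ρ'` and `ρ` agree on `X`, the map `A'` is an intertwiner over `X` and hence a multiple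
  -- of `A`. The image of `A` then carries both extensions.
  obtain ⟨c, hc⟩ := Intertwines.eq_smul hXT hTY hYX hT hρ hρT hσ hA hA0 (C := A')
    fun x hx => by rw [hA' x (hXT hx), hρρ' x hx]
  have hc0 : c ≠ 0 := by
    rintro rfl
    exact hA0' (by rw [hc, zero_smul])
  intro t ht
  have h1 := hA' t ht
  rw [hc, Matrix.mul_smul, hA t ht, Matrix.smul_mul] at h1
  have h2 := smul_right_injective _ hc0 h1
  have h3 := congrArg (fun M => B * M) h2
  simp only [← Matrix.mul_assoc, hBA, Matrix.one_mul] at h3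
  exact h3.symm

/-! ### Linear characters of an abelian quotient -/

section Linear

variable {Q : Type*} [CommGroup Q] [Finite Q]

/-- Multiplication by a character that is nontrivial at `a` permutes the summands and scales the sum
by a number other than `1`. -/
theorem sum_linear_characters [Fintype (Q →* ℂˣ)] {a : Q} (ha : a ≠ 1) :
    ∑ l : Q →* ℂˣ, (l a : ℂ) = 0 := by
  obtain ⟨φ, hφ⟩ := CommGroup.exists_apply_ne_one_of_hasEnoughRootsOfUnity Q ℂ ha
  have h1 : (φ a : ℂ) * ∑ l : Q →* ℂˣ, (l a : ℂ) = ∑ l : Q →* ℂˣ, (l a : ℂ) := by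
    rw [Finset.mul_sum, ← Equiv.sum_comp (Equiv.mulLeft φ) (fun l : Q →* ℂˣ => (l a : ℂ))]
    exact Finset.sum_congr rfl fun l _ => by simp
  have h2 : ((φ a : ℂ) - 1) * ∑ l : Q →* ℂˣ, (l a : ℂ) = 0 := by
    rw [sub_mul, h1, one_mul, sub_self]
  refine (mul_eq_zero.1 h2).resolve_left fun h3 => hφ (Units.ext ?_)
  exact sub_eq_zero.1 h3

/-- Elements outside of a subgroup are detected by linear characters trivial on the subgroup. -/
theorem Subgroup.exists_linear_character_ne_one (B : Subgroup Q) {a : Q} (ha : a ∉ B) :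
    ∃ l : Q →* ℂˣ, (∀ b ∈ B, l b = 1) ∧ l a ≠ 1 := by
  obtain ⟨φ, hφ⟩ := CommGroup.exists_apply_ne_one_of_hasEnoughRootsOfUnity (Q ⧸ B) ℂ
    (a := (a : Q ⧸ B)) (by rwa [Ne, QuotientGroup.eq_one_iff])
  refine ⟨φ.comp (QuotientGroup.mk' B), fun b hb => ?_, hφ⟩
  change φ (b : Q ⧸ B) = 1
  rw [(QuotientGroup.eq_one_iff b).2 hb, map_one]

/-- An intertwiner over the normal subgroup can be replaced by one over the inertia group, up to a
linear character. -/
theorem exists_intertwines_twist {q : Y →* Q} (hq : ∀ y : Y, q y = 1 ↔ (y : Γ) ∈ X)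
    (hTY : T ≤ Y) (hρT : IsMatRep T ρ) (hσ : IsMatRep Y σ) {C : Matrix (Fin m) (Fin n) ℂ}
    (hC : Intertwines X ρ σ C) (hC0 : C ≠ 0) :
    ∃ (l : Q →* ℂˣ) (A : Matrix (Fin m) (Fin n) ℂ), A ≠ 0 ∧
      Intertwines T (fun x => linFun (l.comp q) x • ρ x) σ A := by
  classical
  have := Fintype.ofFinite (Q →* ℂˣ)
  by_contra hno
  push Not at hno
  have h0 : ∀ l : Q →* ℂˣ,
      averageIntertwiner T (fun x => linFun (l.comp q) x • ρ x) σ C = 0 := fun l => by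
    by_contra h1
    exact hno l _ h1 (intertwines_average (hρT.twist hTY _) (hσ.mono hTY) C)
  -- By orthogonality, summing the averages over all linear characters kills the terms outside `X`.
  -- Each term in `X` gives a multiple of `C` itself.
  have h1 : ∑ l : Q →* ℂˣ, averageIntertwiner T (fun x => linFun (l.comp q) x • ρ x) σ C =
      ((Fintype.card (Q →* ℂˣ) : ℂ) * (Finset.univ.filter fun t : T => (t : Γ) ∈ X).card) • C := by
    simp only [averageIntertwiner]
    rw [Finset.sum_comm, Finset.sum_congr rfl (g := fun t : T => if (t : Γ) ∈ X then
      (Fintype.card (Q →* ℂˣ) : ℂ) • C else 0) fun t _ => ?_]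
    · rw [← Finset.sum_filter, Finset.sum_const, ← Nat.cast_smul_eq_nsmul ℂ, smul_smul, mul_comm]
    · have htY := Y.inv_mem (hTY t.2)
      have h2 : ∀ l : Q →* ℂˣ, linFun (l.comp q) (t : Γ)⁻¹ = (l (q ⟨_, htY⟩) : ℂ) := fun l =>
        linFun_of_mem _ htY
      simp only [Matrix.mul_smul, h2]
      rw [← Finset.sum_smul]
      split_ifs with ht
      · have h3 : q ⟨_, htY⟩ = 1 := (hq _).2 (X.inv_mem ht)
        rw [hC t ht, Matrix.mul_assoc, hρT.mul_inv t.2, Matrix.mul_one]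
        simp [h3]
      · rw [sum_linear_characters, zero_smul]
        rw [Ne, hq]
        exact fun h4 => ht ((X.inv_mem_iff).1 h4)
  rw [Finset.sum_eq_zero fun l _ => h0 l] at h1
  have h2 : ((Finset.univ.filter fun t : T => (t : Γ) ∈ X).card : ℂ) ≠ 0 := by
    refine Nat.cast_ne_zero.2 (Finset.card_ne_zero_of_mem (a := (1 : T)) ?_)
    simp [X.one_mem]
  have h3 : (Fintype.card (Q →* ℂˣ) : ℂ) ≠ 0 := Nat.cast_ne_zero.2 Fintype.card_ne_zero
  exact (smul_eq_zero.1 h1.symm).elim (mul_ne_zero h3 h2) hC0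

/-- Gallagher and Clifford: the irreducible characters over an extendible character are the
twists of one of them. -/
theorem Irr.LiesOver.exists_twist {q : Y →* Q} (hq : ∀ y : Y, q y = 1 ↔ (y : Γ) ∈ X)
    (hXY : X ≤ Y) (hYX : Y ≤ Subgroup.normalizer (X : Set Γ)) {θ : Irr X}
    (hθ : θ.ExtendsTo (Y ⊓ θ.inertia)) {χ χ' : Irr Y}
    (h : χ.LiesOver (Subgroup.inclusion hXY) θ) (h' : χ'.LiesOver (Subgroup.inclusion hXY) θ) :
    ∃ l : Q →* ℂˣ, χ' = χ.twist (l.comp q) := by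
  obtain ⟨n, ρ, hXT, hρT, hρ⟩ := hθ.exists_isMatRep
  obtain ⟨m, σ, hσ⟩ := χ.exists_affords
  obtain ⟨k, σ', hσ'⟩ := χ'.exists_affords
  obtain ⟨C, hC0, hC⟩ := (hσ.liesOver_iff hXY hρ).1 h
  obtain ⟨C', hC0', hC'⟩ := (hσ'.liesOver_iff hXY hρ).1 h'
  have hTY : Y ⊓ θ.inertia ≤ Y := inf_le_left
  obtain ⟨l, A, hA0, hA⟩ := exists_intertwines_twist hq hTY hρT hσ.toIsMatRep hC hC0
  obtain ⟨l', A', hA0', hA'⟩ := exists_intertwines_twist hq hTY hρT hσ'.toIsMatRep hC' hC0'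
  -- The characters `χ` and `χ'` lie over the twists of `ρ` by `l` and by `l'`. Twisting `χ` by the
  -- quotient puts both over the same extension, where the Clifford correspondence applies.
  refine ⟨l⁻¹ * l', ?_⟩
  have hτ := hσ.twist ((l⁻¹ * l').comp q)
  have hρ' : Affords θ (fun x => linFun (l'.comp q) x • ρ x) := by
    refine ((hρT.mono hXT).twist hXY _).affords_of_trace_eq fun x => ?_
    rw [hρ.trace, linFun_of_mem _ (hXY x.2)]
    have : q ⟨x, hXY x.2⟩ = 1 := (hq _).2 x.2
    simp [this]
  have hAτ : Intertwines (Y ⊓ θ.inertia) (fun x => linFun (l'.comp q) x • ρ x)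
      (fun x => linFun ((l⁻¹ * l').comp q) x • σ x) A := by
    intro t ht
    have h1 := hA t ht
    rw [Matrix.smul_mul, h1, Matrix.mul_smul, Matrix.mul_smul, smul_smul]
    congr 1
    rw [linFun_of_mem _ ht.1, linFun_of_mem _ ht.1, linFun_of_mem _ ht.1]
    simp only [MonoidHom.comp_apply, MonoidHom.mul_apply, MonoidHom.inv_apply]
    rw [← Units.val_mul]
    congr 1
    rw [mul_right_comm, inv_mul_cancel, one_mul]
  obtain ⟨D, hD0, hD⟩ := exists_intertwines_of_inertia hXT hTY hYX le_rfl hρ'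
    (hρT.twist hTY _) hσ'.toIsMatRep hτ.toIsMatRep hA' hA0' hAτ hA0
  exact hσ'.eq_of_intertwines hτ hD hD0

/-- A twist by a linear character fixes `χ` if and only if the linear character is trivial on the
inertia group. -/
theorem Irr.LiesOver.twist_eq_iff {q : Y →* Q} (hq : ∀ y : Y, q y = 1 ↔ (y : Γ) ∈ X)
    (hXY : X ≤ Y) (hYX : Y ≤ Subgroup.normalizer (X : Set Γ)) {θ : Irr X}
    (hθ : θ.ExtendsTo (Y ⊓ θ.inertia)) {χ : Irr Y}
    (h : χ.LiesOver (Subgroup.inclusion hXY) θ) (l : Q →* ℂˣ) :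
    χ.twist (l.comp q) = χ ↔ ∀ (t : Γ) (ht : t ∈ Y), t ∈ θ.inertia → l (q ⟨t, ht⟩) = 1 := by
  obtain ⟨n, ρ, hXT, hρT, hρ⟩ := hθ.exists_isMatRep
  obtain ⟨m, σ, hσ⟩ := χ.exists_affords
  obtain ⟨C, hC0, hC⟩ := (hσ.liesOver_iff hXY hρ).1 h
  have hTY : Y ⊓ θ.inertia ≤ Y := inf_le_left
  obtain ⟨l₁, A, hA0, hA⟩ := exists_intertwines_twist hq hTY hρT hσ.toIsMatRep hC hC0
  set ρ₁ : Γ → Matrix (Fin n) (Fin n) ℂ := fun x => linFun (l₁.comp q) x • ρ x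
  have hρT₁ : IsMatRep (Y ⊓ θ.inertia) ρ₁ := hρT.twist hTY _
  have hρ₁ : Affords θ ρ₁ := by
    refine (hρT₁.mono hXT).affords_of_trace_eq fun x => ?_
    have : q ⟨x, hXY x.2⟩ = 1 := (hq _).2 x.2
    simp [ρ₁, hρ.trace, linFun_of_mem _ (hXY x.2), this]
  have hτ := hσ.twist (l.comp q)
  constructor
  · intro heq t ht htθ
    rw [heq] at hτ
    obtain ⟨S, hS0, hS⟩ := hτ.exists_intertwines hσ
    obtain ⟨R, -, hRS, -⟩ := hτ.toIsMatIrrep.exists_inverse hσ.toIsMatIrrep hS hS0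
    -- An isomorphism of the twist with `σ` places both `ρ₁` and its twist by `l` inside `σ`.
    -- Uniqueness of the extension below `χ` then forces `l` to be trivial on the inertia group.
    have hSA : Intertwines (Y ⊓ θ.inertia) (fun x => linFun (l.comp q) x • ρ₁ x) σ (S * A) := by
      intro x hx
      have h1 := hS x hx.1
      rw [← Matrix.mul_assoc, h1]
      simp only [Matrix.mul_smul, Matrix.smul_mul, Matrix.mul_assoc]
      rw [hA x hx]
    have hSA0 : S * A ≠ 0 := fun h0 => hA0 (by
      rw [← Matrix.one_mul A, ← hRS, Matrix.mul_assoc, h0, Matrix.mul_zero])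
    have h2 := extension_unique hXT hTY hYX le_rfl hρ₁ hρT₁ hσ.toIsMatIrrep (fun x hx => by
      rw [linFun_of_mem _ (hXY hx)]
      have : q ⟨x, hXY hx⟩ = 1 := (hq _).2 hx
      simp [this]) hA hA0 hSA hSA0 t ⟨ht, htθ⟩
    rw [linFun_of_mem _ ht] at h2
    have h3 : ((l.comp q) ⟨t, ht⟩ : ℂ) - 1 = 0 := by
      have h4 : (((l.comp q) ⟨t, ht⟩ : ℂ) - 1) • ρ₁ t = 0 := by rw [sub_smul, h2, one_smul, sub_self]
      refine (smul_eq_zero.1 h4).resolve_right fun h0 => ?_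
      have h5 := hρT₁.mul_inv (x := t) ⟨ht, htθ⟩
      have : Nonempty (Fin n) := ⟨⟨0, hρ.pos⟩⟩
      rw [h0, Matrix.zero_mul] at h5
      exact zero_ne_one h5
    exact Units.ext (sub_eq_zero.1 h3)
  · intro hl
    have hAτ : Intertwines (Y ⊓ θ.inertia) ρ₁ (fun x => linFun (l.comp q) x • σ x) A := by
      intro t ht
      have h1 : linFun (l.comp q) t = 1 := by
        rw [linFun_of_mem _ ht.1, MonoidHom.comp_apply, hl t ht.1 ht.2, Units.val_one]
      simp only
      rw [h1, one_smul, hA t ht]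
    obtain ⟨D, hD0, hD⟩ := exists_intertwines_of_inertia hXT hTY hYX le_rfl hρ₁ hρT₁
      hτ.toIsMatRep hσ.toIsMatRep hAτ hA0 hA hA0
    exact hτ.eq_of_intertwines hσ hD hD0

end Linear

end CliffordCorrespondence

/-! ### Gluing equivariant bijections from orbit representatives -/

/-- Equivariant bijections are obtained from a system of pairs of orbit representatives with equal
stabilizers. -/
theorem exists_equivariant_bijOn {M α β : Type*} [Group M] [MulAction M α] [MulAction M β]
    [Nonempty β] (s : Set α) (t : Set β) (hs : ∀ (m : M), ∀ a ∈ s, m • a ∈ s)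
    (ht : ∀ (m : M), ∀ b ∈ t, m • b ∈ t) (good : α → β → Prop)
    (hgs : ∀ a b, good a b → a ∈ s) (hgt : ∀ a b, good a b → b ∈ t)
    (hstab : ∀ a b, good a b → ∀ m : M, m • a = a ↔ m • b = b)
    (horb : ∀ a b a' b', good a b → good a' b' → ((∃ m : M, m • a = a') ↔ ∃ m : M, m • b = b'))
    (hsex : ∀ a ∈ s, ∃ (m : M) (b : β), good (m • a) b)
    (htex : ∀ b ∈ t, ∃ (m : M) (a : α), good a (m • b)) :
    ∃ f : α → β, Set.BijOn f s t ∧ (∀ (m : M), ∀ a ∈ s, f (m • a) = m • f a) ∧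
      ∀ a ∈ s, ∃ (m : M) (a₀ : α) (b₀ : β), good a₀ b₀ ∧ a = m • a₀ ∧ f a = m • b₀ := by
  classical
  -- One good pair is fixed for every orbit. Orbits outside `s` receive an arbitrary pair that is
  -- never used.
  have hq : ∀ o : MulAction.orbitRel.Quotient M α, ∃ ab : α × β,
      (∃ a ∈ s, Quotient.mk'' a = o) → good ab.1 ab.2 ∧ Quotient.mk'' ab.1 = o := by
    intro o
    by_cases ho : ∃ a ∈ s, Quotient.mk'' a = o
    · obtain ⟨a, ha, rfl⟩ := ho
      obtain ⟨m, b, hb⟩ := hsex a ha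
      exact ⟨(m • a, b), fun _ => ⟨hb, Quotient.sound' (MulAction.orbitRel_apply.2 ⟨m, rfl⟩)⟩⟩
    · by_cases hα : Nonempty α
      · exact ⟨(hα.some, Classical.arbitrary β), fun h => (ho h).elim⟩
      · induction o using Quotient.inductionOn' with
        | h a => exact (hα ⟨a⟩).elim
  choose r hr using hq
  have hrs : ∀ a ∈ s, good (r (Quotient.mk'' a)).1 (r (Quotient.mk'' a)).2 ∧
      ∃ m : M, m • (r (Quotient.mk'' a)).1 = a := fun a ha => by
    obtain ⟨h1, h2⟩ := hr (Quotient.mk'' a) ⟨a, ha, rfl⟩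
    exact ⟨h1, MulAction.orbitRel_apply.1 (Quotient.exact' h2.symm)⟩
  -- The transporter `c a` from the representative to `a` is unique only up to the stabilizer of the
  -- representative; equal stabilizers make the choice immaterial.
  have hpick : ∀ a : α, ∃ m : M, a ∈ s → m • (r (Quotient.mk'' a)).1 = a := fun a => by
    by_cases ha : a ∈ s
    · obtain ⟨m, hm⟩ := (hrs a ha).2
      exact ⟨m, fun _ => hm⟩
    · exact ⟨1, fun h => (ha h).elim⟩
  choose c hc using hpick
  set f : α → β := fun a => c a • (r (Quotient.mk'' a)).2 with hf
  have hmk : ∀ (m : M) (a : α),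
      (Quotient.mk'' (m • a) : MulAction.orbitRel.Quotient M α) = Quotient.mk'' a := fun m a =>
    Quotient.sound' (MulAction.orbitRel_apply.2 ⟨m, rfl⟩)
  have hstab' : ∀ a b, good a b → ∀ m m' : M, m • a = m' • a ↔ m • b = m' • b := by
    intro a b hab m m'
    have := hstab a b hab (m'⁻¹ * m)
    rwa [mul_smul, mul_smul, inv_smul_eq_iff, inv_smul_eq_iff] at this
  have heq : ∀ (m : M), ∀ a ∈ s, f (m • a) = m • f a := by
    intro m a ha
    have h1 := hc (m • a) (hs m a ha)
    have h2 := hc a ha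
    simp only [hf]
    rw [hmk] at h1 ⊢
    rw [← mul_smul, ← hstab' _ _ (hrs a ha).1, h1, mul_smul, h2]
  refine ⟨f, ⟨fun a ha => ht _ _ (hgt _ _ (hrs a ha).1), ?_, ?_⟩, heq, fun a ha =>
    ⟨c a, _, _, (hrs a ha).1, (hc a ha).symm, rfl⟩⟩
  · intro a ha a' ha' haa'
    have h1 : ((c a')⁻¹ * c a) • (r (Quotient.mk'' a)).2 = (r (Quotient.mk'' a')).2 := by
      rw [mul_smul, inv_smul_eq_iff]
      exact haa'
    obtain ⟨m, hm⟩ := (horb _ _ _ _ (hrs a ha).1 (hrs a' ha').1).2 ⟨_, h1⟩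
    have h2 : (Quotient.mk'' a : MulAction.orbitRel.Quotient M α) = Quotient.mk'' a' := by
      have h3 := hmk m (r (Quotient.mk'' a)).1
      rwa [hm, (hr (Quotient.mk'' a') ⟨a', ha', rfl⟩).2, (hr (Quotient.mk'' a) ⟨a, ha, rfl⟩).2,
        eq_comm] at h3
    have h4 := hc a ha
    have h5 := hc a' ha'
    simp only [hf] at haa'
    rw [← h2] at haa' h5
    rw [← h4, ← h5, hstab' _ _ (hrs a ha).1]
    exact haa'
  · intro b hb
    obtain ⟨m, a, hab⟩ := htex b hb
    have ha := hgs _ _ hab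
    obtain ⟨hg, m', hm'⟩ := hrs a ha
    obtain ⟨m'', hm''⟩ := (horb _ _ _ _ hg hab).1 ⟨m', hm'⟩
    refine ⟨(m⁻¹ * m'' * (c a)⁻¹) • a, hs _ _ ha, ?_⟩
    rw [heq _ _ ha]
    simp only [hf]
    rw [← mul_smul, inv_mul_cancel_right, mul_smul, hm'', inv_smul_smul]

/-! ### Linked characters and their stabilizers -/

section Linking

variable {Γ : Type*} [Group Γ] {G Gt N : Subgroup Γ} [G.Normal] [Gt.Normal]

/-- The hypotheses relating the characters of `Gt` and of the normalizer of `N` in `Gt`. -/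
structure CharacterBijection (p : ℕ) (hGGt : G ≤ Gt) (hNG : N ≤ G) {Q : Type*} [CommGroup Q]
    (q : Gt →* Q) (Ω : Irr Gt → Irr (normalizerIn Gt N)) : Prop where
  ker : ∀ y : Gt, q y = 1 ↔ (y : Γ) ∈ G
  frattini : ∀ x : Γ, ∃ g ∈ G, g⁻¹ * x ∈ Subgroup.normalizer (N : Set Γ)
  inter : ∀ x ∈ G, x ∈ Subgroup.normalizer (N : Set Γ) → x ∈ N
  extendsG : ∀ θ : Irr G, θ.ExtendsTo (Gt ⊓ θ.inertia)
  extendsN : ∀ θ : Irr N, θ.ExtendsTo (normalizerIn Gt N ⊓ θ.inertia)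
  bijOn : Set.BijOn Ω (pPrimeBelow p hGGt) (pPrimeBelow p (le_normalizerIn (hNG.trans hGGt)))
  equivariant : ∀ (x : Γ) (hx : x ∈ Subgroup.normalizer (N : Set Γ)), ∀ χ ∈ pPrimeBelow p hGGt,
      Ω (χ.conj x (mem_normalizer_of_normal Gt x)) =
        (Ω χ).conj x (mem_normalizer_normalizerIn Gt hx)
  twist : ∀ χ ∈ pPrimeBelow p hGGt, ∀ l : Q →* ℂˣ, Ω (χ.twist (l.comp q)) =
    (Ω χ).twist (l.comp (q.comp (Subgroup.inclusion (normalizerIn_le Gt N))))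

variable {p : ℕ} {hGGt : G ≤ Gt} {hNG : N ≤ G} {Q : Type*} [CommGroup Q]
    {q : Gt →* Q} {Ω : Irr Gt → Irr (normalizerIn Gt N)}

/-- The characters `χ` and `ψ` lie under corresponding characters. -/
def Linked (hGGt : G ≤ Gt) (hNG : N ≤ G) (p : ℕ) (Ω : Irr Gt → Irr (normalizerIn Gt N))
    (χ : Irr G) (ψ : Irr N) : Prop :=
  ∃ X ∈ pPrimeBelow p hGGt, X.LiesOver (Subgroup.inclusion hGGt) χ ∧
    (Ω X).LiesOver (Subgroup.inclusion (le_normalizerIn (hNG.trans hGGt))) ψ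

variable [Finite Γ]

/-- All constituents below `χ` are conjugate and so have the same degree. -/
theorem mem_pPrimeBelow_of_liesOver {X Y : Subgroup Γ} (hXY : X ≤ Y)
    (hYX : Y ≤ Subgroup.normalizer (X : Set Γ)) {χ : Irr Y} {θ : Irr X}
    (h : χ.LiesOver (Subgroup.inclusion hXY) θ) (hθ : θ.IsPPrime p) : χ ∈ pPrimeBelow p hXY := by
  intro θ' h'
  obtain ⟨y, hy, rfl⟩ := h.exists_conj_eq hXY hYX h'
  rwa [Irr.isPPrime_conj]

omit [G.Normal] [Finite Γ] in
theorem Irr.liesOver_twist_of_ker (h : CharacterBijection p hGGt hNG q Ω) {X : Irr Gt} {χ : Irr G}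
    (l : Q →* ℂˣ) : (X.twist (l.comp q)).LiesOver (Subgroup.inclusion hGGt) χ ↔
      X.LiesOver (Subgroup.inclusion hGGt) χ :=
  Irr.liesOver_twist hGGt fun x => by
    rw [MonoidHom.comp_apply, (h.ker _).2 x.2, map_one]

namespace CharacterBijection

omit [G.Normal] [Finite Γ] in
theorem ker_normalizerIn (h : CharacterBijection p hGGt hNG q Ω) (y : normalizerIn Gt N) :
    q.comp (Subgroup.inclusion (normalizerIn_le Gt N)) y = 1 ↔ (y : Γ) ∈ N := by
  rw [MonoidHom.comp_apply, h.ker]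
  exact ⟨fun h1 => h.inter _ h1 y.2.2, fun h1 => hNG h1⟩

omit [G.Normal] [Finite Γ] in
theorem liesOver_twist_normalizerIn (h : CharacterBijection p hGGt hNG q Ω)
    {Y : Irr (normalizerIn Gt N)} {ψ : Irr N} (l : Q →* ℂˣ) :
    (Y.twist (l.comp (q.comp (Subgroup.inclusion (normalizerIn_le Gt N))))).LiesOver
        (Subgroup.inclusion (le_normalizerIn (hNG.trans hGGt))) ψ ↔
      Y.LiesOver (Subgroup.inclusion (le_normalizerIn (hNG.trans hGGt))) ψ :=
  Irr.liesOver_twist _ fun x => by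
    rw [MonoidHom.comp_apply, (h.ker_normalizerIn _).2 x.2, map_one]

omit [G.Normal] [Finite Γ] in
theorem twist_mem (h : CharacterBijection p hGGt hNG q Ω) {X : Irr Gt}
    (hX : X ∈ pPrimeBelow p hGGt) (l : Q →* ℂˣ) : X.twist (l.comp q) ∈ pPrimeBelow p hGGt :=
  fun θ hθ => hX θ ((Irr.liesOver_twist_of_ker h l).1 hθ)

omit [Finite Γ] in
theorem conj_mem {X : Irr Gt} (hX : X ∈ pPrimeBelow p hGGt) (x : Γ) :
    X.conj x (mem_normalizer_of_normal Gt x) ∈ pPrimeBelow p hGGt := by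
  intro θ hθ
  have hx := mem_normalizer_of_normal G x
  have h1 : θ = (θ.conj x⁻¹ (Subgroup.inv_mem _ hx)).conj x hx := by
    rw [Irr.conj_conj]
    simp [Irr.conj_one]
  rw [h1, Irr.liesOver_conj hGGt (mem_normalizer_of_normal Gt x)] at hθ
  exact Irr.isPPrime_conj _ |>.1 (hX _ hθ)

omit [Gt.Normal] [Finite Γ] in
theorem normalizerIn_le_normalizer : normalizerIn Gt N ≤ Subgroup.normalizer (N : Set Γ) :=
  inf_le_right

variable [Finite Q]

/-- If the conjugate of `χ` by `x` is `Gt`-conjugate to `χ'`, then the conjugate of `X` by `x` and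
`X'` lie over a common character and differ by a twist. Applying `Ω` gives the same relation between
`Ω X` and `Ω X'`, whose constituents on `N` are therefore conjugate. The converse uses injectivity
of `Ω`. -/
theorem exists_conj_iff (h : CharacterBijection p hGGt hNG q Ω) {χ χ' : Irr G} {ψ ψ' : Irr N}
    (hl : Linked hGGt hNG p Ω χ ψ) (hl' : Linked hGGt hNG p Ω χ' ψ') {x : Γ}
    (hx : x ∈ Subgroup.normalizer (N : Set Γ)) :
    (∃ s ∈ Gt, χ.conj x (mem_normalizer_of_normal G x) =
        χ'.conj s (mem_normalizer_of_normal G s)) ↔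
      ∃ (s : Γ) (hs : s ∈ normalizerIn Gt N), ψ.conj x hx = ψ'.conj s hs.2 := by
  obtain ⟨X, hX, hXχ, hXψ⟩ := hl
  obtain ⟨X', hX', hXχ', hXψ'⟩ := hl'
  have hGt := fun y => mem_normalizer_of_normal Gt y
  have hG := fun y => mem_normalizer_of_normal G y
  have hN := mem_normalizer_normalizerIn Gt hx
  have h1 := (Irr.liesOver_conj hGGt (hGt x) (hG x)).2 hXχ
  have h2 := (Irr.liesOver_conj _ hN hx).2 hXψ
  have hGGt' : Gt ≤ Subgroup.normalizer (G : Set Γ) := fun y _ => hG y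
  rw [← h.equivariant x hx X hX] at h2
  constructor
  · rintro ⟨s, hs, hχ⟩
    have h3 := (Irr.liesOver_conj hGGt (hGt s) (hG s)).2 hXχ'
    rw [Irr.conj_of_mem X' hs, ← hχ] at h3
    obtain ⟨l, hl⟩ := h3.exists_twist h.ker hGGt hGGt' (h.extendsG _) h1
    rw [hl, h.twist X' hX' l, h.liesOver_twist_normalizerIn] at h2
    obtain ⟨s, hs, h4⟩ := hXψ'.exists_conj_eq _ normalizerIn_le_normalizer h2
    exact ⟨s, hs, h4.symm⟩
  · rintro ⟨s, hs, hψ⟩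
    have h3 := (Irr.liesOver_conj (le_normalizerIn (hNG.trans hGGt))
      (Subgroup.le_normalizer hs) hs.2).2 hXψ'
    rw [Irr.conj_of_mem _ hs, ← hψ] at h3
    obtain ⟨l, hl⟩ := h3.exists_twist h.ker_normalizerIn _ normalizerIn_le_normalizer
      (h.extendsN _) h2
    rw [← h.twist X' hX' l] at hl
    have h4 := h.bijOn.injOn (conj_mem hX x) (h.twist_mem hX' l) hl
    rw [h4, Irr.liesOver_twist_of_ker h] at h1
    obtain ⟨s, hs, h5⟩ := hXχ'.exists_conj_eq _ hGGt' h1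
    exact ⟨s, hs, h5.symm⟩

omit [G.Normal] [Finite Γ] [Finite Q] in
/-- Every element of `Gt` is the product of an element of `G` and an element of the normalizer. -/
theorem exists_mem_normalizerIn (h : CharacterBijection p hGGt hNG q Ω) {x : Γ} (hx : x ∈ Gt) :
    ∃ g ∈ G, g⁻¹ * x ∈ normalizerIn Gt N := by
  obtain ⟨g, hg, h1⟩ := h.frattini x
  exact ⟨g, hg, Gt.mul_mem (Gt.inv_mem (hGGt hg)) hx, h1⟩

/-- The linear characters fixing `X` are those trivial on the stabilizer of `χ`, and likewise for `Ω
X` and `ψ`. As `Ω` identifies the two sets, the stabilizers agree, because subgroups of a finite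
abelian group are determined by the characters trivial on them. -/
theorem mem_inertia_iff (h : CharacterBijection p hGGt hNG q Ω) {χ : Irr G} {ψ : Irr N}
    (hl : Linked hGGt hNG p Ω χ ψ) {t : Γ} (ht : t ∈ normalizerIn Gt N) :
    t ∈ χ.inertia ↔ t ∈ ψ.inertia := by
  obtain ⟨X, hX, hXχ, hXψ⟩ := hl
  set qN := q.comp (Subgroup.inclusion (normalizerIn_le Gt N))
  have hGGt' : Gt ≤ Subgroup.normalizer (G : Set Γ) := fun y _ => mem_normalizer_of_normal G y
  have key : ∀ l : Q →* ℂˣ, (∀ (t : Γ) (ht : t ∈ Gt), t ∈ χ.inertia → l (q ⟨t, ht⟩) = 1) ↔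
      (∀ (t : Γ) (ht : t ∈ normalizerIn Gt N), t ∈ ψ.inertia → l (qN ⟨t, ht⟩) = 1) := by
    intro l
    rw [← hXχ.twist_eq_iff h.ker hGGt hGGt' (h.extendsG _),
      ← hXψ.twist_eq_iff h.ker_normalizerIn _ normalizerIn_le_normalizer (h.extendsN _),
      ← h.twist X hX]
    exact ⟨fun h1 => by rw [h1], fun h1 => h.bijOn.injOn (h.twist_mem hX l) hX h1⟩
  constructor
  · intro htχ
    by_contra hno
    obtain ⟨l, hl, hl'⟩ := Subgroup.exists_linear_character_ne_one
      ((ψ.inertia.subgroupOf (normalizerIn Gt N)).map qN) (a := qN ⟨t, ht⟩) (by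
        rintro ⟨⟨s, hs⟩, hsψ, hst⟩
        apply hno
        have h1 : s⁻¹ * t ∈ N := by
          have := (h.ker_normalizerIn (⟨s, hs⟩⁻¹ * ⟨t, ht⟩)).1
            (by rw [map_mul, map_inv, inv_mul_eq_one]; exact hst)
          exact this
        have h2 := ψ.inertia.mul_mem hsψ (ψ.le_inertia h1)
        simpa using h2)
    exact hl' ((key l).2 (fun s hs hsψ => hl _ ⟨⟨s, hs⟩, hsψ, rfl⟩) t ht.1 htχ)
  · intro htψ
    by_contra hno
    obtain ⟨l, hl, hl'⟩ := Subgroup.exists_linear_character_ne_one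
      ((χ.inertia.subgroupOf Gt).map q) (a := q ⟨t, ht.1⟩) (by
        rintro ⟨⟨s, hs⟩, hsχ, hst⟩
        apply hno
        have h1 : s⁻¹ * t ∈ G := by
          have := (h.ker (⟨s, hs⟩⁻¹ * ⟨t, ht.1⟩)).1
            (by rw [map_mul, map_inv, inv_mul_eq_one]; exact hst)
          exact this
        have h2 := χ.inertia.mul_mem hsχ (χ.le_inertia h1)
        simpa using h2)
    exact hl' ((key l).1 (fun s hs hsχ => hl _ ⟨⟨s, hs⟩, hsχ, rfl⟩) t ht htψ)

/-- The inertia group of `χ` is determined by the one of `ψ`, if both split with respect to the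
complement `D`. -/
theorem inertia_eq_sup (h : CharacterBijection p hGGt hNG q Ω) {χ : Irr G} {ψ : Irr N}
    (hl : Linked hGGt hNG p Ω χ ψ) {D : Subgroup Γ} (hD : Gt ⊓ D = ⊥)
    (hχ : χ.inertia = (Gt ⊓ χ.inertia) ⊔ (D ⊓ χ.inertia))
    (hψ : ψ.inertia ⊔ G = (Gt ⊓ (ψ.inertia ⊔ G)) ⊔ (D ⊓ (ψ.inertia ⊔ G))) :
    χ.inertia = ψ.inertia ⊔ G := by
  have hGO : G ≤ ψ.inertia ⊔ G := le_sup_right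
  have hψO : ψ.inertia ≤ ψ.inertia ⊔ G := le_sup_left
  have hmem : ∀ x, x ∈ ψ.inertia ⊔ G → ∃ j ∈ ψ.inertia, ∃ g ∈ G, j * g = x := fun x =>
    Subgroup.mem_sup_of_normal_right.1
  have hGt : ∀ t ∈ Gt, t ∈ χ.inertia ↔ t ∈ ψ.inertia ⊔ G := by
    intro t ht
    constructor
    · intro htχ
      obtain ⟨g, hg, hk⟩ := h.exists_mem_normalizerIn ht
      have h1 := (h.mem_inertia_iff hl hk).1
        (χ.inertia.mul_mem (χ.inertia.inv_mem (χ.le_inertia hg)) htχ)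
      simpa using Subgroup.mul_mem _ (hGO hg) (hψO h1)
    · intro htO
      obtain ⟨j, hj, g, hg, rfl⟩ := hmem t htO
      have h1 : j ∈ Gt := (Gt.mul_mem_cancel_right (hGGt hg)).1 ht
      exact χ.inertia.mul_mem ((h.mem_inertia_iff hl ⟨h1, ψ.inertia_le_normalizer hj⟩).2 hj)
        (χ.le_inertia hg)
  have hdec : ∀ (K : Subgroup Γ), K = (Gt ⊓ K) ⊔ (D ⊓ K) → ∀ x ∈ K,
      ∃ a ∈ Gt, a ∈ K ∧ ∃ d ∈ D, d ∈ K ∧ a * d = x := by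
    intro K hK x hx
    have hx' : x ∈ Gt ⊔ (D ⊓ K) := by
      rw [hK] at hx
      exact (sup_le_sup_right (inf_le_left : Gt ⊓ K ≤ Gt) (D ⊓ K) :) hx
    obtain ⟨a, ha, d, hd, rfl⟩ := Subgroup.mem_sup_of_normal_left.1 hx'
    exact ⟨a, ha, (K.mul_mem_cancel_right hd.2).1 hx, d, hd.1, hd.2, rfl⟩
  -- When `K` splits along `Gt` and `D`, its elements have their `D`-component in `K`. Hence an
  -- element of `D` that lies in `K` up to a factor from `Gt` already lies in `K`, which absorbs the
  -- ambiguity left by `exists_conj_iff`.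
  have hshift : ∀ (K : Subgroup Γ), K = (Gt ⊓ K) ⊔ (D ⊓ K) → ∀ d ∈ D, ∀ s ∈ Gt, s⁻¹ * d ∈ K →
      d ∈ K := by
    intro K hK d hd s hs hdK
    obtain ⟨a, ha, -, d', hd', hd'K, had⟩ := hdec K hK _ hdK
    have h1 : d * d'⁻¹ ∈ Gt ⊓ D := by
      refine ⟨?_, D.mul_mem hd (D.inv_mem hd')⟩
      have : d * d'⁻¹ = s * a := by
        rw [mul_inv_eq_iff_eq_mul, mul_assoc, had, mul_inv_cancel_left]
      rw [this]
      exact Gt.mul_mem hs ha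
    rw [hD, Subgroup.mem_bot, mul_inv_eq_one] at h1
    rwa [h1]
  have hDD : ∀ d ∈ D, d ∈ χ.inertia ↔ d ∈ ψ.inertia ⊔ G := by
    intro d hd
    constructor
    · intro hdχ
      obtain ⟨g, hg, hk⟩ := h.frattini d
      have h1 : g⁻¹ * d ∈ χ.inertia :=
        χ.inertia.mul_mem (χ.inertia.inv_mem (χ.le_inertia hg)) hdχ
      -- After moving `d` into the normalizer of `N` by an element of `G`, it fixes `χ`, so it fixes
      -- `ψ` up to an element `s` of `Gt`.
      obtain ⟨s, hs, h2⟩ := (h.exists_conj_iff hl hl hk).1 ⟨1, Gt.one_mem, by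
        rw [Irr.conj_one]
        exact (Irr.mem_inertia_iff.1 h1).2⟩
      rw [Irr.conj_eq_conj_iff] at h2
      refine hshift _ hψ d hd (g * s) (Gt.mul_mem (hGGt hg) hs.1) (hψO ?_)
      rwa [mul_inv_rev, mul_assoc]
    · intro hdO
      obtain ⟨j, hj, g, hg, rfl⟩ := hmem d hdO
      obtain ⟨s, hs, h2⟩ := (h.exists_conj_iff hl hl (ψ.inertia_le_normalizer hj)).2 ⟨1,
        Subgroup.one_mem _, by
          rw [Irr.conj_one]
          exact (Irr.mem_inertia_iff.1 hj).2⟩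
      rw [Irr.conj_eq_conj_iff] at h2
      refine hshift _ hχ _ hd s hs ?_
      rw [← mul_assoc]
      exact χ.inertia.mul_mem h2 (χ.le_inertia hg)
  have hle : ∀ K K' : Subgroup Γ, K = (Gt ⊓ K) ⊔ (D ⊓ K) → (∀ t ∈ Gt, t ∈ K → t ∈ K') →
      (∀ d ∈ D, d ∈ K → d ∈ K') → K ≤ K' := by
    intro K K' hK h1 h2
    rw [hK]
    exact sup_le (fun t ht => h1 t ht.1 ht.2) fun d hd => h2 d hd.1 hd.2
  exact le_antisymm (hle _ _ hχ (fun t ht => (hGt t ht).1) fun d hd => (hDD d hd).1)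
    (hle _ _ hψ (fun t ht => (hGt t ht).2) fun d hd => (hDD d hd).2)

omit [Finite Γ] [Finite Q] in
/-- The stabilizers of `χ` and `ψ` in the normalizer of `N` agree. -/
theorem mem_inertia_iff_of_eq_sup (h : CharacterBijection p hGGt hNG q Ω) {χ : Irr G} {ψ : Irr N}
    (hχψ : χ.inertia = ψ.inertia ⊔ G) {x : Γ} (hx : x ∈ Subgroup.normalizer (N : Set Γ)) :
    x ∈ χ.inertia ↔ x ∈ ψ.inertia := by
  rw [hχψ]
  refine ⟨fun h1 => ?_, fun h1 => (le_sup_left : ψ.inertia ≤ _) h1⟩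
  obtain ⟨j, hj, g, hg, rfl⟩ := Subgroup.mem_sup_of_normal_right.1 h1
  have hgN : g ∈ N := h.inter g hg
    ((Subgroup.mul_mem_cancel_left _ (ψ.inertia_le_normalizer hj)).1 hx)
  exact ψ.inertia.mul_mem hj (ψ.le_inertia hgN)

end CharacterBijection

end Linking

/-! ### Parallel projective representations -/

section ParallelReps

variable {Γ : Type*} [Group Γ] {H X Y T : Subgroup Γ} {n m k : ℕ}
  {ρ : Γ → Matrix (Fin n) (Fin n) ℂ} {σ : Γ → Matrix (Fin m) (Fin m) ℂ}

theorem Irr.mem_inertia_of_mem_centralizer (θ : Irr X) {z : Γ}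
    (hz : z ∈ Subgroup.centralizer (X : Set Γ)) : z ∈ θ.inertia := by
  have hz' := Subgroup.mem_centralizer_iff.1 hz
  refine Irr.mem_inertia_iff.2 ⟨Subgroup.centralizer_le_normalizer _ hz, ?_⟩
  ext y
  have h1 : z⁻¹ * y * z = y := by rw [mul_assoc, hz' y y.2, inv_mul_cancel_left]
  rw [Irr.conj_apply]
  exact congrArg θ (Subtype.ext h1)

variable [Finite Γ]

attribute [local instance] fintypeSubgroup

/-- An extension of `θ` can be realized on a given representation affording `θ`. -/
theorem Irr.ExtendsTo.exists_isMatRep_eq {θ : Irr X} (h : θ.ExtendsTo T) (hρ : Affords θ ρ) :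
    ∃ ρ' : Γ → Matrix (Fin n) (Fin n) ℂ, IsMatRep T ρ' ∧ ∀ x ∈ X, ρ' x = ρ x := by
  obtain ⟨k, τ, hXT, hτT, hτ⟩ := h.exists_isMatRep
  obtain ⟨A, hA0, hA⟩ := hρ.exists_intertwines hτ
  obtain ⟨B, hB, hBA, hAB⟩ := hρ.toIsMatIrrep.exists_inverse hτ.toIsMatIrrep hA hA0
  refine ⟨fun x => B * τ x * A, ⟨by rw [hτ.one, Matrix.mul_one, hBA], fun x hx y hy => ?_⟩,
    fun x hx => ?_⟩
  · calc B * τ (x * y) * A = B * τ x * (1 : Matrix (Fin k) (Fin k) ℂ) * (τ y * A) := by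
          rw [hτT.mul x hx y hy, Matrix.mul_one]
          simp only [Matrix.mul_assoc]
      _ = B * τ x * A * (B * τ y * A) := by
          rw [← hAB]
          simp only [Matrix.mul_assoc]
  · simp only
    rw [Matrix.mul_assoc, hA x hx, ← Matrix.mul_assoc, hBA, Matrix.one_mul]

/-- The extension of `θ` to the inertia group corresponding to a character over `θ`. -/
theorem Irr.LiesOver.exists_extension {Q : Type*} [CommGroup Q] [Finite Q] {q : Y →* Q}
    (hq : ∀ y : Y, q y = 1 ↔ (y : Γ) ∈ X) (hXY : X ≤ Y) {θ : Irr X}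
    (hθ : θ.ExtendsTo (Y ⊓ θ.inertia)) {χ : Irr Y}
    (h : χ.LiesOver (Subgroup.inclusion hXY) θ) :
    ∃ (n m : ℕ) (ρ : Γ → Matrix (Fin n) (Fin n) ℂ) (σ : Γ → Matrix (Fin m) (Fin m) ℂ)
      (A : Matrix (Fin m) (Fin n) ℂ), Affords θ ρ ∧ IsMatRep (Y ⊓ θ.inertia) ρ ∧ Affords χ σ ∧
      A ≠ 0 ∧ Intertwines (Y ⊓ θ.inertia) ρ σ A := by
  obtain ⟨n, ρ, hXT, hρT, hρ⟩ := hθ.exists_isMatRep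
  obtain ⟨m, σ, hσ⟩ := χ.exists_affords
  obtain ⟨C, hC0, hC⟩ := (hσ.liesOver_iff hXY hρ).1 h
  obtain ⟨l, A, hA0, hA⟩ := exists_intertwines_twist hq inf_le_left hρT hσ.toIsMatRep hC hC0
  have hρ' := hρT.twist inf_le_left (l.comp q)
  refine ⟨n, m, _, σ, A, (hρ'.mono hXT).affords_of_trace_eq fun x => ?_, hρ', hσ, hA0, hA⟩
  have : q ⟨x, hXY x.2⟩ = 1 := (hq _).2 x.2
  simp [hρ.trace, linFun_of_mem _ (hXY x.2), this]

/-- If conjugation by `d` multiplies a character over an extension of `θ` by a linear character,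
then it multiplies the extension by the same linear character. -/
theorem mul_eq_linFun_smul {θ : Irr X} (hXY : X ≤ Y) (hYX : Y ≤ Subgroup.normalizer (X : Set Γ))
    (hρ : Affords θ ρ) (hρT : IsMatRep (Y ⊓ θ.inertia) ρ) {χ : Irr Y} (hσ : Affords χ σ)
    {A : Matrix (Fin m) (Fin n) ℂ} (hA : Intertwines (Y ⊓ θ.inertia) ρ σ A) (hA0 : A ≠ 0)
    {d : Γ} (hd : d ∈ θ.inertia) (hdY : d ∈ Subgroup.normalizer (Y : Set Γ))
    {M M' : Matrix (Fin n) (Fin n) ℂ} (hM'M : M' * M = 1)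
    (hMρ : ∀ g ∈ X, M * ρ (d⁻¹ * g * d) = ρ g * M)
    {l : Y →* ℂˣ} (hl : ∀ x : X, l (Subgroup.inclusion hXY x) = 1)
    (hχ : χ.conj d hdY = χ.twist l) :
    ∀ x ∈ Y ⊓ θ.inertia, M * ρ x = linFun l (d * x * d⁻¹) • (ρ (d * x * d⁻¹) * M) := by
  have hMM' : M * M' = 1 := mul_eq_one_comm.1 hM'M
  have hXT : X ≤ Y ⊓ θ.inertia := le_inf hXY θ.le_inertia
  have hconj : ∀ x, x ∈ Y ⊓ θ.inertia → d⁻¹ * x * d ∈ Y ⊓ θ.inertia := fun x hx =>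
    ⟨(Subgroup.mem_normalizer_iff''.1 hdY x).1 hx.1,
      Subgroup.mul_mem _ (Subgroup.mul_mem _ (Subgroup.inv_mem _ hd) hx.2) hd⟩
  have hconj' : ∀ x, x ∈ Y ⊓ θ.inertia → d * x * d⁻¹ ∈ Y ⊓ θ.inertia := fun x hx =>
    ⟨(Subgroup.mem_normalizer_iff.1 hdY x).1 hx.1,
      Subgroup.mul_mem _ (Subgroup.mul_mem _ hd hx.2) (Subgroup.inv_mem _ hd)⟩
  have hτ := hσ.conj hdY
  rw [hχ] at hτ
  obtain ⟨U, hU0, hU⟩ := hτ.exists_intertwines (hσ.twist l)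
  obtain ⟨V, -, hVU, -⟩ := hτ.toIsMatIrrep.exists_inverse (hσ.twist l).toIsMatIrrep hU hU0
  -- Conjugating `ρ` by `d`, moving the result back with `M` and dividing by `l` gives a second
  -- extension of the same representation of `X`, again below `χ`. It must equal `ρ`.
  have hint : Intertwines (Y ⊓ θ.inertia)
      (fun t => (linFun l t)⁻¹ • (M * ρ (d⁻¹ * t * d) * M')) σ (U * A * M') := by
    intro t ht
    have h1 := hU t ht.1
    simp only [Matrix.smul_mul] at h1
    have h2 : σ t * U = (linFun l t)⁻¹ • (U * σ (d⁻¹ * t * d)) := by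
      rw [← h1, smul_smul, inv_mul_cancel₀ (linFun_ne_zero l t), one_smul]
    calc σ t * (U * A * M') = σ t * U * A * M' := by simp only [Matrix.mul_assoc]
      _ = (linFun l t)⁻¹ • (U * (σ (d⁻¹ * t * d) * A) * M') := by
        rw [h2]
        simp only [Matrix.smul_mul, Matrix.mul_assoc]
      _ = (linFun l t)⁻¹ • (U * A * (M' * M) * ρ (d⁻¹ * t * d) * M') := by
        rw [hA _ (hconj t ht), hM'M]
        simp only [Matrix.mul_assoc, Matrix.one_mul]
      _ = _ := by
        simp only [Matrix.mul_smul, Matrix.mul_assoc]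
  have hne : U * A * M' ≠ 0 := by
    intro h0
    apply hA0
    calc A = V * (U * A * M') * M := by
          rw [← Matrix.mul_assoc, ← Matrix.mul_assoc, hVU, Matrix.one_mul, Matrix.mul_assoc, hM'M,
            Matrix.mul_one]
      _ = 0 := by rw [h0, Matrix.mul_zero, Matrix.zero_mul]
  have hag : ∀ x ∈ X, (linFun l x)⁻¹ • (M * ρ (d⁻¹ * x * d) * M') = ρ x := by
    intro x hx
    rw [hMρ x hx, Matrix.mul_assoc, hMM', Matrix.mul_one, linFun_of_mem l (hXY hx)]
    have h1 : l ⟨x, hXY hx⟩ = 1 := hl ⟨x, hx⟩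
    simp [h1]
  have key := extension_unique hXT inf_le_left hYX le_rfl hρ hρT hσ.toIsMatIrrep hag hA hA0 hint hne
  intro x hx
  have h1 := key _ (hconj' x hx)
  have h2 : d⁻¹ * (d * x * d⁻¹) * d = x := by group
  rw [h2] at h1
  rw [← h1, smul_mul_assoc, smul_smul, mul_inv_cancel₀ (linFun_ne_zero l _), one_smul,
    Matrix.mul_assoc, hM'M, Matrix.mul_one]

variable {G Gt N : Subgroup Γ}

/-- Projective representations `P` and `P'` of the inertia group of `ψ` with the same factor set
that are associated with `χ` and with `ψ`, and agree on the centralizer of `G`. -/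
structure ParallelProjReps (χ : Irr G) (ψ : Irr N) (ρ P : Γ → Matrix (Fin n) (Fin n) ℂ)
    (P' : Γ → Matrix (Fin m) (Fin m) ℂ) : Prop where
  affordsG : Affords χ ρ
  affordsN : Affords ψ P'
  eq_on : ∀ x ∈ N, P x = ρ x
  isUnit : ∀ j ∈ ψ.inertia, IsUnit (P j)
  conj : ∀ j ∈ ψ.inertia, ∀ g ∈ G, P j * ρ g = ρ (j * g * j⁻¹) * P j
  mul : ∀ i ∈ ψ.inertia, ∀ j ∈ ψ.inertia,
    ∃ a : ℂ, P i * P j = a • P (i * j) ∧ P' i * P' j = a • P' (i * j)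
  central : ∀ z ∈ Subgroup.centralizer (G : Set Γ), ∃ a : ℂ, P z = a • 1 ∧ P' z = a • 1

/-- The product of representations of two subgroups, along a factorization. -/
def productRep (f₁ f₂ : Γ → Γ) (ρ₁ ρ₂ : Γ → Matrix (Fin n) (Fin n) ℂ) (x : Γ) :
    Matrix (Fin n) (Fin n) ℂ :=
  ρ₁ (f₁ x) * ρ₂ (f₂ x)

-- Two factorizations differ by an element of `T₁ ⊓ T₂`, which lies in `N`, where the two
-- representations agree. So the chosen `f₁` and `f₂` do not matter.
omit [Finite Γ] in
theorem productRep_eq {J T₁ T₂ : Subgroup Γ} (hT : T₁ ⊓ T₂ ≤ N) {f₁ f₂ : Γ → Γ}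
    (hf : ∀ x ∈ J, f₁ x ∈ T₁ ∧ f₂ x ∈ T₂ ∧ f₁ x * f₂ x = x) {ρ₁ ρ₂ : Γ → Matrix (Fin n) (Fin n) ℂ}
    (h₁ : IsMatRep T₁ ρ₁) (h₂ : IsMatRep T₂ ρ₂) (h₁₂ : ∀ x ∈ N, ρ₁ x = ρ₂ x) {x t₁ t₂ : Γ}
    (hx : x ∈ J) (ht₁ : t₁ ∈ T₁) (ht₂ : t₂ ∈ T₂) (ht : t₁ * t₂ = x) :
    productRep f₁ f₂ ρ₁ ρ₂ x = ρ₁ t₁ * ρ₂ t₂ := by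
  obtain ⟨h1, h2, h3⟩ := hf x hx
  have h4 : t₁⁻¹ * f₁ x = t₂ * (f₂ x)⁻¹ := by
    rw [inv_mul_eq_iff_eq_mul, ← mul_assoc, ht, eq_mul_inv_iff_mul_eq, h3]
  have h5 : t₁⁻¹ * f₁ x ∈ T₁ := T₁.mul_mem (T₁.inv_mem ht₁) h1
  have h6 : t₁⁻¹ * f₁ x ∈ T₂ := h4 ▸ T₂.mul_mem ht₂ (T₂.inv_mem h2)
  have h7 : f₁ x = t₁ * (t₁⁻¹ * f₁ x) := by group
  have h8 : t₂ = (t₁⁻¹ * f₁ x) * f₂ x := by rw [h4]; group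
  rw [productRep]
  conv_lhs => rw [h7]
  conv_rhs => rw [h8]
  rw [h₁.mul _ ht₁ _ h5, h₂.mul _ h6 _ h2, h₁₂ _ (hT ⟨h5, h6⟩), Matrix.mul_assoc]

omit [Finite Γ] in
/-- Multiplication of products of representations. -/
theorem productRep_mul {J T₁ T₂ : Subgroup Γ} (hT : T₁ ⊓ T₂ ≤ N) {f₁ f₂ : Γ → Γ}
    (hf : ∀ x ∈ J, f₁ x ∈ T₁ ∧ f₂ x ∈ T₂ ∧ f₁ x * f₂ x = x) {ρ₁ ρ₂ : Γ → Matrix (Fin n) (Fin n) ℂ}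
    (h₁ : IsMatRep T₁ ρ₁) (h₂ : IsMatRep T₂ ρ₂) (h₁₂ : ∀ x ∈ N, ρ₁ x = ρ₂ x)
    (hnorm : ∀ d ∈ T₂, ∀ x ∈ T₁, d * x * d⁻¹ ∈ T₁) {i j : Γ} (hi : i ∈ J) (hj : j ∈ J) {a : ℂ}
    (ha : ρ₂ (f₂ i) * ρ₁ (f₁ j) = a • (ρ₁ (f₂ i * f₁ j * (f₂ i)⁻¹) * ρ₂ (f₂ i))) :
    productRep f₁ f₂ ρ₁ ρ₂ i * productRep f₁ f₂ ρ₁ ρ₂ j =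
      a • productRep f₁ f₂ ρ₁ ρ₂ (i * j) := by
  obtain ⟨hi1, hi2, hi3⟩ := hf i hi
  obtain ⟨hj1, hj2, hj3⟩ := hf j hj
  have hn := hnorm _ hi2 _ hj1
  rw [productRep_eq hT hf h₁ h₂ h₁₂ (J.mul_mem hi hj) (T₁.mul_mem hi1 hn) (T₂.mul_mem hi2 hj2)
    (by conv_rhs => rw [← hi3, ← hj3]
        group), h₁.mul _ hi1 _ hn, h₂.mul _ hi2 _ hj2]
  calc productRep f₁ f₂ ρ₁ ρ₂ i * productRep f₁ f₂ ρ₁ ρ₂ j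
      = ρ₁ (f₁ i) * (ρ₂ (f₂ i) * ρ₁ (f₁ j)) * ρ₂ (f₂ j) := by
        simp only [productRep, Matrix.mul_assoc]
    _ = _ := by
        rw [ha]
        simp only [Matrix.mul_smul, Matrix.smul_mul, Matrix.mul_assoc]

/-- Representations of `Y` and of a subgroup `H` whose characters lie over the same characters of
a central subgroup `X` of `Y` agree on `X`. -/
theorem exists_central_scalar {χ : Irr Y} {χ' : Irr H} (hσ : Affords χ σ) (hρ : Affords χ' ρ)
    (hXY : X ≤ Y) (hXH : X ≤ H) (hX : ∀ z ∈ X, ∀ y ∈ Y, y * z = z * y) (hHY : H ≤ Y)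
    (hν : ∀ ν : Irr X, χ.LiesOver (Subgroup.inclusion hXY) ν →
      χ'.LiesOver (Subgroup.inclusion hXH) ν) :
    ∀ z ∈ X, ∃ a : ℂ, σ z = a • 1 ∧ ρ z = a • 1 := by
  have hscal : ∀ z, ∃ a : ℂ, z ∈ X → σ z = a • 1 := by
    intro z
    by_cases hz : z ∈ X
    · obtain ⟨a, ha⟩ := hσ.schur (σ z) fun y hy => by
        rw [← hσ.mul _ (hXY hz) _ hy, ← hσ.mul _ hy _ (hXY hz), hX z hz y hy]
      exact ⟨a, fun _ => ha⟩
    · exact ⟨0, fun h => (hz h).elim⟩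
  choose a ha using hscal
  have : Nonempty (Fin m) := ⟨⟨0, hσ.pos⟩⟩
  have hinj : Function.Injective (fun c : ℂ => c • (1 : Matrix (Fin m) (Fin m) ℂ)) :=
    smul_left_injective ℂ one_ne_zero
  -- The scalars by which `X` acts in `σ` form a linear character of `X`, which by hypothesis also
  -- lies under `χ'`.
  have hτ : IsMatIrrep X (fun z => a z • (1 : Matrix (Fin 1) (Fin 1) ℂ)) := by
    refine ⟨⟨?_, fun z hz y hy => ?_⟩, one_pos, fun M _ => ⟨M 0 0, ?_⟩⟩
    · have h1 : a 1 = 1 := hinj (by simp only [← ha 1 X.one_mem, hσ.one, one_smul])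
      simp only [h1, one_smul]
    · have h1 : a (z * y) = a z * a y := hinj (by
        simp only
        rw [← ha _ (X.mul_mem hz hy), hσ.mul _ (hXY hz) _ (hXY hy), ha z hz, ha y hy,
          Matrix.smul_mul, Matrix.one_mul, smul_smul])
      simp only [h1, Matrix.smul_mul, Matrix.one_mul, smul_smul]
    · ext i j
      rw [Subsingleton.elim i 0, Subsingleton.elim j 0]
      simp
  have h1 : χ.LiesOver (Subgroup.inclusion hXY) hτ.toIrr := by
    refine (hσ.liesOver_iff hXY hτ.affords_toIrr).2 ⟨Matrix.of fun _ _ => 1, fun h0 => ?_, fun z hz => ?_⟩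
    · exact one_ne_zero (congrFun (congrFun h0 (Classical.arbitrary _)) 0)
    · simp only
      rw [ha z hz, Matrix.smul_mul, Matrix.one_mul, Matrix.mul_smul, Matrix.mul_one]
  obtain ⟨A, hA0, hA⟩ := (hρ.liesOver_iff hXH hτ.affords_toIrr).1 (hν _ h1)
  intro z hz
  refine ⟨a z, ha z hz, ?_⟩
  obtain ⟨b, hb⟩ := hρ.schur (ρ z) fun y hy => by
    rw [← hρ.mul _ (hXH hz) _ hy, ← hρ.mul _ hy _ (hXH hz), hX z hz y (hHY hy)]
  have h2 := hA z hz
  rw [hb, Matrix.smul_mul, Matrix.one_mul, Matrix.mul_smul, Matrix.mul_one] at h2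
  rw [hb, smul_left_injective ℂ hA0 h2]

end ParallelReps

/-! ### Construction of the parallel projective representations -/

section Existence

variable {Γ : Type*} [Group Γ] [Finite Γ] {G Gt N : Subgroup Γ} [G.Normal] [Gt.Normal] {p : ℕ}
  {hGGt : G ≤ Gt} {hNG : N ≤ G} {Q : Type*} [CommGroup Q] [Finite Q] {q : Gt →* Q}
  {Ω : Irr Gt → Irr (normalizerIn Gt N)}

/-- The extensions to the `Gt`-parts are chosen below `X` and `Ω X`; this ties their twisting
behaviour and their central scalars to `Ω`. The extensions to the `G ⊔ D`-parts are arbitrary up to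
agreeing with the first ones on `G` and on `N`. -/
theorem CharacterBijection.exists_parallelProjReps (h : CharacterBijection p hGGt hNG q Ω)
    {χ : Irr G} {ψ : Irr N} {X : Irr Gt} (hX : X ∈ pPrimeBelow p hGGt)
    (hXχ : X.LiesOver (Subgroup.inclusion hGGt) χ)
    (hXψ : (Ω X).LiesOver (Subgroup.inclusion (le_normalizerIn (hNG.trans hGGt))) ψ)
    {D : Subgroup Γ} (hD : ∀ x ∈ Gt, x ∈ G ⊔ D → x ∈ G)
    (hχψ : χ.inertia = ψ.inertia ⊔ G)
    (hsplit : ψ.inertia ⊔ G = (Gt ⊓ (ψ.inertia ⊔ G)) ⊔ (D ⊓ (ψ.inertia ⊔ G)))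
    (hχext : χ.ExtendsTo ((G ⊔ D) ⊓ χ.inertia)) (hψext : ψ.ExtendsTo ((G ⊔ D) ⊓ ψ.inertia))
    (hcent : Subgroup.centralizer (G : Set Γ) = centerOf Gt)
    (hcentral : ∀ ν : Irr (centerOf Gt),
      X.LiesOver (Subgroup.inclusion (centerOf_le Gt)) ν →
        (Ω X).LiesOver (Subgroup.inclusion (centerOf_le_normalizerIn (hNG.trans hGGt))) ν) :
    ∃ (n m : ℕ) (ρ P : Γ → Matrix (Fin n) (Fin n) ℂ) (P' : Γ → Matrix (Fin m) (Fin m) ℂ),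
      ParallelProjReps χ ψ ρ P P' := by
  classical
  have hψχ : ψ.inertia ≤ χ.inertia := hχψ ▸ le_sup_left
  have hGGt' : Gt ≤ Subgroup.normalizer (G : Set Γ) := fun y _ => mem_normalizer_of_normal G y
  have hNNt : N ≤ normalizerIn Gt N := le_normalizerIn (hNG.trans hGGt)
  obtain ⟨n, mX, ρ₁, σ, A, hρ, hρ₁, hσ, hA0, hA⟩ :=
    hXχ.exists_extension h.ker hGGt (h.extendsG χ)
  obtain ⟨m, mY, ρ₁', σ', A', hρ', hρ₁', hσ', hA0', hA'⟩ :=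
    hXψ.exists_extension h.ker_normalizerIn hNNt (h.extendsN ψ)
  obtain ⟨ρ₂, hρ₂, h₁₂⟩ := hχext.exists_isMatRep_eq hρ
  obtain ⟨ρ₂', hρ₂', h₁₂'⟩ := hψext.exists_isMatRep_eq hρ'
  set T₁ := Gt ⊓ ψ.inertia with hT₁
  set T₂ := (G ⊔ D) ⊓ ψ.inertia with hT₂
  have hT₁le : T₁ ≤ Gt ⊓ χ.inertia := inf_le_inf_left _ hψχ
  have hT₂le : T₂ ≤ (G ⊔ D) ⊓ χ.inertia := inf_le_inf_left _ hψχ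
  have hT₁le' : T₁ ≤ normalizerIn Gt N ⊓ ψ.inertia :=
    fun x hx => ⟨⟨hx.1, ψ.inertia_le_normalizer hx.2⟩, hx.2⟩
  have hG₁ : G ≤ Gt ⊓ χ.inertia := le_inf hGGt χ.le_inertia
  have hG₂ : G ≤ (G ⊔ D) ⊓ χ.inertia := le_inf le_sup_left χ.le_inertia
  have hN₁ : N ≤ T₁ := le_inf (hNG.trans hGGt) ψ.le_inertia
  have hN₂ : N ≤ T₂ := le_inf (hNG.trans le_sup_left) ψ.le_inertia
  have hT : T₁ ⊓ T₂ ≤ N := fun x hx =>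
    h.inter x (hD x hx.1.1 hx.2.1) (ψ.inertia_le_normalizer hx.1.2)
  have hnorm : ∀ d ∈ T₂, ∀ x ∈ T₁, d * x * d⁻¹ ∈ T₁ := fun d hd x hx =>
    ⟨(Subgroup.mem_normalizer_iff.1 (mem_normalizer_of_normal Gt d) x).1 hx.1,
      Subgroup.mul_mem _ (Subgroup.mul_mem _ hd.2 hx.2) (Subgroup.inv_mem _ hd.2)⟩
  -- The splitting hypothesis gives `x = a * d`, but `d` lies only in `ψ.inertia ⊔ G`. Writing `d =
  -- j * g` and moving `g` to the first factor puts both factors into the stabilizer of `ψ`.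
  have hfac : ∀ x : Γ, ∃ f : Γ × Γ, x ∈ ψ.inertia → f.1 ∈ T₁ ∧ f.2 ∈ T₂ ∧ f.1 * f.2 = x := by
    intro x
    by_cases hx : x ∈ ψ.inertia
    · have hxO : x ∈ Gt ⊔ (D ⊓ (ψ.inertia ⊔ G)) := by
        have hx' : x ∈ ψ.inertia ⊔ G := (le_sup_left : ψ.inertia ≤ _) hx
        rw [hsplit] at hx'
        exact (sup_le_sup_right (inf_le_left : Gt ⊓ (ψ.inertia ⊔ G) ≤ Gt) _ :) hx'
      obtain ⟨a, ha, d, hd, had⟩ := Subgroup.mem_sup_of_normal_left.1 hxO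
      obtain ⟨j, hj, g, hg, hjg⟩ := Subgroup.mem_sup_of_normal_right.1 hd.2
      refine ⟨(x * j⁻¹, j), fun _ => ⟨⟨?_, ψ.inertia.mul_mem hx (ψ.inertia.inv_mem hj)⟩,
        ⟨?_, hj⟩, inv_mul_cancel_right _ _⟩⟩
      · have h1 : x * j⁻¹ = a * (d * g * d⁻¹) := by
          rw [← had, ← hjg]
          group
        rw [h1]
        exact Gt.mul_mem ha (hGGt ((Subgroup.mem_normalizer_iff.1
          (mem_normalizer_of_normal G d) g).1 hg))
      · have h1 : j = d * g⁻¹ := by rw [← hjg, mul_inv_cancel_right]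
        rw [h1]
        exact Subgroup.mul_mem _ ((le_sup_right : D ≤ G ⊔ D) hd.1)
          ((le_sup_left : G ≤ G ⊔ D) (G.inv_mem hg))
    · exact ⟨(1, 1), fun h1 => (hx h1).elim⟩
  choose f hf using hfac
  set f₁ : Γ → Γ := fun x => (f x).1
  set f₂ : Γ → Γ := fun x => (f x).2
  have hρ₁T := hρ₁.mono hT₁le
  have hρ₂T := hρ₂.mono hT₂le
  have hρ₁T' := hρ₁'.mono hT₁le'
  have hag : ∀ x ∈ N, ρ₁ x = ρ₂ x := fun x hx => (h₁₂ x (hNG hx)).symm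
  have hag' : ∀ x ∈ N, ρ₁' x = ρ₂' x := fun x hx => (h₁₂' x hx).symm
  -- The heart of the construction: `d` fixes `χ`, so it twists `X` by some `l`. By equivariance and
  -- compatibility with twists it changes `Ω X` by the restriction of the same `l`, so both
  -- commutation scalars are the value of `l` at `d * x * d⁻¹`.
  have hscalar : ∀ d ∈ T₂, ∀ x ∈ T₁, ∃ a : ℂ,
      ρ₂ d * ρ₁ x = a • (ρ₁ (d * x * d⁻¹) * ρ₂ d) ∧
      ρ₂' d * ρ₁' x = a • (ρ₁' (d * x * d⁻¹) * ρ₂' d) := by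
    intro d hd x hx
    have hdN := ψ.inertia_le_normalizer hd.2
    have hdGt := mem_normalizer_of_normal Gt d
    have hdNt := mem_normalizer_normalizerIn Gt hdN
    have h1 := (Irr.liesOver_conj hGGt hdGt (mem_normalizer_of_normal G d)).2 hXχ
    rw [(Irr.mem_inertia_iff.1 (hψχ hd.2)).2] at h1
    obtain ⟨l, hl⟩ := hXχ.exists_twist h.ker hGGt hGGt' (h.extendsG _) h1
    have hl' := h.equivariant d hdN X hX
    rw [hl, h.twist X hX] at hl'
    refine ⟨linFun (l.comp q) (d * x * d⁻¹), ?_, ?_⟩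
    · refine mul_eq_linFun_smul hGGt hGGt' hρ hρ₁ hσ hA hA0 (hψχ hd.2) hdGt
        (hρ₂T.inv_mul hd) (fun g hg => ?_) (fun y => ?_) hl x (hT₁le hx)
      · have hg' := (Subgroup.mem_normalizer_iff''.1 (mem_normalizer_of_normal G d) g).1 hg
        rw [← h₁₂ _ hg', ← h₁₂ _ hg, ← hρ₂.mul _ (hT₂le hd) _ (hG₂ hg'),
          ← hρ₂.mul _ (hG₂ hg) _ (hT₂le hd)]
        congr 1
        group
      · rw [MonoidHom.comp_apply, (h.ker _).2 y.2, map_one]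
    · have hxd := hT₁le' (hnorm d hd x hx)
      have h2 : linFun (l.comp q) (d * x * d⁻¹) = linFun (l.comp (q.comp
          (Subgroup.inclusion (normalizerIn_le Gt N)))) (d * x * d⁻¹) := by
        rw [linFun_of_mem _ hxd.1.1, linFun_of_mem _ hxd.1]
        rfl
      rw [h2]
      refine mul_eq_linFun_smul hNNt normalizerIn_le_normalizer hρ' hρ₁' hσ' hA' hA0' hd.2 hdNt
        (hρ₂'.inv_mul hd) (fun g hg => ?_) (fun y => ?_) hl'.symm x (hT₁le' hx)
      · have hg' := (Subgroup.mem_normalizer_iff''.1 hdN g).1 hg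
        rw [← h₁₂' _ hg', ← h₁₂' _ hg, ← hρ₂'.mul _ hd _ (hN₂ hg'),
          ← hρ₂'.mul _ (hN₂ hg) _ hd]
        congr 1
        group
      · rw [MonoidHom.comp_apply, (h.ker_normalizerIn _).2 y.2, map_one]
  refine ⟨n, m, ρ₁, productRep f₁ f₂ ρ₁ ρ₂, productRep f₁ f₂ ρ₁' ρ₂', hρ, ?_, ?_, ?_, ?_, ?_, ?_⟩
  · have h1 : ∀ x ∈ N, productRep f₁ f₂ ρ₁' ρ₂' x = ρ₁' x := fun x hx => by
      rw [productRep_eq hT hf hρ₁T' hρ₂' hag' (ψ.le_inertia hx) (hN₁ hx) T₂.one_mem (mul_one x),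
        hρ₂'.one, Matrix.mul_one]
    refine IsMatRep.affords_of_trace_eq ⟨?_, fun x hx y hy => ?_⟩ fun x => ?_
    · rw [h1 1 N.one_mem, hρ'.one]
    · rw [h1 _ (N.mul_mem hx hy), h1 x hx, h1 y hy, hρ'.mul x hx y hy]
    · rw [h1 x x.2, hρ'.trace]
  · intro x hx
    rw [productRep_eq hT hf hρ₁T hρ₂T hag (ψ.le_inertia hx) (hN₁ hx) T₂.one_mem (mul_one x),
      hρ₂.one, Matrix.mul_one]
  · intro j hj
    obtain ⟨h1, h2, -⟩ := hf j hj
    exact (IsUnit.of_mul_eq_one _ (hρ₁T.mul_inv h1)).mul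
      (IsUnit.of_mul_eq_one _ (hρ₂T.mul_inv h2))
  · intro j hj g hg
    obtain ⟨h1, h2, h3⟩ := hf j hj
    change ρ₁ (f₁ j) * ρ₂ (f₂ j) * ρ₁ g = _ * (ρ₁ (f₁ j) * ρ₂ (f₂ j))
    have hg' := (Subgroup.mem_normalizer_iff.1 (mem_normalizer_of_normal G (f₂ j)) g).1 hg
    have hg'' := (Subgroup.mem_normalizer_iff.1 (mem_normalizer_of_normal G j) g).1 hg
    have h4 : ρ₂ (f₂ j) * ρ₁ g = ρ₁ (f₂ j * g * (f₂ j)⁻¹) * ρ₂ (f₂ j) := by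
      rw [← h₁₂ g hg, ← h₁₂ _ hg', ← hρ₂.mul _ (hT₂le h2) _ (hG₂ hg),
        ← hρ₂.mul _ (hG₂ hg') _ (hT₂le h2), inv_mul_cancel_right]
    rw [Matrix.mul_assoc, h4, ← Matrix.mul_assoc, ← Matrix.mul_assoc,
      ← hρ₁.mul _ (hT₁le h1) _ (hG₁ hg'), ← hρ₁.mul _ (hG₁ hg'') _ (hT₁le h1)]
    have h5 : ∀ a b i : Γ, a * b = i → a * (b * g * b⁻¹) = i * g * i⁻¹ * a := by
      rintro a b _ rfl
      group
    rw [h5 _ _ _ h3]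
  · intro i hi j hj
    obtain ⟨a, ha, ha'⟩ := hscalar _ (hf i hi).2.1 _ (hf j hj).1
    exact ⟨a, productRep_mul hT hf hρ₁T hρ₂T hag hnorm hi hj ha,
      productRep_mul hT hf hρ₁T' hρ₂' hag' hnorm hi hj ha'⟩
  · intro z hz
    have hzψ : z ∈ ψ.inertia :=
      ψ.mem_inertia_of_mem_centralizer (Subgroup.centralizer_le hNG hz)
    have hzc : z ∈ centerOf Gt := hcent ▸ hz
    have hzGt := centerOf_le Gt hzc
    have hz₁ : z ∈ T₁ := ⟨hzGt, hzψ⟩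
    have hzcomm : ∀ y ∈ Gt, y * z = z * y := by
      obtain ⟨⟨w, hw⟩, hw', rfl⟩ := hzc
      exact fun y hy => congrArg Subtype.val (Subgroup.mem_center_iff.1 hw' ⟨y, hy⟩)
    rw [productRep_eq hT hf hρ₁T hρ₂T hag hzψ hz₁ T₂.one_mem (mul_one z),
      productRep_eq hT hf hρ₁T' hρ₂' hag' hzψ hz₁ T₂.one_mem (mul_one z), hρ₂.one, hρ₂'.one,
      Matrix.mul_one, Matrix.mul_one]
    have hzG : z ∈ Gt ⊓ χ.inertia := hT₁le hz₁
    have hzN : z ∈ normalizerIn Gt N ⊓ ψ.inertia := hT₁le' hz₁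
    have hi := (IsMatIrrep.of_le hρ₁ hG₁ hρ.toIsMatIrrep)
    have hi' := (IsMatIrrep.of_le hρ₁' (le_inf hNNt ψ.le_inertia) hρ'.toIsMatIrrep)
    obtain ⟨B, -, hBA⟩ := hi.exists_leftInverse (hσ.toIsMatRep.mono inf_le_left) hA hA0
    obtain ⟨B', -, hBA'⟩ := hi'.exists_leftInverse (hσ'.toIsMatRep.mono inf_le_left) hA' hA0'
    -- The centralizer of `G` is the centre of `Gt`, on which `X` and `Ω X` act by the same scalars.
    -- The extensions below them inherit these.
    obtain ⟨a, ha, ha'⟩ := exists_central_scalar hσ hσ' (centerOf_le Gt)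
      (centerOf_le_normalizerIn (hNG.trans hGGt)) (fun w hw y hy => by
        obtain ⟨⟨v, hv⟩, hv', rfl⟩ := hw
        exact congrArg Subtype.val (Subgroup.mem_center_iff.1 hv' ⟨y, hy⟩)) inf_le_left hcentral z hzc
    refine ⟨a, ?_, ?_⟩
    · have h1 := congrArg (fun M => B * M) (hA z hzG)
      simp only [ha, ← Matrix.mul_assoc, hBA, Matrix.one_mul, Matrix.mul_smul, Matrix.smul_mul] at h1
      exact h1.symm
    · have h1 := congrArg (fun M => B' * M) (hA' z hzN)
      simp only [ha', ← Matrix.mul_assoc, hBA', Matrix.one_mul, Matrix.mul_smul, Matrix.smul_mul] at h1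
      exact h1.symm

end Existence

/-! ### Perfect groups and lifting of automorphisms -/

section Perfect

variable {G : Type u} [Group G]

theorem Group.IsPerfect.hom_eq_one [Group.IsPerfect G] {C : Type*} [CommGroup C] (f : G →* C)
    (g : G) : f g = 1 :=
  Abelianization.commutator_subset_ker f Group.IsPerfect.mem_commutator

open scoped IsMulCommutative in
/-- Homomorphisms from a perfect group that agree up to central elements are equal. -/
theorem Group.IsPerfect.hom_eq [Group.IsPerfect G] {H : Type*} [Group H] {f f' : G →* H}
    (h : ∀ g, (f g)⁻¹ * f' g ∈ Subgroup.center H) : f' = f := by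
  let c : G →* Subgroup.center H :=
    { toFun := fun g => ⟨(f g)⁻¹ * f' g, h g⟩
      map_one' := by ext; simp
      map_mul' := fun x y => by
        ext
        have h1 := Subgroup.mem_center_iff.1 (h x) (f y)⁻¹
        simp only [map_mul, mul_inv_rev, Subgroup.coe_mul]
        calc (f y)⁻¹ * (f x)⁻¹ * (f' x * f' y) = (f y)⁻¹ * ((f x)⁻¹ * f' x) * f' y := by
              simp only [mul_assoc]
          _ = _ := by rw [h1, mul_assoc] }
  ext g
  have h1 : (f g)⁻¹ * f' g = 1 := by
    have h2 : c g = 1 := Group.IsPerfect.hom_eq_one (C := Subgroup.center H) c g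
    exact congrArg Subtype.val h2
  exact (inv_mul_eq_one.1 h1).symm

/-- An element of a perfect group that is central modulo the centre is central. -/
theorem Group.IsPerfect.mem_center [Group.IsPerfect G] {a : G}
    (h : ∀ g : G, g⁻¹ * (a * g * a⁻¹) ∈ Subgroup.center G) : a ∈ Subgroup.center G := by
  have h1 : (MulAut.conj a).toMonoidHom = MonoidHom.id G := Group.IsPerfect.hom_eq h
  refine Subgroup.mem_center_iff.2 fun g => ?_
  have h2 : a * g * a⁻¹ = g := DFunLike.congr_fun h1 g
  rw [mul_inv_eq_iff_eq_mul] at h2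
  exact h2.symm

theorem commutatorElement_mul_central {a b c d : G} (hc : c ∈ Subgroup.center G)
    (hd : d ∈ Subgroup.center G) : ⁅a * c, b * d⁆ = ⁅a, b⁆ := by
  have hc' := fun g => Subgroup.mem_center_iff.1 hc g
  have hd' := fun g => Subgroup.mem_center_iff.1 hd g
  calc a * c * (b * d) * (a * c)⁻¹ * (b * d)⁻¹
      = a * (c * b) * d * c⁻¹ * a⁻¹ * d⁻¹ * b⁻¹ := by group
    _ = a * b * (c * d) * c⁻¹ * a⁻¹ * d⁻¹ * b⁻¹ := by rw [← hc']; group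
    _ = a * b * (d * a⁻¹) * d⁻¹ * b⁻¹ := by rw [← hc']; group
    _ = a * b * a⁻¹ * b⁻¹ := by rw [← hd']; group

/-- Automorphisms of a central quotient of a universal covering group lift. -/
theorem IsUniversalCovering.exists_lift [Finite G] {S : Type u} [Group S] {π : G →* S}
    (hπ : IsUniversalCovering π) {R : Type*} [Group R] (τ : G →* R) (hτ : Function.Surjective τ)
    (hker : τ.ker ≤ Subgroup.center G) (σ : MulAut R) :
    ∃ σ' : MulAut G, ∀ g, τ (σ' g) = σ (τ g) := by
  have := hπ.perfect
  -- The graph of `σ`, pulled back to `G × G`. Its commutator subgroup will be a perfect central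
  -- extension of `S`.
  let H : Subgroup (G × G) :=
    { carrier := {x | σ (τ x.1) = τ x.2}
      one_mem' := by simp
      mul_mem' := fun {x y} hx hy => by
        change σ (τ (x.1 * y.1)) = τ (x.2 * y.2)
        rw [map_mul, map_mul, map_mul, show σ (τ x.1) = _ from hx, show σ (τ y.1) = _ from hy]
      inv_mem' := fun {x} hx => by
        change σ (τ x.1⁻¹) = τ x.2⁻¹
        rw [map_inv, map_inv, map_inv, show σ (τ x.1) = _ from hx] }
  set K : Subgroup (G × G) := ⁅H, H⁆ with hK
  have hKH : K ≤ H := Subgroup.commutator_le_self H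
  have hfstH : H.map (MonoidHom.fst G G) = ⊤ := by
    refine eq_top_iff.2 fun g _ => ?_
    obtain ⟨g', hg'⟩ := hτ (σ (τ g))
    exact ⟨(g, g'), hg'.symm, rfl⟩
  have hfstK : K.map (MonoidHom.fst G G) = ⊤ := by
    rw [hK, Subgroup.map_commutator, hfstH]
    exact Group.IsPerfect.commutator_eq_top
  have hKK : ⁅K, K⁆ = K := by
    refine le_antisymm (Subgroup.commutator_le_self K) ?_
    -- `K` already projects onto the first factor, so `H` is `K` times central elements, and these
    -- do not affect commutators.
    have hdec : ∀ h ∈ H, ∃ k ∈ K, ∃ c ∈ Subgroup.center (G × G), h = k * c := by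
      intro h hh
      obtain ⟨k, hk, hkh⟩ : h.1 ∈ K.map (MonoidHom.fst G G) := hfstK ▸ Subgroup.mem_top _
      refine ⟨k, hk, k⁻¹ * h, ?_, (mul_inv_cancel_left _ _).symm⟩
      have h1 : k⁻¹ * h ∈ H := H.mul_mem (H.inv_mem (hKH hk)) hh
      have h2 : (k⁻¹ * h).1 = 1 := by
        change k.1⁻¹ * h.1 = 1
        rw [← hkh]
        exact inv_mul_cancel _
      have h3 : (k⁻¹ * h).2 ∈ Subgroup.center G := by
        apply hker
        rw [MonoidHom.mem_ker, ← h1.out, h2, map_one, map_one]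
      rw [Subgroup.mem_center_iff]
      intro x
      refine Prod.ext ?_ ?_
      · change x.1 * (k⁻¹ * h).1 = (k⁻¹ * h).1 * x.1
        rw [h2, mul_one, one_mul]
      · exact Subgroup.mem_center_iff.1 h3 _
    conv_lhs => rw [hK]
    rw [Subgroup.commutator_le]
    intro x hx y hy
    obtain ⟨k, hk, c, hc, rfl⟩ := hdec x hx
    obtain ⟨k', hk', c', hc', rfl⟩ := hdec y hy
    rw [commutatorElement_mul_central hc hc']
    exact Subgroup.commutator_mem_commutator hk hk'
  have hKperf : Group.IsPerfect K := Subgroup.isPerfect_iff.2 hKK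
  let τ' : K →* S := π.comp ((MonoidHom.fst G G).comp K.subtype)
  have hτ' : Function.Surjective τ' := by
    intro s
    obtain ⟨g, rfl⟩ := hπ.surjective s
    obtain ⟨k, hk, rfl⟩ : g ∈ K.map (MonoidHom.fst G G) := hfstK ▸ Subgroup.mem_top _
    exact ⟨⟨k, hk⟩, rfl⟩
  have hτker : τ'.ker ≤ Subgroup.center K := by
    rintro ⟨k, hk⟩ hk1
    have h1 : k.1 ∈ Subgroup.center G := hπ.central hk1
    have h2 : k.2 ∈ Subgroup.center G := by
      refine Group.IsPerfect.mem_center fun g => hker ?_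
      have h3 : σ (τ k.1) = τ k.2 := hKH hk
      obtain ⟨g', hg'⟩ := hτ (σ.symm (τ g))
      have h4 : τ g = σ (τ g') := by rw [hg', MulEquiv.apply_symm_apply]
      rw [MonoidHom.mem_ker, map_mul, map_mul, map_mul, map_inv, map_inv, ← h3, h4, ← map_mul,
        ← map_mul, ← Subgroup.mem_center_iff.1 h1 g', map_mul, map_mul, mul_inv_cancel_right,
        inv_mul_cancel]
    rw [Subgroup.mem_center_iff]
    rintro ⟨x, hx⟩
    apply Subtype.ext
    exact Prod.ext (Subgroup.mem_center_iff.1 h1 _) (Subgroup.mem_center_iff.1 h2 _)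
  -- Universality gives a section of the first projection; its second coordinate is the lift of `σ`.
  obtain ⟨φ, hφ⟩ := hπ.universal K τ' hτ' hτker
  have hφ1 : (MonoidHom.fst G G).comp (K.subtype.comp φ) = MonoidHom.id G := by
    refine Group.IsPerfect.hom_eq fun g => hπ.central ?_
    rw [MonoidHom.mem_ker, map_mul, map_inv, inv_mul_eq_one]
    exact (DFunLike.congr_fun hφ g).symm
  set f : G →* G := (MonoidHom.snd G G).comp (K.subtype.comp φ)
  have hf : ∀ g, τ (f g) = σ (τ g) := fun g => by
    have h1 : σ (τ (φ g : G × G).1) = τ (f g) := hKH (φ g).2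
    have h2 : (φ g : G × G).1 = g := DFunLike.congr_fun hφ1 g
    rw [← h1, h2]
  have hsurj : Function.Surjective f := by
    -- The lift is surjective modulo the centre, so its range contains all commutators and hence the
    -- perfect group `G`.
    have hdec : ∀ x, ∃ g, ∃ c ∈ Subgroup.center G, x = f g * c := by
      intro x
      obtain ⟨g, hg⟩ := hτ (σ.symm (τ x))
      refine ⟨g, (f g)⁻¹ * x, hker ?_, (mul_inv_cancel_left _ _).symm⟩
      rw [MonoidHom.mem_ker, map_mul, map_inv, hf, hg, MulEquiv.apply_symm_apply, inv_mul_cancel]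
    have h1 : commutator G ≤ f.range := by
      rw [commutator_def, Subgroup.commutator_le]
      intro x _ y _
      obtain ⟨g, c, hc, rfl⟩ := hdec x
      obtain ⟨g', c', hc', rfl⟩ := hdec y
      rw [commutatorElement_mul_central hc hc', ← map_commutatorElement]
      exact ⟨_, rfl⟩
    rw [Group.IsPerfect.commutator_eq_top] at h1
    exact MonoidHom.range_eq_top.1 (top_le_iff.1 h1)
  exact ⟨MulEquiv.ofBijective f ⟨Finite.injective_iff_surjective.2 hsurj, hsurj⟩, hf⟩

end Perfect

/-! ### The overgroup defined by a representation of a perfect group -/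

section Overgroup

variable {Γ : Type u} [Group Γ] {G N : Subgroup Γ} {n m : ℕ}
  {ρ : Γ → Matrix (Fin n) (Fin n) ℂ}

/-- The group of all pairs of a matrix `M` of determinant `1` and an automorphism `σ` of `G` such
that `M` intertwines `ρ` and its conjugate under `σ`. -/
def overgroup (G : Subgroup Γ) {n : ℕ} (ρ : Γ → Matrix (Fin n) (Fin n) ℂ) :
    Subgroup (GL (Fin n) ℂ × MulAut G) where
  -- Determinant one leaves only roots of unity as scalars, which makes the group finite, and is
  -- automatic on the image of a perfect group. The automorphism component keeps the kernel of the
  -- map from `G` central even when `ρ` is far from faithful, as for the trivial character.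
  carrier := {x | Matrix.GeneralLinearGroup.det x.1 = 1 ∧
    ∀ g : G, (x.1 : Matrix (Fin n) (Fin n) ℂ) * ρ g = ρ (x.2 g) * x.1}
  one_mem' := ⟨map_one _, fun g => by simp⟩
  mul_mem' := fun {x y} hx hy => by
    refine ⟨?_, fun g => ?_⟩
    · rw [Prod.fst_mul, map_mul, hx.1, hy.1, one_mul]
    · rw [Prod.fst_mul, Prod.snd_mul, Units.val_mul, Matrix.mul_assoc, hy.2, ← Matrix.mul_assoc,
        hx.2, Matrix.mul_assoc, MulAut.mul_apply]
  inv_mem' := fun {x} hx => by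
    refine ⟨?_, fun g => ?_⟩
    · rw [Prod.fst_inv, map_inv, hx.1, inv_one]
    · rw [Prod.fst_inv, Prod.snd_inv, Units.inv_mul_eq_iff_eq_mul, ← Matrix.mul_assoc, hx.2,
        MulAut.apply_inv_self, Units.mul_inv_cancel_right]

/-- The first component, as a matrix. -/
def overgroupMatrix (a : overgroup G ρ) : Matrix (Fin n) (Fin n) ℂ := (a.1.1 : Matrix _ _ ℂ)

theorem overgroupMatrix_mul (a b : overgroup G ρ) :
    overgroupMatrix (a * b) = overgroupMatrix a * overgroupMatrix b := rfl

theorem overgroup_ext {a b : overgroup G ρ} (h : overgroupMatrix a = overgroupMatrix b)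
    (h' : a.1.2 = b.1.2) : a = b :=
  Subtype.ext (Prod.ext (Units.ext h) h')

theorem overgroupMatrix_mul_rep (a : overgroup G ρ) (g : G) :
    overgroupMatrix a * ρ g = ρ (a.1.2 g) * overgroupMatrix a := a.2.2 g

theorem isUnit_overgroupMatrix (a : overgroup G ρ) : IsUnit (overgroupMatrix a) := a.1.1.isUnit

/-- A matrix representation, as a homomorphism to the general linear group. -/
def IsMatRep.toGL (h : IsMatRep G ρ) : G →* GL (Fin n) ℂ where
  toFun g := ⟨ρ g, ρ (g : Γ)⁻¹, h.mul_inv g.2, h.inv_mul g.2⟩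
  map_one' := Units.ext h.one
  map_mul' x y := Units.ext (h.mul x x.2 y y.2)

/-- The embedding of the representation's image. -/
def overgroupHom [Group.IsPerfect G] (h : IsMatRep G ρ) : G →* overgroup G ρ where
  toFun g := ⟨(h.toGL g, MulAut.conj g),
    Group.IsPerfect.hom_eq_one (Matrix.GeneralLinearGroup.det.comp h.toGL) g, fun x => by
      change ρ g * ρ x = ρ ((g * x * g⁻¹ : G) : Γ) * ρ g
      rw [← h.mul _ g.2 _ x.2, ← h.mul _ (g * x * g⁻¹).2 _ g.2]
      simp⟩
  map_one' := Subtype.ext (Prod.ext (map_one _) (map_one _))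
  map_mul' x y := Subtype.ext (Prod.ext (map_mul _ _ _) (map_mul _ _ _))

variable [Group.IsPerfect G]

theorem overgroupMatrix_hom (h : IsMatRep G ρ) (g : G) :
    overgroupMatrix (overgroupHom h g) = ρ g := rfl

theorem overgroupHom_snd (h : IsMatRep G ρ) (g : G) :
    (overgroupHom h g).1.2 = MulAut.conj g := rfl

theorem mul_overgroupHom (h : IsMatRep G ρ) (a : overgroup G ρ) (g : G) :
    a * overgroupHom h g = overgroupHom h (a.1.2 g) * a := by
  refine overgroup_ext (overgroupMatrix_mul_rep a g) ?_
  change a.1.2 * MulAut.conj g = MulAut.conj (a.1.2 g) * a.1.2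
  ext x
  simp [MulAut.conj_apply]

theorem overgroup_conj (h : IsMatRep G ρ) (a : overgroup G ρ) (g : G) :
    a * overgroupHom h g * a⁻¹ = overgroupHom h (a.1.2 g) := by
  rw [mul_overgroupHom, mul_inv_cancel_right]

instance overgroupHom_range_normal (h : IsMatRep G ρ) : (overgroupHom h).range.Normal := by
  refine ⟨?_⟩
  rintro _ ⟨g, rfl⟩ a
  rw [overgroup_conj]
  exact ⟨_, rfl⟩

theorem overgroupHom_ker_le (h : IsMatRep G ρ) : (overgroupHom h).ker ≤ Subgroup.center G := by
  intro g hg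
  have h1 : MulAut.conj g = 1 := by
    rw [← overgroupHom_snd h, MonoidHom.mem_ker.1 hg]
    rfl
  refine Subgroup.mem_center_iff.2 fun x => ?_
  have h2 : g * x * g⁻¹ = x := DFunLike.congr_fun h1 x
  exact (mul_inv_eq_iff_eq_mul.1 h2).symm

omit [Group.IsPerfect G] in
theorem conj_eq_one_of_mem_center {g : G} (hg : g ∈ Subgroup.center G) : MulAut.conj g = 1 := by
  ext x
  rw [MulAut.conj_apply, ← Subgroup.mem_center_iff.1 hg x, mul_inv_cancel_right]
  rfl

/-- The elements of the centralizer act as scalars. -/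
theorem mem_centralizer_overgroup (h : IsMatIrrep G ρ) {a : overgroup G ρ} :
    a ∈ Subgroup.centralizer ((overgroupHom h.toIsMatRep).range : Set (overgroup G ρ)) ↔
      (∃ c : ℂ, overgroupMatrix a = c • 1) ∧ a.1.2 = 1 := by
  rw [Subgroup.mem_centralizer_iff]
  constructor
  · intro ha
    have h1 : ∀ g : G, overgroupHom h.toIsMatRep g * a = a * overgroupHom h.toIsMatRep g :=
      fun g => ha _ ⟨g, rfl⟩
    refine ⟨h.schur _ fun g hg => ?_, ?_⟩
    · exact (congrArg overgroupMatrix (h1 ⟨g, hg⟩)).symm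
    -- The automorphism is trivial modulo the kernel of `overgroupHom`, which is central, and a
    -- perfect group has no nontrivial such automorphism.
    · have h2 : (a.1.2 : MulAut G).toMonoidHom = MonoidHom.id G := by
        refine Group.IsPerfect.hom_eq fun g => overgroupHom_ker_le h.toIsMatRep ?_
        rw [MonoidHom.mem_ker, map_mul, map_inv, inv_mul_eq_one]
        have h3 := h1 g
        rw [mul_overgroupHom] at h3
        exact mul_right_cancel h3
      ext g
      exact congrArg Subtype.val (DFunLike.congr_fun h2 g)
  · rintro ⟨⟨c, hc⟩, ha⟩ _ ⟨g, rfl⟩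
    refine overgroup_ext ?_ ?_
    · rw [overgroupMatrix_mul, overgroupMatrix_mul, hc, Matrix.mul_smul, Matrix.smul_mul,
        Matrix.one_mul, Matrix.mul_one]
    · change _ * a.1.2 = a.1.2 * _
      rw [ha, mul_one, one_mul]

theorem mul_comm_of_mem_centralizer_overgroup (h : IsMatIrrep G ρ) {a : overgroup G ρ}
    (ha : a ∈ Subgroup.centralizer ((overgroupHom h.toIsMatRep).range : Set (overgroup G ρ)))
    (b : overgroup G ρ) : a * b = b * a := by
  obtain ⟨⟨c, hc⟩, ha⟩ := (mem_centralizer_overgroup h).1 ha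
  refine overgroup_ext ?_ ?_
  · rw [overgroupMatrix_mul, overgroupMatrix_mul, hc, Matrix.mul_smul, Matrix.smul_mul,
      Matrix.one_mul, Matrix.mul_one]
  · change a.1.2 * _ = _ * a.1.2
    rw [ha, mul_one, one_mul]

-- The projection to `MulAut G` has finite range, and by Schur's lemma its kernel consists of
-- scalars whose `n`-th power is `1`.
omit [Group.IsPerfect G] in
theorem finite_overgroup [Finite Γ] (h : IsMatIrrep G ρ) : Finite (overgroup G ρ) := by
  let f : overgroup G ρ →* MulAut G := (MonoidHom.snd _ _).comp (overgroup G ρ).subtype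
  rw [f.finite_iff_finite_ker_range]
  have hfin : Finite (MulAut G) := inferInstance
  refine ⟨?_, inferInstance⟩
  have hscal : ∀ a : f.ker, ∃ c : ℂ, overgroupMatrix a.1 = c • 1 := fun a => by
    refine h.schur _ fun g hg => ?_
    have h1 := overgroupMatrix_mul_rep a.1 ⟨g, hg⟩
    rwa [show a.1.1.2 = 1 from a.2, MulAut.one_apply] at h1
  choose c hc using hscal
  have hpow : ∀ a, c a ∈ {z : ℂ | z ^ n = 1} := fun a => by
    have h1 : (overgroupMatrix a.1).det = 1 := congrArg Units.val a.1.2.1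
    rw [hc, Matrix.det_smul, Matrix.det_one, mul_one, Fintype.card_fin] at h1
    exact h1
  have hset : {z : ℂ | z ^ n = 1}.Finite := by
    refine (Polynomial.nthRootsFinset n (1 : ℂ)).finite_toSet.subset fun z hz => ?_
    exact (Polynomial.mem_nthRootsFinset h.pos 1).2 hz
  have := hset.to_subtype
  refine Finite.of_injective (fun a => (⟨c a, hpow a⟩ : {z : ℂ | z ^ n = 1})) fun a b hab => ?_
  have h1 : c a = c b := congrArg Subtype.val hab
  refine Subtype.ext (overgroup_ext ?_ ?_)
  · rw [hc, hc, h1]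
  · exact (show a.1.1.2 = 1 from a.2).trans (show b.1.1.2 = 1 from b.2).symm

omit [Group.IsPerfect G] in
/-- Automorphisms of `G` fixing the character of `ρ` are induced by the overgroup. -/
theorem exists_overgroup_snd_eq [Finite Γ] {χ : Irr G} (h : Affords χ ρ) (σ : MulAut G)
    (hσ : ∀ g, χ (σ g) = χ g) : ∃ a : overgroup G ρ, a.1.2 = σ := by
  set ρ' : Γ → Matrix (Fin n) (Fin n) ℂ := extendFun (fun g : G => ρ (σ g)) 1 with hρ'
  have h1 : ∀ g : G, ρ' g = ρ (σ g) := fun g => by simp [hρ']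
  have h2 : IsMatRep G ρ' := by
    refine ⟨?_, fun x hx y hy => ?_⟩
    · have := h1 1
      simpa [h.one] using this
    · have := h1 (⟨x, hx⟩ * ⟨y, hy⟩)
      rw [map_mul, Subgroup.coe_mul, Subgroup.coe_mul, h.mul _ (σ _).2 _ (σ _).2, ← h1, ← h1]
        at this
      exact this
  have h3 : Affords χ ρ' := h2.affords_of_trace_eq fun x => by
    rw [h1, ← h.trace, hσ]
  obtain ⟨A, hA0, hA⟩ := h.exists_intertwines h3
  obtain ⟨B, -, hBA, hAB⟩ := h.toIsMatIrrep.exists_inverse h3.toIsMatIrrep hA hA0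
  have hdet : A.det ≠ 0 := by
    intro h0
    have h4 := congrArg Matrix.det hAB
    rw [Matrix.det_mul, h0, zero_mul, Matrix.det_one] at h4
    exact zero_ne_one h4
  -- Dividing by an `n`-th root of the determinant normalizes the intertwiner.
  obtain ⟨z, hz⟩ := IsAlgClosed.exists_pow_nat_eq A.det h.pos
  have hz0 : z ≠ 0 := by
    rintro rfl
    rw [zero_pow h.pos.ne'] at hz
    exact hdet hz.symm
  have hdet' : (z⁻¹ • A).det = 1 := by
    rw [Matrix.det_smul, Fintype.card_fin, inv_pow, hz, inv_mul_cancel₀ hdet]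
  refine ⟨⟨(Matrix.GeneralLinearGroup.mkOfDetNeZero (z⁻¹ • A) (hdet' ▸ one_ne_zero), σ),
    Units.ext hdet', fun g => ?_⟩, rfl⟩
  change z⁻¹ • A * ρ g = ρ (σ g) * (z⁻¹ • A)
  rw [Matrix.smul_mul, Matrix.mul_smul, ← hA g g.2, h1]

end Overgroup

/-! ### The linear representation of the local overgroup -/

section LocalRepresentation

variable {Γ : Type u} [Group Γ] [Finite Γ] {G N : Subgroup Γ} [G.Normal] {n m : ℕ}
  {ρ P : Γ → Matrix (Fin n) (Fin n) ℂ} {P' : Γ → Matrix (Fin m) (Fin m) ℂ}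
  {χ : Irr G} {ψ : Irr N}

/-- The matrix `M` corresponds to the element `a` of the overgroup under the parallel projective
representations `P` and `P'`. -/
def ParallelMatrix (ψ : Irr N) (P : Γ → Matrix (Fin n) (Fin n) ℂ)
    (P' : Γ → Matrix (Fin m) (Fin m) ℂ) (a : overgroup G ρ) (M : Matrix (Fin m) (Fin m) ℂ) : Prop :=
  ∃ j ∈ ψ.inertia, ∃ c : ℂ, (∀ g : G, (a.1.2 g : Γ) = j * g * j⁻¹) ∧
    overgroupMatrix a = c • P j ∧ M = c • P' j

namespace ParallelProjReps

omit [Finite Γ] [G.Normal] in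
theorem apply_one (h : ParallelProjReps χ ψ ρ P P') : P 1 = 1 ∧ P' 1 = 1 :=
  ⟨by rw [h.eq_on 1 N.one_mem, h.affordsG.one], h.affordsN.one⟩

-- Two choices of `j` induce the same automorphism and differ by an element centralizing `G`. There
-- `P` and `P'` are the same scalar, and the common factor set shows that changing `j` rescales `P
-- j` and `P' j` alike.
omit [Finite Γ] [G.Normal] in
theorem parallel_unique (h : ParallelProjReps χ ψ ρ P P') {a : overgroup G ρ}
    {M M' : Matrix (Fin m) (Fin m) ℂ} (hM : ParallelMatrix ψ P P' a M)
    (hM' : ParallelMatrix ψ P P' a M') : M = M' := by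
  obtain ⟨i, hi, c, hci, ha, rfl⟩ := hM
  obtain ⟨j, hj, d, hdj, ha', rfl⟩ := hM'
  have hz : i⁻¹ * j ∈ Subgroup.centralizer (G : Set Γ) := by
    rw [Subgroup.mem_centralizer_iff]
    intro g hg
    have h1 := (hci ⟨g, hg⟩).symm.trans (hdj ⟨g, hg⟩)
    simp only at h1
    calc g * (i⁻¹ * j) = i⁻¹ * (i * g * i⁻¹) * j := by group
      _ = i⁻¹ * (j * g * j⁻¹) * j := by rw [h1]
      _ = i⁻¹ * j * g := by group
  have hzψ : i⁻¹ * j ∈ ψ.inertia := ψ.inertia.mul_mem (ψ.inertia.inv_mem hi) hj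
  obtain ⟨e, he, he'⟩ := h.central _ hz
  obtain ⟨b, hb, hb'⟩ := h.mul i hi _ hzψ
  rw [mul_inv_cancel_left, he, Matrix.mul_smul, Matrix.mul_one] at hb
  rw [mul_inv_cancel_left, he', Matrix.mul_smul, Matrix.mul_one] at hb'
  have : Nonempty (Fin n) := ⟨⟨0, h.affordsG.pos⟩⟩
  have he0 : e ≠ 0 := by
    rintro rfl
    have h1 := h.isUnit _ hzψ
    rw [he, zero_smul] at h1
    exact not_isUnit_zero h1
  have hPi : P i ≠ 0 := (h.isUnit i hi).ne_zero
  have hb0 : b ≠ 0 := by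
    rintro rfl
    rw [zero_smul] at hb
    exact (smul_eq_zero.1 hb).elim he0 hPi
  have h2 : P j = (b⁻¹ * e) • P i := by
    rw [mul_smul, hb, smul_smul, inv_mul_cancel₀ hb0, one_smul]
  have h2' : P' j = (b⁻¹ * e) • P' i := by
    rw [mul_smul, hb', smul_smul, inv_mul_cancel₀ hb0, one_smul]
  rw [ha, h2, smul_smul] at ha'
  rw [h2', smul_smul, smul_left_injective ℂ hPi ha']

-- The scalar from the factor set appears on both sides and is absorbed into the coefficient; this
-- turns the projective `P'` into a linear representation.
omit [Finite Γ] [G.Normal] in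
theorem parallel_mul (h : ParallelProjReps χ ψ ρ P P') {a b : overgroup G ρ}
    {M M' : Matrix (Fin m) (Fin m) ℂ} (hM : ParallelMatrix ψ P P' a M)
    (hM' : ParallelMatrix ψ P P' b M') : ParallelMatrix ψ P P' (a * b) (M * M') := by
  obtain ⟨i, hi, c, hci, ha, rfl⟩ := hM
  obtain ⟨j, hj, d, hdj, hb, rfl⟩ := hM'
  obtain ⟨e, he, he'⟩ := h.mul i hi j hj
  refine ⟨i * j, ψ.inertia.mul_mem hi hj, c * d * e, fun g => ?_, ?_, ?_⟩
  · change ((a.1.2 (b.1.2 g) : G) : Γ) = _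
    rw [hci, hdj]
    group
  · rw [overgroupMatrix_mul, ha, hb, Matrix.smul_mul, Matrix.mul_smul, he, smul_smul, smul_smul]
  · rw [Matrix.smul_mul, Matrix.mul_smul, he', smul_smul, smul_smul]

variable [Group.IsPerfect G]

omit [Finite Γ] [G.Normal] in
theorem parallel_hom (h : ParallelProjReps χ ψ ρ P P') {x : G} (hx : (x : Γ) ∈ N) :
    ParallelMatrix ψ P P' (overgroupHom h.affordsG.toIsMatRep x) (P' x) :=
  ⟨x, ψ.le_inertia hx, 1, fun g => rfl, by
    rw [one_smul, overgroupMatrix_hom, h.eq_on _ hx], (one_smul _ _).symm⟩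

omit [Finite Γ] [G.Normal] [Group.IsPerfect G] in
theorem parallel_scalar (h : ParallelProjReps χ ψ ρ P P') {a : overgroup G ρ} {c : ℂ}
    (hc : overgroupMatrix a = c • 1) (ha : a.1.2 = 1) :
    ParallelMatrix ψ P P' a (c • 1) :=
  ⟨1, ψ.inertia.one_mem, c, fun g => by rw [ha]; simp, by rw [h.apply_one.1, hc],
    by rw [h.apply_one.2]⟩

-- The automorphism of `a` is conjugation by some `x` in `Γ`, which normalizes `N` and fixes `χ`,
-- hence also `ψ`. Then `P x` and the matrix of `a` induce the same conjugation on `ρ`, so they are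
-- proportional.
omit [Finite Γ] in
theorem exists_parallel (h : ParallelProjReps χ ψ ρ P P')
    (hAut : ∀ σ : MulAut G, ∃ x : Γ, MulAut.conjNormal (H := G) x = σ)
    (hmem : ∀ x ∈ Subgroup.normalizer (N : Set Γ), x ∈ χ.inertia → x ∈ ψ.inertia) (hNG : N ≤ G)
    (hZN : Subgroup.center G ≤ N.subgroupOf G) {a : overgroup G ρ}
    (ha : a ∈ Subgroup.normalizer (((N.subgroupOf G).map (overgroupHom h.affordsG.toIsMatRep) :
      Subgroup (overgroup G ρ)) : Set (overgroup G ρ))) :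
    ∃ M, ParallelMatrix ψ P P' a M := by
  set ι := overgroupHom h.affordsG.toIsMatRep with hι
  obtain ⟨x, hx⟩ := hAut a.1.2
  have hxg : ∀ g : G, (a.1.2 g : Γ) = x * g * x⁻¹ := fun g => by
    rw [← hx, MulAut.conjNormal_apply]
  have hmemN : ∀ g : G, (g : Γ) ∈ N ↔ ι g ∈ (N.subgroupOf G).map ι := by
    intro g
    refine ⟨fun hg => ⟨g, hg, rfl⟩, ?_⟩
    rintro ⟨g', hg', hgg'⟩
    have h1 : g'⁻¹ * g ∈ Subgroup.center G := overgroupHom_ker_le h.affordsG.toIsMatRep (by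
      rw [MonoidHom.mem_ker, map_mul, map_inv, inv_mul_eq_one]
      exact hgg')
    have h2 := (N.subgroupOf G).mul_mem hg' (hZN h1)
    rwa [mul_inv_cancel_left] at h2
  have hxN : x ∈ Subgroup.normalizer (N : Set Γ) := by
    rw [Subgroup.mem_normalizer_iff]
    have key : ∀ g : G, (g : Γ) ∈ N ↔ x * g * x⁻¹ ∈ N := fun g => by
      rw [hmemN, ← hxg, hmemN, ← overgroup_conj]
      exact Subgroup.mem_normalizer_iff.1 ha _
    intro y
    constructor
    · intro hy
      exact (key ⟨y, hNG hy⟩).1 hy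
    · intro hy
      have hyG : y ∈ G := (Subgroup.mem_normalizer_iff.1 (mem_normalizer_of_normal G x) y).2
        (hNG hy)
      exact (key ⟨y, hyG⟩).2 hy
  have hxχ : x ∈ χ.inertia := by
    refine (Subgroup.inv_mem_iff _).1 (Irr.mem_inertia_iff.2 ⟨mem_normalizer_of_normal G _, ?_⟩)
    ext g
    rw [Irr.conj_apply, h.affordsG.trace, h.affordsG.trace]
    simp only [inv_inv]
    rw [← hxg]
    have h1 := overgroupMatrix_mul_rep a g
    obtain ⟨u, hu⟩ := isUnit_overgroupMatrix a
    rw [← hu] at h1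
    have h2 : ρ (a.1.2 g) = (u : Matrix (Fin n) (Fin n) ℂ) * ρ g * (u⁻¹ : (Matrix _ _ ℂ)ˣ) := by
      rw [h1, Units.mul_inv_cancel_right]
    rw [h2, Matrix.trace_mul_comm, ← Matrix.mul_assoc, Units.inv_mul, Matrix.one_mul]
  have hxψ := hmem x hxN hxχ
  obtain ⟨u, hu⟩ := h.isUnit x hxψ
  obtain ⟨c, hc⟩ := h.affordsG.schur ((u⁻¹ : (Matrix _ _ ℂ)ˣ) * overgroupMatrix a) fun g hg => by
    have h1 : overgroupMatrix a * ρ g = ρ (x * g * x⁻¹) * overgroupMatrix a := by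
      have := overgroupMatrix_mul_rep a ⟨g, hg⟩
      rwa [hxg] at this
    have h2 := h.conj x hxψ g hg
    rw [← hu] at h2
    rw [Matrix.mul_assoc, h1, Units.inv_mul_eq_iff_eq_mul, ← Matrix.mul_assoc, ← Matrix.mul_assoc,
      h2, Units.mul_inv_cancel_right]
  refine ⟨c • P' x, x, hxψ, c, hxg, ?_, rfl⟩
  rw [← hu, ← Units.mul_inv_cancel_left u (overgroupMatrix a), hc, Matrix.mul_smul, Matrix.mul_one]

omit [Finite Γ] in
/-- The representation of the normalizer of the image of `N` in the overgroup. -/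
theorem exists_localRep (h : ParallelProjReps χ ψ ρ P P')
    (hAut : ∀ σ : MulAut G, ∃ x : Γ, MulAut.conjNormal (H := G) x = σ)
    (hmem : ∀ x ∈ Subgroup.normalizer (N : Set Γ), x ∈ χ.inertia → x ∈ ψ.inertia) (hNG : N ≤ G)
    (hZN : Subgroup.center G ≤ N.subgroupOf G) :
    ∃ F : overgroup G ρ → Matrix (Fin m) (Fin m) ℂ,
      IsMatRep (Subgroup.normalizer (((N.subgroupOf G).map
        (overgroupHom h.affordsG.toIsMatRep) : Subgroup (overgroup G ρ)) :
          Set (overgroup G ρ))) F ∧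
      (∀ x : G, (x : Γ) ∈ N → F (overgroupHom h.affordsG.toIsMatRep x) = P' x) ∧
      ∀ (a : overgroup G ρ) (c : ℂ), overgroupMatrix a = c • 1 → a.1.2 = 1 → F a = c • 1 := by
  -- `F` takes the unique parallel matrix as its value. The default `0` occurs only outside the
  -- normalizer.
  have hex : ∀ a : overgroup G ρ, ∃ M, ∀ M', ParallelMatrix ψ P P' a M' → M = M' := by
    intro a
    by_cases ha : ∃ M, ParallelMatrix ψ P P' a M
    · exact ⟨ha.choose, fun M' hM' => h.parallel_unique ha.choose_spec hM'⟩
    · exact ⟨0, fun M' hM' => (ha ⟨M', hM'⟩).elim⟩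
  choose F hF using hex
  refine ⟨F, ⟨?_, fun a ha b hb => ?_⟩, fun x hx => hF _ _ (h.parallel_hom hx), fun a c hc ha =>
    hF _ _ (h.parallel_scalar hc ha)⟩
  · have := hF _ _ (h.parallel_hom (x := 1) N.one_mem)
    rw [map_one] at this
    rw [this]
    exact h.apply_one.2
  · obtain ⟨M, hM⟩ := h.exists_parallel hAut hmem hNG hZN ha
    obtain ⟨M', hM'⟩ := h.exists_parallel hAut hmem hNG hZN hb
    rw [hF _ _ (h.parallel_mul hM hM'), hF _ _ hM, hF _ _ hM']

end ParallelProjReps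

end LocalRepresentation

/-! ### Cohomology classes of characters that extend linearly -/

section CohomologyClasses

variable {A : Type*} [Group A] {H N : Subgroup A} {n m : ℕ}
  {R : A → Matrix (Fin n) (Fin n) ℂ} {F : A → Matrix (Fin m) (Fin m) ℂ}

/-- A matrix representation of `K`, as a function to the general linear group. -/
def IsMatRep.toGLFun {K : Subgroup A} (h : IsMatRep K R) (x : K) : GL (Fin n) ℂ :=
  ⟨R x, R (x : A)⁻¹, h.mul_inv x.2, h.inv_mul x.2⟩

variable [Finite A]

omit [Finite A] in
/-- The character of an irreducible representation of a normal subgroup that extends to a linear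
representation has the trivial cohomology class. -/
theorem IsMatRep.representsClass_one {K L : Subgroup A} (hKL : K ≤ L) (h : IsMatRep L R)
    {θ : Irr K} (hθ : Affords θ R) :
    RepresentsClass (Subgroup.inclusion hKL) θ (fun _ _ => 1) := by
  refine ⟨n, h.toGLFun, ⟨fun x y => ?_, fun k l => ?_, fun k => ?_, fun _ _ _ _ => rfl⟩⟩
  · rw [Units.val_one, one_smul]
    exact (h.mul x x.2 y y.2).symm
  · exact Units.ext (h.mul k (hKL k.2) l (hKL l.2))
  · exact (hθ.trace k).symm

theorem isDotProduct_toIrr {χ : Irr H} {C : Subgroup A} {ε : Irr C} (hR : IsMatRep (H ⊔ C) R)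
    (hχ : Affords χ R) (hC : ∀ c : C, R c = ε c • 1) :
    IsDotProduct χ ε (IsMatIrrep.of_le hR le_sup_left hχ.toIsMatIrrep).toIrr := by
  intro h c
  change (R (h * c)).trace = _
  rw [hR.mul _ ((le_sup_left : H ≤ H ⊔ C) h.2) _ ((le_sup_right : C ≤ H ⊔ C) c.2), hC,
    Matrix.mul_smul, Matrix.mul_one, Matrix.trace_smul, hχ.trace, smul_eq_mul, mul_comm]

/-- If `χ` and `ψ` extend to linear representations of `A` and of the normalizer of `N` that agree
on the centralizer, then the cohomological elements coincide. -/
theorem isCohomOvergroup_of_isMatRep [H.Normal] (hNH : N ≤ H) {χ : Irr H} {ψ : Irr N}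
    (hR : IsMatRep ⊤ R) (hF : IsMatRep (Subgroup.normalizer (N : Set A)) F)
    (hχ : Affords χ R) (hψ : Affords ψ F)
    (hC : ∀ c ∈ Subgroup.centralizer (H : Set A), ∃ s : ℂ, R c = s • 1 ∧ F c = s • 1)
    (hcomm : ∀ c ∈ Subgroup.centralizer (H : Set A), ∀ a, c * a = a * c)
    (hind : ∀ σ : MulAut H, σ • χ = χ → ∃ a : A, MulAut.conjNormal (H := H) a = σ) :
    IsCohomOvergroup hNH χ ψ := by
  set C := Subgroup.centralizer (H : Set A) with hCdef
  -- The centralizer acts by scalars, so the first diagonal entry reads off the linear character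
  -- `ε`.
  set E : A → Matrix (Fin 1) (Fin 1) ℂ := fun a => R a ⟨0, hχ.pos⟩ ⟨0, hχ.pos⟩ • 1 with hE
  have hE' : ∀ {a : A} {s : ℂ}, R a = s • 1 → E a = s • 1 := fun {a s} h => by
    rw [hE]
    simp only [h, Matrix.smul_apply, Matrix.one_apply_eq, smul_eq_mul, mul_one]
  have hEirr : IsMatIrrep C E := by
    refine ⟨⟨?_, fun x hx y hy => ?_⟩, one_pos, fun M _ => ⟨M 0 0, ?_⟩⟩
    · rw [hE' (s := 1) (by rw [hR.one, one_smul]), one_smul]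
    · obtain ⟨s, hs, -⟩ := hC x hx
      obtain ⟨t, ht, -⟩ := hC y hy
      rw [hE' hs, hE' ht, hE' (s := s * t), Matrix.smul_mul, Matrix.one_mul, smul_smul]
      rw [hR.mul x trivial y trivial, hs, ht, Matrix.smul_mul, Matrix.one_mul, smul_smul]
    · ext i j
      rw [Subsingleton.elim i 0, Subsingleton.elim j 0]
      simp
  have hε : ∀ c : C, R c = hEirr.toIrr c • 1 ∧ F c = hEirr.toIrr c • 1 := fun c => by
    obtain ⟨s, hs, hs'⟩ := hC c c.2
    have : hEirr.toIrr c = s := by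
      change (E c).trace = s
      rw [hE' hs, Matrix.trace_smul, Matrix.trace_one]
      simp
    rw [this]
    exact ⟨hs, hs'⟩
  refine ⟨fun a => ?_, fun x hx y _ => hcomm x hx y, hind, hEirr.toIrr, fun a => ?_, fun ν => ?_,
    ?_⟩
  · ext x
    change χ ((MulAut.conjNormal (H := H) a)⁻¹ x) = χ x
    rw [hχ.trace, hχ.trace, ← map_inv, MulAut.conjNormal_apply]
    exact hR.trace_conj trivial trivial
  · ext c
    change hEirr.toIrr ((MulAut.conjNormal (H := C) a)⁻¹ c) = _
    congr 1
    rw [← map_inv]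
    apply Subtype.ext
    rw [MulAut.conjNormal_apply, ← hcomm c c.2 a⁻¹, inv_inv, inv_mul_cancel_right]
  -- On `H ⊓ C` the character `χ` is `n` times `ε`, so they have the same constituents.
  · have h1 : ∀ k : (H ⊓ C : Subgroup A), χ (Subgroup.inclusion inf_le_left k) =
        (n : ℂ) * hEirr.toIrr (Subgroup.inclusion inf_le_right k) := fun k => by
      rw [hχ.trace]
      have := (hε (Subgroup.inclusion inf_le_right k)).1
      rw [Subgroup.coe_inclusion] at this ⊢
      rw [this, Matrix.trace_smul, Matrix.trace_one, Fintype.card_fin, smul_eq_mul, mul_comm]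
    simp only [Irr.LiesOver]
    simp only [h1, mul_assoc]
    simp only [← smul_eq_mul (n : ℂ)]
    rw [← smul_finsum, smul_eq_mul, mul_ne_zero_iff]
    exact ⟨fun h => ⟨Nat.cast_ne_zero.2 hχ.pos.ne', h⟩, fun h => h.2⟩
  · have hNC : N ⊔ C ≤ Subgroup.normalizer (N : Set A) := sup_centralizer_le_normalizer hNH
    have hR1 := hR.mono (le_top : H ⊔ C ≤ ⊤)
    have hF1 := hF.mono hNC
    -- Both products extend to linear representations, so the constant cocycle `1` represents each
    -- class.
    refine ⟨_, _, isDotProduct_toIrr hR1 hχ fun c => (hε c).1,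
      isDotProduct_toIrr hF1 hψ fun c => (hε c).2, fun _ _ => 1, fun _ _ => 1, ?_,
      hF.representsClass_one hNC (IsMatIrrep.affords_toIrr _), fun _ => 1, fun _ _ => rfl,
      fun _ _ => by simp⟩
    obtain ⟨k, P, hP⟩ := hR.representsClass_one le_top
      (IsMatIrrep.affords_toIrr (IsMatIrrep.of_le hR1 le_sup_left hχ.toIsMatIrrep))
    exact ⟨k, fun a => P ⟨a, trivial⟩, ⟨fun x y => hP.factorSet ⟨x, trivial⟩ ⟨y, trivial⟩,
      hP.linear, hP.affords, fun _ _ _ _ => rfl⟩⟩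

end CohomologyClasses

/-! ### From parallel representations to the cohomological condition -/

section CohomOfParallel

/-- Transport of characters along an isomorphism. -/
def Irr.compEquiv {H K : Type*} [Group H] [Group K] (χ : Irr H) (e : K ≃* H) : Irr K where
  toFun g := χ (e g)
  isIrr := by
    obtain ⟨n, ρ, hρ, hχ⟩ := χ.isIrr
    refine ⟨n, ρ.comp e.toMonoidHom, ?_, ?_⟩
    · refine Irr.isIrreducible_congr (ρ := ρ)
        (fun W => ⟨fun hW g v hv => hW (e g) v hv, fun hW g v hv => ?_⟩) hρ
      have h1 : ρ (e (e.symm g)) v ∈ W := hW (e.symm g) v hv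
      rwa [MulEquiv.apply_symm_apply] at h1
    · funext g
      rw [← hχ]
      rfl

variable {Γ : Type u} [Group Γ] {G N : Subgroup Γ}

/-- The character of `N`, regarded as a subgroup of the group `G`. -/
def Irr.subgroupOf (ψ : Irr N) (hNG : N ≤ G) : Irr (N.subgroupOf G) :=
  ψ.compEquiv (Subgroup.subgroupOfEquivOfLe hNG)

theorem Irr.subgroupOf_apply (ψ : Irr N) (hNG : N ≤ G) (x : N.subgroupOf G) :
    ψ.subgroupOf hNG x = ψ ⟨x, x.2⟩ := rfl

theorem Irr.subgroupOf_injective (hNG : N ≤ G) :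
    Function.Injective (fun ψ : Irr N => ψ.subgroupOf hNG) := by
  intro ψ ψ' h
  ext x
  exact congrArg (fun θ : Irr (N.subgroupOf G) => θ ⟨⟨x, hNG x.2⟩, x.2⟩) h

theorem mem_normalizer_of_map_conjNormal [G.Normal] (hNG : N ≤ G) {x : Γ}
    (h : (N.subgroupOf G).map (MulAut.conjNormal (H := G) x : G ≃* G).toMonoidHom =
      N.subgroupOf G) : x ∈ Subgroup.normalizer (N : Set Γ) := by
  have key : ∀ g : G, (g : Γ) ∈ N ↔ x * g * x⁻¹ ∈ N := fun g => by
    have h1 : (g ∈ N.subgroupOf G) ↔ MulAut.conjNormal x g ∈ N.subgroupOf G := by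
      conv_rhs => rw [← h]
      exact (Subgroup.mem_map_iff_mem
        (f := (MulAut.conjNormal (H := G) x : G ≃* G).toMonoidHom)
        (MulAut.conjNormal (H := G) x : G ≃* G).injective).symm
    exact h1
  rw [Subgroup.mem_normalizer_iff]
  refine fun y => ⟨fun hy => (key ⟨y, hNG hy⟩).1 hy, fun hy => ?_⟩
  have hyG : y ∈ G := (Subgroup.mem_normalizer_iff.1 (mem_normalizer_of_normal G x) y).2 (hNG hy)
  exact (key ⟨y, hyG⟩).2 hy

theorem conjNormal_smul [G.Normal] (χ : Irr G) (x : Γ) :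
    MulAut.conjNormal (H := G) x • χ = χ.conj x (mem_normalizer_of_normal G x) := by
  ext g
  rw [Irr.conj_apply]
  change χ ((MulAut.conjNormal (H := G) x)⁻¹ g) = _
  congr 1
  apply Subtype.ext
  rw [← map_inv, MulAut.conjNormal_apply, inv_inv]

theorem restrictAut_conjNormal_smul [G.Normal] (ψ : Irr N) (hNG : N ≤ G) {x : Γ}
    (h : (N.subgroupOf G).map (MulAut.conjNormal (H := G) x : G ≃* G).toMonoidHom =
      N.subgroupOf G) (hx : x ∈ Subgroup.normalizer (N : Set Γ)) :
    restrictAut (MulAut.conjNormal (H := G) x) (N.subgroupOf G) h • ψ.subgroupOf hNG =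
      (ψ.conj x hx).subgroupOf hNG := by
  ext g
  set σ := restrictAut (MulAut.conjNormal (H := G) x) (N.subgroupOf G) h with hσ
  rw [Irr.subgroupOf_apply, Irr.conj_apply]
  change ψ.subgroupOf hNG (σ⁻¹ g) = _
  rw [Irr.subgroupOf_apply]
  congr 1
  apply Subtype.ext
  have h1 : (((σ (σ⁻¹ g) : N.subgroupOf G) : G) : Γ) = x * ((σ⁻¹ g : N.subgroupOf G) : G) * x⁻¹ :=
    rfl
  rw [MulAut.apply_inv_self] at h1
  simp only [h1]
  group

variable [Finite Γ] [G.Normal] {n m : ℕ}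
  {ρ P : Γ → Matrix (Fin n) (Fin n) ℂ} {P' : Γ → Matrix (Fin m) (Fin m) ℂ}
  {χ : Irr G} {ψ : Irr N}

namespace ParallelProjReps

-- The centre acts by the same scalars in both representations, so the two restrictions are
-- proportional.
omit [Finite Γ] [G.Normal] in
theorem liesOver_center_iff (h : ParallelProjReps χ ψ ρ P P') (hNG : N ≤ G)
    (hZN : Subgroup.center G ≤ N.subgroupOf G) (ν : Irr (Subgroup.center G)) :
    χ.LiesOver (Subgroup.center G).subtype ν ↔
      (ψ.subgroupOf hNG).LiesOver (Subgroup.inclusion hZN) ν := by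
  have h1 : ∀ z : Subgroup.center G, (m : ℂ) * χ (Subgroup.subtype _ z) =
      (n : ℂ) * (ψ.subgroupOf hNG) (Subgroup.inclusion hZN z) := fun z => by
    have hz : ((z : G) : Γ) ∈ Subgroup.centralizer (G : Set Γ) := by
      rw [Subgroup.mem_centralizer_iff]
      intro g hg
      exact congrArg Subtype.val (Subgroup.mem_center_iff.1 z.2 ⟨g, hg⟩)
    obtain ⟨a, ha, ha'⟩ := h.central _ hz
    have hzN : ((z : G) : Γ) ∈ N := hZN z.2
    rw [h.eq_on _ hzN] at ha
    rw [Irr.subgroupOf_apply, h.affordsN.trace, h.affordsG.trace]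
    change (m : ℂ) * (ρ ((z : G) : Γ)).trace = n * (P' ((z : G) : Γ)).trace
    rw [ha, ha']
    simp only [Matrix.trace_smul, Matrix.trace_one, Fintype.card_fin, smul_eq_mul]
    ring
  have hn : (n : ℂ) ≠ 0 := Nat.cast_ne_zero.2 h.affordsG.pos.ne'
  have hm : (m : ℂ) ≠ 0 := Nat.cast_ne_zero.2 h.affordsN.pos.ne'
  have h2 : (m : ℂ) * (∑ᶠ z, χ (Subgroup.subtype _ z) * (starRingEnd ℂ) (ν z)) =
      (n : ℂ) * ∑ᶠ z, (ψ.subgroupOf hNG) (Subgroup.inclusion hZN z) * (starRingEnd ℂ) (ν z) := by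
    rw [← smul_eq_mul, ← smul_eq_mul, smul_finsum, smul_finsum]
    simp only [smul_eq_mul, ← mul_assoc, h1]
  rw [Irr.LiesOver, Irr.LiesOver, ← not_iff_not, not_not, not_not]
  constructor
  · intro h0
    rw [h0, mul_zero, eq_comm] at h2
    exact (mul_eq_zero.1 h2).resolve_left hn
  · intro h0
    rw [h0, mul_zero] at h2
    exact (mul_eq_zero.1 h2).resolve_left hm

theorem cohom (h : ParallelProjReps χ ψ ρ P P') {S : Type u} [Group S] {π : G →* S}
    (hπ : IsUniversalCovering π)
    (hAut : ∀ σ : MulAut G, ∃ x : Γ, MulAut.conjNormal (H := G) x = σ)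
    (hmem : ∀ x ∈ Subgroup.normalizer (N : Set Γ), (x ∈ χ.inertia ↔ x ∈ ψ.inertia)) (hNG : N ≤ G)
    (hZN : Subgroup.center G ≤ N.subgroupOf G) :
    Cohom hZN χ (ψ.subgroupOf hNG) := by
  have := hπ.perfect
  refine ⟨h.liesOver_center_iff hNG hZN, fun σ hσ => ?_, ?_⟩
  · obtain ⟨x, rfl⟩ := hAut σ
    have hx := mem_normalizer_of_map_conjNormal hNG hσ
    rw [restrictAut_conjNormal_smul ψ hNG hσ hx, conjNormal_smul,
      (Irr.subgroupOf_injective hNG).eq_iff]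
    have h1 := hmem x hx
    rw [Irr.mem_inertia_iff, Irr.mem_inertia_iff] at h1
    exact ⟨fun h2 => (h1.1 ⟨_, h2⟩).2, fun h2 => (h1.2 ⟨_, h2⟩).2⟩
  · have hfin : Finite (overgroup G ρ) := finite_overgroup h.affordsG.toIsMatIrrep
    obtain ⟨F, hF, hFN, hFC⟩ := h.exists_localRep hAut (fun x hx => (hmem x hx).1) hNG hZN
    set ι := overgroupHom h.affordsG.toIsMatRep with hι
    have hRirr : IsMatIrrep ι.range (overgroupMatrix (G := G) (ρ := ρ)) :=
      ⟨⟨rfl, fun _ _ _ _ => rfl⟩, h.affordsG.pos, fun M hM =>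
        h.affordsG.schur M fun x hx => hM _ ⟨⟨x, hx⟩, rfl⟩⟩
    have hFirr : IsMatIrrep ((N.subgroupOf G).map ι) F :=
      ⟨hF.mono Subgroup.le_normalizer, h.affordsN.pos, fun M hM =>
        h.affordsN.schur M fun x hx => by
          have := hM _ ⟨⟨x, hNG hx⟩, hx, rfl⟩
          rwa [hFN _ hx] at this⟩
    refine ⟨overgroup G ρ, inferInstance, hfin, ι, inferInstance, fun g => ?_, hRirr.toIrr,
      hFirr.toIrr, fun g => (h.affordsG.trace g).symm, fun g => ?_, ?_⟩
    · constructor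
      · intro hg
        refine ⟨overgroupHom_ker_le _ hg, ?_⟩
        have h1 : ρ g = 1 := congrArg overgroupMatrix hg
        rw [h.affordsG.trace, h.affordsG.trace, h1, OneMemClass.coe_one, h.affordsG.one]
      · rintro ⟨hg, hχ⟩
        -- A central element acts as a scalar, and the condition `χ g = χ 1` says that this scalar
        -- is `1`.
        obtain ⟨c, hc⟩ := h.affordsG.schur (ρ g) fun x hx => by
          rw [← h.affordsG.mul _ g.2 _ hx, ← h.affordsG.mul _ hx _ g.2]
          exact congrArg ρ (congrArg Subtype.val (Subgroup.mem_center_iff.1 hg ⟨x, hx⟩)).symm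
        rw [h.affordsG.trace, h.affordsG.trace, hc, OneMemClass.coe_one, h.affordsG.one,
          Matrix.trace_smul, smul_eq_mul, Matrix.trace_one, Fintype.card_fin,
          mul_eq_right₀ (Nat.cast_ne_zero.2 h.affordsG.pos.ne')] at hχ
        refine overgroup_ext ?_ (conj_eq_one_of_mem_center hg)
        rw [hι, overgroupMatrix_hom, hc, hχ, one_smul]
        rfl
    · change (F (ι g)).trace = _
      rw [hFN _ g.2, Irr.subgroupOf_apply, h.affordsN.trace]
    · refine isCohomOvergroup_of_isMatRep _ ⟨rfl, fun _ _ _ _ => rfl⟩ hF hRirr.affords_toIrr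
        hFirr.affords_toIrr (fun c hc => ?_)
        (fun c hc a => mul_comm_of_mem_centralizer_overgroup h.affordsG.toIsMatIrrep hc a)
        fun σ hσ => ?_
      · obtain ⟨⟨s, hs⟩, h1⟩ := (mem_centralizer_overgroup h.affordsG.toIsMatIrrep).1 hc
        exact ⟨s, hs, hFC _ _ hs h1⟩
      -- An automorphism of the image of `G` fixing the character lifts to one of `G` fixing `χ`,
      -- and such automorphisms are components of elements of the overgroup.
      · obtain ⟨σ', hσ'⟩ := hπ.exists_lift ι.rangeRestrict ι.rangeRestrict_surjective
          (by rw [MonoidHom.ker_rangeRestrict]; exact overgroupHom_ker_le _) σ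
        obtain ⟨a, ha⟩ := exists_overgroup_snd_eq h.affordsG σ' fun g => by
          have h1 : ∀ y, hRirr.toIrr (σ y) = hRirr.toIrr y := fun y => by
            conv_lhs => rw [← hσ]
            change hRirr.toIrr (σ⁻¹ (σ y)) = _
            rw [MulAut.inv_apply_self]
          have h2 := h1 (ι.rangeRestrict g)
          rw [← hσ'] at h2
          rw [h.affordsG.trace, h.affordsG.trace]
          exact h2
        refine ⟨a, ?_⟩
        refine MulEquiv.ext ?_
        rintro ⟨_, g, rfl⟩
        apply Subtype.ext
        rw [MulAut.conjNormal_apply, overgroup_conj, ha]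
        exact congrArg Subtype.val (hσ' g)

end ParallelProjReps

end CohomOfParallel

/-! ### Conjugation of parallel representations -/

section ConjugateReps

variable {Γ : Type*} [Group Γ] {G N H : Subgroup Γ} {n m : ℕ}
  {ρ P : Γ → Matrix (Fin n) (Fin n) ℂ} {P' : Γ → Matrix (Fin m) (Fin m) ℂ}
  {χ : Irr G} {ψ : Irr N}

theorem Irr.mem_inertia_conj_iff {θ : Irr H} {x y : Γ}
    (hx : x ∈ Subgroup.normalizer (H : Set Γ)) :
    y ∈ (θ.conj x hx).inertia ↔ x⁻¹ * y * x ∈ θ.inertia := by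
  have h1 : x⁻¹ * y * x ∈ Subgroup.normalizer (H : Set Γ) ↔
      y ∈ Subgroup.normalizer (H : Set Γ) := by
    rw [Subgroup.mul_mem_cancel_right _ hx, Subgroup.mul_mem_cancel_left _ (Subgroup.inv_mem _ hx)]
  by_cases hy : y ∈ Subgroup.normalizer (H : Set Γ)
  · rw [mul_assoc, ← Irr.conj_eq_conj_iff θ (Subgroup.mul_mem _ hy hx) hx,
      ← Irr.conj_conj θ hy hx, Irr.mem_inertia_iff]
    exact ⟨fun h => h.2, fun h => ⟨hy, h⟩⟩
  · exact ⟨fun h => (hy (Irr.inertia_le_normalizer _ h)).elim,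
      fun h => (hy (h1.1 (Irr.inertia_le_normalizer _ h))).elim⟩

/-- Parallel representations are constructed only for orbit representatives; this carries them to
the other pairs of the bijection. -/
theorem ParallelProjReps.conj_reps [G.Normal] (h : ParallelProjReps χ ψ ρ P P') {x : Γ}
    (hx : x ∈ Subgroup.normalizer (N : Set Γ)) :
    ParallelProjReps (χ.conj x (mem_normalizer_of_normal G x)) (ψ.conj x hx)
      (fun y => ρ (x⁻¹ * y * x)) (fun y => P (x⁻¹ * y * x)) (fun y => P' (x⁻¹ * y * x)) where
  affordsG := h.affordsG.conj _
  affordsN := h.affordsN.conj _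
  eq_on y hy := h.eq_on _ ((Subgroup.mem_normalizer_iff''.1 hx y).1 hy)
  isUnit j hj := h.isUnit _ ((Irr.mem_inertia_conj_iff hx).1 hj)
  conj j hj g hg := by
    rw [h.conj _ ((Irr.mem_inertia_conj_iff hx).1 hj) _
      ((Subgroup.mem_normalizer_iff''.1 (mem_normalizer_of_normal G x) g).1 hg)]
    congr 2
    group
  mul i hi j hj := by
    have := h.mul _ ((Irr.mem_inertia_conj_iff hx).1 hi) _ ((Irr.mem_inertia_conj_iff hx).1 hj)
    rwa [show x⁻¹ * i * x * (x⁻¹ * j * x) = x⁻¹ * (i * j) * x by group] at this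
  central z hz := by
    refine h.central _ (Subgroup.mem_centralizer_iff.2 fun g hg => ?_)
    have h1 := Subgroup.mem_centralizer_iff.1 hz (x * g * x⁻¹)
      ((Subgroup.mem_normalizer_iff.1 (mem_normalizer_of_normal G x) g).1 hg)
    calc g * (x⁻¹ * z * x) = x⁻¹ * (x * g * x⁻¹ * z) * x := by group
      _ = x⁻¹ * z * x * g := by rw [h1]; group

end ConjugateReps

/-! ### A Frattini argument -/

section Frattini

variable {Γ : Type u} [Group Γ] [Finite Γ] {G N Q : Subgroup Γ} [G.Normal] {p : ℕ} [Fact p.Prime]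

open scoped Pointwise in
/-- The Frattini argument in the normalizer of a subgroup between a Sylow subgroup `Q` of `G` and
`G`. -/
theorem exists_mem_normalizer_of_sylow (hQ : ∃ P : Sylow p G, (P : Subgroup G).map G.subtype = Q)
    (hQN : Q ≤ N) {x : Γ} (hx : x ∈ Subgroup.normalizer (N : Set Γ)) :
    ∃ g ∈ N, g⁻¹ * x ∈ Subgroup.normalizer (Q : Set Γ) := by
  obtain ⟨P, rfl⟩ := hQ
  have hP : (P : Subgroup G) ≤ N.subgroupOf G := fun y hy => hQN ⟨y, hy, rfl⟩
  set τ := MulAut.conjNormal (H := G) x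
  have hP' : ((τ • P : Sylow p G) : Subgroup G) ≤ N.subgroupOf G := by
    rintro _ ⟨y, hy, rfl⟩
    exact (Subgroup.mem_normalizer_iff.1 hx y).1 (hP hy)
  -- Both Sylow subgroups lie in `N`, so the conjugating element can be taken from `N`.
  obtain ⟨n, hn⟩ := MulAction.exists_smul_eq (N.subgroupOf G) ((τ • P).subtype hP') (P.subtype hP)
  rw [Sylow.smul_subtype] at hn
  have h1 : MulAut.conj (n : G) • τ • P = P := Sylow.subtype_injective hn
  rw [← mul_smul, ← MulAut.conjNormal_val, ← map_mul] at h1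
  refine ⟨((n : G) : Γ)⁻¹, N.inv_mem n.2, ?_⟩
  rw [inv_inv]
  refine mem_normalizer_of_map_conjNormal (Subgroup.map_subtype_le _) ?_
  rw [show ((P : Subgroup G).map G.subtype).subgroupOf G = P from
    Subgroup.comap_map_eq_self_of_injective G.subtype_injective _]
  exact congrArg Sylow.toSubgroup h1

end Frattini

/-! ### The equivariant bijection between characters of `G` and of `N` -/

section Conclusion

/-- The trivial character. -/
theorem Irr.nonempty {Γ : Type*} [Group Γ] [Finite Γ] (H : Subgroup Γ) : Nonempty (Irr H) := by
  refine ⟨IsMatIrrep.toIrr (ρ := fun _ => (1 : Matrix (Fin 1) (Fin 1) ℂ))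
    ⟨⟨rfl, fun _ _ _ _ => (Matrix.one_mul _).symm⟩, one_pos, fun M _ => ⟨M 0 0, ?_⟩⟩⟩
  ext i j
  rw [Subsingleton.elim i 0, Subsingleton.elim j 0]
  simp

section EquivariantBijection

variable {Γ : Type*} [Group Γ] [Finite Γ] {G Gt N : Subgroup Γ} [G.Normal] [Gt.Normal] {p : ℕ}
  {hGGt : G ≤ Gt} {hNG : N ≤ G} {Q : Type*} [CommGroup Q] [Finite Q] {q : Gt →* Q}
  {Ω : Irr Gt → Irr (normalizerIn Gt N)}

/-- The action of a group normalizing `H` on the irreducible characters of `H`. -/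
abbrev conjAction {H K : Subgroup Γ} (h : K ≤ Subgroup.normalizer (H : Set Γ)) :
    MulAction K (Irr H) where
  smul x θ := θ.conj x (h x.2)
  one_smul θ := θ.conj_one
  mul_smul x y θ := (θ.conj_conj (h x.2) (h y.2)).symm

-- By the Frattini property `y` is a product of an element of `G`, which acts trivially on
-- characters of `G`, and one normalizing `N`.
omit [Finite Q] [Finite Γ] in
theorem CharacterBijection.exists_conj_eq_conj (h : CharacterBijection p hGGt hNG q Ω)
    (χ : Irr G) (y : Γ) : ∃ k ∈ Subgroup.normalizer (N : Set Γ),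
      χ.conj y (mem_normalizer_of_normal G y) = χ.conj k (mem_normalizer_of_normal G k) := by
  obtain ⟨g, hg, hk⟩ := h.frattini y
  refine ⟨_, hk, ?_⟩
  have h1 := Irr.conj_of_mem (χ.conj _ (mem_normalizer_of_normal G (g⁻¹ * y))) hg
  rw [Irr.conj_conj] at h1
  rw [← h1]
  congr 1
  group

/-- A bijection of characters of `Gt` and of the normalizer of `N` induces an equivariant bijection
of characters of `G` and of `N`. -/
theorem CharacterBijection.exists_bijOn (h : CharacterBijection p hGGt hNG q Ω)
    (good : Irr G → Irr N → Prop)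
    (hp : ∀ χ ψ, good χ ψ → χ.IsPPrime p ∧ ψ.IsPPrime p)
    (hl : ∀ χ ψ, good χ ψ → Linked hGGt hNG p Ω χ ψ)
    (hinertia : ∀ χ ψ, good χ ψ → χ.inertia = ψ.inertia ⊔ G)
    (hex : ∀ X ∈ pPrimeBelow p hGGt, ∃ χ ψ, good χ ψ ∧ X.LiesOver (Subgroup.inclusion hGGt) χ ∧
      (Ω X).LiesOver (Subgroup.inclusion (le_normalizerIn (hNG.trans hGGt))) ψ) :
    ∃ f : Irr G → Irr N, Set.BijOn f {χ | χ.IsPPrime p} {ψ | ψ.IsPPrime p} ∧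
      (∀ (x : Γ) (hx : x ∈ Subgroup.normalizer (N : Set Γ)) (χ : Irr G), χ.IsPPrime p →
        f (χ.conj x (mem_normalizer_of_normal G x)) = (f χ).conj x hx) ∧
      ∀ χ, χ.IsPPrime p → ∃ (x : Γ) (hx : x ∈ Subgroup.normalizer (N : Set Γ)) (χ₀ : Irr G)
        (ψ₀ : Irr N), good χ₀ ψ₀ ∧ χ = χ₀.conj x (mem_normalizer_of_normal G x) ∧
          f χ = ψ₀.conj x hx := by
  have hG : Subgroup.normalizer (N : Set Γ) ≤ Subgroup.normalizer (G : Set Γ) :=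
    fun x _ => mem_normalizer_of_normal G x
  let _ := conjAction hG
  let _ := conjAction (le_refl (Subgroup.normalizer (N : Set Γ)))
  have := Irr.nonempty N
  have hGGt' : Gt ≤ Subgroup.normalizer (G : Set Γ) := fun y _ => mem_normalizer_of_normal G y
  have hstab : ∀ a b, good a b → ∀ m : Subgroup.normalizer (N : Set Γ), m • a = a ↔ m • b = b := by
    intro χ ψ hg m
    have h1 := h.mem_inertia_iff_of_eq_sup (hinertia χ ψ hg) m.2
    rw [Irr.mem_inertia_iff, Irr.mem_inertia_iff] at h1
    exact ⟨fun h2 => (h1.1 ⟨_, h2⟩).2, fun h2 => (h1.2 ⟨_, h2⟩).2⟩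
  have horb : ∀ a b a' b', good a b → good a' b' →
      ((∃ m : Subgroup.normalizer (N : Set Γ), m • a = a') ↔
        ∃ m : Subgroup.normalizer (N : Set Γ), m • b = b') := by
    intro χ ψ χ' ψ' hg hg'
    constructor
    · rintro ⟨m, hm⟩
      obtain ⟨s, hs, h1⟩ := (h.exists_conj_iff (hl _ _ hg) (hl _ _ hg') m.2).1
        ⟨1, Gt.one_mem, by rw [Irr.conj_one]; exact hm⟩
      refine ⟨(⟨s, hs.2⟩ : Subgroup.normalizer (N : Set Γ))⁻¹ * m, ?_⟩
      rw [mul_smul, inv_smul_eq_iff]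
      exact h1
    · rintro ⟨m, hm⟩
      obtain ⟨s, hs, h1⟩ := (h.exists_conj_iff (hl _ _ hg) (hl _ _ hg') m.2).2
        ⟨1, Subgroup.one_mem _, by rw [Irr.conj_one]; exact hm⟩
      obtain ⟨k, hk, h2⟩ := h.exists_conj_eq_conj χ' s
      refine ⟨(⟨k, hk⟩ : Subgroup.normalizer (N : Set Γ))⁻¹ * m, ?_⟩
      rw [mul_smul, inv_smul_eq_iff]
      exact h1.trans h2
  obtain ⟨f, hf, hfe, hfg⟩ := exists_equivariant_bijOn (M := Subgroup.normalizer (N : Set Γ))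
    {χ : Irr G | χ.IsPPrime p} {ψ : Irr N | ψ.IsPPrime p}
    (fun m χ hχ => (Irr.isPPrime_conj _).2 hχ) (fun m ψ hψ => (Irr.isPPrime_conj _).2 hψ) good
    -- For coverage, take a character above the given one: the good pair it provides contains a
    -- conjugate of the given character, and the conjugating element can be chosen to normalize `N`.
    -- On the `N` side the character above comes from some `X` by surjectivity of `Ω`.
    (fun χ ψ hg => (hp χ ψ hg).1) (fun χ ψ hg => (hp χ ψ hg).2) hstab horb (fun χ hχ => by
      obtain ⟨X, hX⟩ := Irr.exists_liesOver hGGt χ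
      obtain ⟨χ₀, ψ₀, hg, hχ₀, -⟩ := hex X (mem_pPrimeBelow_of_liesOver hGGt hGGt' hX hχ)
      obtain ⟨y, hy, rfl⟩ := hX.exists_conj_eq hGGt hGGt' hχ₀
      obtain ⟨k, hk, h1⟩ := h.exists_conj_eq_conj χ y
      rw [h1] at hg
      exact ⟨⟨k, hk⟩, ψ₀, hg⟩) (fun ψ hψ => by
      have hN := le_normalizerIn (hNG.trans hGGt)
      obtain ⟨Y, hY⟩ := Irr.exists_liesOver hN ψ
      obtain ⟨X, hX, rfl⟩ := h.bijOn.surjOn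
        (mem_pPrimeBelow_of_liesOver hN normalizerIn_le_normalizer hY hψ)
      obtain ⟨χ₀, ψ₀, hg, -, hψ₀⟩ := hex X hX
      obtain ⟨y, hy, rfl⟩ := hY.exists_conj_eq hN normalizerIn_le_normalizer hψ₀
      exact ⟨⟨y, hy.2⟩, χ₀, hg⟩)
  refine ⟨f, hf, fun x hx χ hχ => hfe ⟨x, hx⟩ χ hχ, fun χ hχ => ?_⟩
  obtain ⟨m, χ₀, ψ₀, h1, h2, h3⟩ := hfg χ hχ
  exact ⟨m, m.2, χ₀, ψ₀, h1, h2, h3⟩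

end EquivariantBijection

variable {Γ : Type u} [Group Γ] {G N : Subgroup Γ}

theorem Irr.subgroupOf_surjective (hNG : N ≤ G) (θ : Irr (N.subgroupOf G)) :
    ∃ ψ : Irr N, ψ.subgroupOf hNG = θ :=
  ⟨θ.compEquiv (Subgroup.subgroupOfEquivOfLe hNG).symm, rfl⟩

theorem map_conjNormal_subgroupOf [G.Normal] {x : Γ}
    (hx : x ∈ Subgroup.normalizer (N : Set Γ)) :
    (N.subgroupOf G).map (MulAut.conjNormal (H := G) x : G ≃* G).toMonoidHom =
      N.subgroupOf G := by
  ext g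
  constructor
  · rintro ⟨g, hg, rfl⟩
    exact (Subgroup.mem_normalizer_iff.1 hx g).1 hg
  · intro hg
    refine ⟨MulAut.conjNormal (H := G) x⁻¹ g, ?_, ?_⟩
    · change ((MulAut.conjNormal (H := G) x⁻¹ g : G) : Γ) ∈ N
      rw [MulAut.conjNormal_apply, inv_inv]
      exact (Subgroup.mem_normalizer_iff''.1 hx g).1 hg
    · change MulAut.conjNormal (H := G) x (MulAut.conjNormal (H := G) x⁻¹ g) = g
      rw [map_inv, MulAut.apply_inv_self]

end Conclusion

/-! ### The main theorem -/

theorem theorem2 {S Γ : Type u} [Group S] [IsSimpleGroup S] (hS : ∃ a b : S, a * b ≠ b * a)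
    (p : ℕ) [Fact p.Prime] (hp : p ∣ Nat.card S)
    [Group Γ] [Finite Γ] (G Gt D : Subgroup Γ) [G.Normal] [Gt.Normal] (hGGt : G ≤ Gt)
    -- `G` is the universal covering group of `S`, and `Q` a Sylow `p`-subgroup of `G`
    (π : G →* S) (hπ : IsUniversalCovering π)
    (Q : Subgroup Γ) (hQ : ∃ P : Sylow p G, (P : Subgroup G).map G.subtype = Q)
    -- `Γ = Gt ⋊ D` with `Gt / G` abelian, `C_Γ(G) = Z(Gt)`, inducing all automorphisms of `G`
    (hGtD : Gt.IsComplement' D)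
    (hab : ∀ a b : Gt ⧸ G.subgroupOf Gt, a * b = b * a)
    (hcent : Subgroup.centralizer (G : Set Γ) = centerOf Gt)
    (hAut : ∀ σ : MulAut G, ∃ x : Γ, MulAut.conjNormal (H := G) x = σ)
    -- the `Γ_Q`-stable subgroup `N`
    (N : Subgroup Γ) (hNG : N < G) (hQN : normalizerIn G Q ≤ N)
    (hN : ∀ x ∈ Subgroup.normalizer (Q : Set Γ), x ∈ Subgroup.normalizer (N : Set Γ))
    -- maximal extensibility
    (hmaxG : MaximalExtensibility G Gt)
    (hmaxN : MaximalExtensibility N (normalizerIn Gt N))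
    -- the equivariant bijection `Ω`
    (Ω : Irr Gt → Irr (normalizerIn Gt N))
    (hΩ : Set.BijOn Ω (pPrimeBelow p hGGt) (pPrimeBelow p (le_normalizerIn (hNG.le.trans hGGt))))
    (hΩequiv : ∀ (x : Γ) (hx : x ∈ Subgroup.normalizer (Q : Set Γ)), ∀ χ ∈ pPrimeBelow p hGGt,
      Ω (χ.conj x (mem_normalizer_of_normal Gt x)) =
        (Ω χ).conj x (mem_normalizer_normalizerIn Gt (hN x hx)))
    (hΩcentral : ∀ ν : Irr (centerOf Gt),
      Ω '' (pPrimeBelow p hGGt ∩ {χ | χ.LiesOver (Subgroup.inclusion (centerOf_le Gt)) ν}) =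
        pPrimeBelow p (le_normalizerIn (hNG.le.trans hGGt)) ∩
          {ψ | ψ.LiesOver
            (Subgroup.inclusion (centerOf_le_normalizerIn (hNG.le.trans hGGt))) ν})
    (hΩtwist : ∀ χ ∈ pPrimeBelow p hGGt, ∀ l : Gt →* ℂˣ, G.subgroupOf Gt ≤ l.ker →
      Ω (χ.twist l) = (Ω χ).twist (l.comp (Subgroup.inclusion (normalizerIn_le Gt N))))
    -- global stabilizer and extension condition
    (hglobal : ∀ χ ∈ pPrimeBelow p hGGt, ∃ χ₀ : Irr G, χ₀.IsPPrime p ∧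
      χ.LiesOver (Subgroup.inclusion hGGt) χ₀ ∧
      χ₀.inertia = (Gt ⊓ χ₀.inertia) ⊔ (D ⊓ χ₀.inertia) ∧
      χ₀.ExtendsTo ((G ⊔ D) ⊓ χ₀.inertia))
    -- local stabilizer and extension condition
    (hlocal : ∀ ψ ∈ pPrimeBelow p (le_normalizerIn (hNG.le.trans hGGt)), ∃ ψ₀ : Irr N,
      ψ.LiesOver (Subgroup.inclusion (le_normalizerIn (hNG.le.trans hGGt))) ψ₀ ∧
      ψ₀.inertia ⊔ G = (Gt ⊓ (ψ₀.inertia ⊔ G)) ⊔ (D ⊓ (ψ₀.inertia ⊔ G)) ∧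
      ψ₀.ExtendsTo ((G ⊔ D) ⊓ ψ₀.inertia)) :
    InductiveMcKayCondition S p := by
  have hNG' := hNG.le
  have hQG : Q ≤ G := by
    obtain ⟨P, rfl⟩ := hQ
    exact Subgroup.map_subtype_le _
  have hQN' : Q ≤ N := fun x hx => hQN ⟨hQG hx, Subgroup.le_normalizer hx⟩
  -- `N` is its own normalizer in `G`, because it contains the normalizer of a Sylow subgroup.
  have hinter : ∀ x ∈ G, x ∈ Subgroup.normalizer (N : Set Γ) → x ∈ N := by
    intro x hxG hx
    obtain ⟨g, hg, h1⟩ := exists_mem_normalizer_of_sylow hQ hQN' hx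
    have h2 := hQN ⟨G.mul_mem (G.inv_mem (hNG' hg)) hxG, h1⟩
    exact (N.mul_mem_cancel_left (N.inv_mem hg)).1 h2
  let _ : CommGroup (Gt ⧸ G.subgroupOf Gt) :=
    { QuotientGroup.Quotient.group (G.subgroupOf Gt) with mul_comm := hab }
  have hΩ' : CharacterBijection p hGGt hNG' (QuotientGroup.mk' (G.subgroupOf Gt)) Ω :=
    { ker := fun y => QuotientGroup.eq_one_iff y
      frattini := fun x => by
        obtain ⟨g, hg, h1⟩ := exists_mem_normalizer_of_sylow hQ hQG
          (mem_normalizer_of_normal G x)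
        exact ⟨g, hg, hN _ h1⟩
      inter := hinter
      extendsG := hmaxG
      extendsN := hmaxN
      bijOn := hΩ
      equivariant := fun x hx χ hχ => by
        -- Equivariance is given only for elements normalizing `Q`. An element normalizing `N`
        -- differs from one of these by an element of `N`, which acts trivially on both sets of
        -- characters.
        obtain ⟨g, hg, h1⟩ := exists_mem_normalizer_of_sylow hQ hQN' hx
        have hgt : g ∈ normalizerIn Gt N := ⟨hGGt (hNG' hg), Subgroup.le_normalizer hg⟩
        have h2 := Irr.conj_of_mem (χ.conj _ (mem_normalizer_of_normal Gt (g⁻¹ * x))) hgt.1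
        have h3 := Irr.conj_of_mem
          ((Ω χ).conj _ (mem_normalizer_normalizerIn Gt (hN _ h1))) hgt
        rw [Irr.conj_conj] at h2 h3
        simp only [mul_inv_cancel_left] at h2 h3
        rw [h2, h3, hΩequiv _ h1 χ hχ]
      twist := fun χ hχ l => hΩtwist χ hχ _ fun x hx => by
        rw [MonoidHom.mem_ker, MonoidHom.comp_apply, QuotientGroup.mk'_apply,
          (QuotientGroup.eq_one_iff x).2 hx, map_one] }
  have hGtD' : Gt ⊓ D = ⊥ := hGtD.disjoint.eq_bot
  have hD : ∀ x ∈ Gt, x ∈ G ⊔ D → x ∈ G := by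
    intro x hx hxD
    obtain ⟨g, hg, d, hd, rfl⟩ := Subgroup.mem_sup_of_normal_left.1 hxD
    have h1 : d ∈ Gt ⊓ D := ⟨(Gt.mul_mem_cancel_left (hGGt hg)).1 hx, hd⟩
    rw [hGtD', Subgroup.mem_bot] at h1
    rwa [h1, mul_one]
  -- Good pairs carry the parallel representations along, so these remain available, up to
  -- conjugation, for every pair of the resulting bijection.
  obtain ⟨f, hf, hfe, hfg⟩ := hΩ'.exists_bijOn
    (fun χ ψ => (χ.IsPPrime p ∧ ψ.IsPPrime p) ∧ Linked hGGt hNG' p Ω χ ψ ∧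
      χ.inertia = ψ.inertia ⊔ G ∧
      ∃ (n m : ℕ) (ρ P : Γ → Matrix (Fin n) (Fin n) ℂ) (P' : Γ → Matrix (Fin m) (Fin m) ℂ),
        ParallelProjReps χ ψ ρ P P') (fun _ _ h => h.1) (fun _ _ h => h.2.1)
    (fun _ _ h => h.2.2.1) fun X hX => by
      obtain ⟨χ, hχ, hXχ, hχs, hχe⟩ := hglobal X hX
      obtain ⟨ψ, hXψ, hψs, hψe⟩ := hlocal _ (hΩ.mapsTo hX)
      have hl : Linked hGGt hNG' p Ω χ ψ := ⟨X, hX, hXχ, hXψ⟩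
      have hχψ := hΩ'.inertia_eq_sup hl hGtD' hχs hψs
      exact ⟨χ, ψ, ⟨⟨hχ, hΩ.mapsTo hX ψ hXψ⟩, hl, hχψ,
        hΩ'.exists_parallelProjReps hX hXχ hXψ hD hχψ hψs hχe hψe hcent fun ν hν =>
          ((hΩcentral ν).le ⟨X, ⟨hX, hν⟩, rfl⟩).2⟩, hXχ, hXψ⟩
  obtain ⟨P, hPQ⟩ := hQ
  have hP : Q.subgroupOf G = P := by
    rw [← hPQ]
    exact Subgroup.comap_map_eq_self_of_injective G.subtype_injective _
  have hPN : Subgroup.normalizer ((P : Subgroup G) : Set G) ≤ N.subgroupOf G := by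
    intro g hg
    refine hQN ⟨g.2, mem_normalizer_of_map_conjNormal hQG ?_⟩
    rw [hP, Subgroup.subtype_apply, MulAut.conjNormal_val]
    exact congrArg Sylow.toSubgroup (Sylow.smul_eq_iff_mem_normalizer.2 hg)
  have hstab : ∀ x : Γ, (P : Subgroup G).map
      (MulAut.conjNormal (H := G) x : G ≃* G).toMonoidHom = P →
      x ∈ Subgroup.normalizer (N : Set Γ) := fun x hx =>
    hN x (mem_normalizer_of_map_conjNormal hQG (by rwa [hP]))
  have hcohom : ∀ χ : Irr G, χ.IsPPrime p →
      Cohom ((Subgroup.center_le_normalizer _).trans hPN) χ ((f χ).subgroupOf hNG') := by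
    intro χ hχ
    obtain ⟨x, hx, χ₀, ψ₀, ⟨-, -, hχψ, n, m, ρ, R, R', hR⟩, rfl, h2⟩ := hfg χ hχ
    rw [h2]
    refine (hR.conj_reps hx).cohom hπ hAut (fun y hy => ?_) hNG' _
    rw [Irr.mem_inertia_conj_iff, Irr.mem_inertia_conj_iff]
    exact hΩ'.mem_inertia_iff_of_eq_sup hχψ
      (Subgroup.mul_mem _ (Subgroup.mul_mem _ (Subgroup.inv_mem _ hx) hy) hx)
  have hbij : Set.BijOn (fun χ => (f χ).subgroupOf hNG') {χ : Irr G | χ.IsPPrime p}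
      {ψ | ψ.IsPPrime p} := by
    refine ⟨fun χ hχ => hf.mapsTo hχ, fun χ hχ χ' hχ' h =>
      hf.injOn hχ hχ' (Irr.subgroupOf_injective hNG' h), fun θ hθ => ?_⟩
    obtain ⟨ψ, rfl⟩ := Irr.subgroupOf_surjective hNG' θ
    obtain ⟨χ, hχ, rfl⟩ := hf.surjOn hθ
    exact ⟨χ, hχ, rfl⟩
  refine ⟨G, inferInstance, inferInstance, π, P, N.subgroupOf G, hPN, fun σ hσ => ?_,
    fun χ => (f χ).subgroupOf hNG', hπ, ?_, hbij, fun σ hσ χ hχ => ?_, fun ν => ?_, hcohom⟩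
  · obtain ⟨x, rfl⟩ := hAut σ
    exact map_conjNormal_subgroupOf (hstab x hσ)
  · rw [Ne, Subgroup.subgroupOf_eq_top]
    exact hNG.not_ge
  · obtain ⟨x, rfl⟩ := hAut σ
    rw [restrictAut_conjNormal_smul _ hNG' _ (hstab x hσ), conjNormal_smul,
      ← hfe x (hstab x hσ) χ hχ]
  -- The compatibility with characters of the centre is part of `Cohom`, already known for each
  -- pair.
  · ext θ
    constructor
    · rintro ⟨χ, ⟨hχ, hν⟩, rfl⟩
      exact ⟨hbij.mapsTo hχ, ((hcohom χ hχ).central ν).1 hν⟩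
    · rintro ⟨hθ, hν⟩
      obtain ⟨χ, hχ, rfl⟩ := hbij.surjOn hθ
      exact ⟨χ, ⟨hχ, ((hcohom χ hχ).central ν).2 hν⟩, rfl⟩

end
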